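/- **Infeasible Uniform Approximation.** For each sample size $n$ consider the linear instrumental-variables model with one endogenous regressor $$y_i = x_i\beta + \varepsilon_i,\qquad x_i=\Pi_i+v_i,\qquad i=1,\dots,n,$$ conditionally on the instruments, which are treated as fixed: $\Pi_i=\mathbb E[x_i]$ is a real number, the pairs $(\varepsilon_i,v_i)$ are independent across $i$ (not necessarily identically distributed), square-integrable and have mean zero. All objects, including $\beta$, may depend on $n$. Let $H=[h_{ij}]\in\mathbb R^{n\times n}$ be a non-random matrix with $h_{ii}=0$. For the hypothesised value $\beta_0\in\mathbb R$ put $$\varepsilon_i(\beta_0)=y_i-x_i\beta_0,\quad \rho_i=\frac{\operatorname{Cov}(\varepsilon_i(\beta_0),x_i)}{\operatorname{Var}(\varepsilon_i(\beta_0))},\quad r_i=x_i-\rho_i\varepsilon_i(\beta_0),\quad \widehat\Pi^I_i=\sum_{j\ne i}h_{ij}r_j,$$ $\eta_i=(\beta-\beta_0)v_i+\varepsilon_i$, $\zeta_i=v_i-\rho_i\eta_i$, and $s_n>0$ with $s_n^{-2}=\max_i\mathbb E[(\widehat\Pi^I_i)^2]$. The infeasible statistic (which uses the true $\rho_i$)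 is $$JK_I(\beta_0)=\frac{\big(\sum_i\varepsilon_i(\beta_0)\widehat\Pi^I_i\big)^2}{\sum_i\varepsilon_i(\beta_0)^2(\widehat\Pi^I_i)^2}\,\mathbf 1\Big\{\sum_i\varepsilon_i(\beta_0)^2(\widehat\Pi^I_i)^2>0\Big\}$$ (read as $0$ when the denominator vanishes). Let $(\tilde\varepsilon_i,\tilde r_i)$, $i=1,\dots,n$, be independent jointly Gaussian pairs with the same means and covariance matrices as $(\varepsilon_i(\beta_0),r_i)$, put $\tilde\Pi_i=\sum_{j\ne i}h_{ij}\tilde r_j$, and $$JK_G(\beta_0)=\frac{\big(\sum_i\tilde\varepsilon_i\tilde\Pi_i\big)^2}{\sum_i\mathbb E[\varepsilon_i(\beta_0)^2]\,\tilde\Pi_i^2}.$$ Suppose there is a constant $c>1$, not depending on $n$, such that for all sufficiently large $n$ the following hold. 1. (Moments) For every $i$, $|\Pi_i|+|\beta-\beta_0|+|\rho_i|\le c$, and $c^{-1}\le\mathbb E[|\eta_i|^l|\zeta_i|^k]\le c$ for all integers $l,k\ge0$ with $l+k\le6$. 2. (Balanced design) $c^{-1}\le\mathbb E\big[\frac{s_n^2}{n}\sum_i(\widehat\Pi_i^I)^2\big]$;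 $\max_i s_n^2\sum_{j\ne i}h_{ji}^2\le c$; and $\sum_{k=2}^n\lambda_k^2(HH')\big/\sum_{k=1}^n\lambda_k^2(HH')\ge c^{-1}$, where $\lambda_k(HH')$ is the $k$-th largest eigenvalue of $HH'$. 3. (Local identification) $P:=(\beta-\beta_0)^2\,\mathbb E\big[\big(\frac{s_n}{\sqrt n}\sum_i\Pi_i\widehat\Pi_i^I\big)^2\big]\le c$, and $\max_i\mathbb E\big[\big(s_n\sum_{j\ne i}h_{ji}\varepsilon_j(\beta_0)\big)^2\big]\le c$. Then $$\sup_{a\in\mathbb R}\big|\Pr(JK_I(\beta_0)\le a)-\Pr(JK_G(\beta_0)\le a)\big|\to0\qquad(n\to\infty).$$ -/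

import Mathlib

open MeasureTheory ProbabilityTheory Filter Topology

noncomputable section

namespace JackknifeK

/-- A sample of size `n` from the linear instrumental-variables model with one endogenous
regressor, `y i = x i * β + ε i`, `x i = firstStage i + v i`, with independent observations.
The instruments are fixed (all probabilities are conditional on them): they enter through the
conditional means `firstStage i = E[x i]`, through the joint laws of the errors, which may differ
across `i`, and through the hat matrix `H`, an arbitrary real matrix with zero diagonal. -/
structure IVSample {Ω : Type*} [MeasurableSpace Ω] (μ : Measure Ω) (n : ℕ) where
  /-- the true structural parameter -/
  β : ℝ
  /-- the conditional means of the endogenous regressor -/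
  firstStage : Fin n → ℝ
  /-- the structural errors -/
  ε : Fin n → Ω → ℝ
  /-- the first-stage errors -/
  v : Fin n → Ω → ℝ
  /-- the hat matrix -/
  H : Matrix (Fin n) (Fin n) ℝ
  measurable_ε : ∀ i, Measurable (ε i)
  measurable_v : ∀ i, Measurable (v i)
  memLp_ε : ∀ i, MemLp (ε i) 2 μ
  memLp_v : ∀ i, MemLp (v i) 2 μ
  mean_ε : ∀ i, ∫ ω, ε i ω ∂μ = 0
  mean_v : ∀ i, ∫ ω, v i ω ∂μ = 0
  indep : iIndepFun (fun i ω => (ε i ω, v i ω)) μ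
  H_diag : ∀ i, H i i = 0

namespace IVSample

variable {Ω : Type*} [MeasurableSpace Ω] {μ : Measure Ω} {n : ℕ}

/-- The endogenous regressor `x i`. -/
def x (S : IVSample μ n) (i : Fin n) (ω : Ω) : ℝ := S.firstStage i + S.v i ω

/-- The outcome `y i`. -/
def y (S : IVSample μ n) (i : Fin n) (ω : Ω) : ℝ := S.x i ω * S.β + S.ε i ω

/-- The null errors `ε i (β₀) = y i - x i * β₀`. -/
def nullErr (S : IVSample μ n) (β₀ : ℝ) (i : Fin n) (ω : Ω) : ℝ := S.y i ω - S.x i ω * β₀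

/-- The slope `ρ i = Cov(ε i (β₀), x i) / Var(ε i (β₀))`. -/
def rho (S : IVSample μ n) (β₀ : ℝ) (i : Fin n) : ℝ :=
  cov[S.nullErr β₀ i, S.x i; μ] / Var[S.nullErr β₀ i; μ]

/-- The partialled-out regressor `r i = x i - ρ i * ε i (β₀)`. -/
def r (S : IVSample μ n) (β₀ : ℝ) (i : Fin n) (ω : Ω) : ℝ :=
  S.x i ω - S.rho β₀ i * S.nullErr β₀ i ω

/-- The centred null error `η i`. -/
def eta (S : IVSample μ n) (β₀ : ℝ) (i : Fin n) (ω : Ω) : ℝ :=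
  (S.β - β₀) * S.v i ω + S.ε i ω

/-- The centred partialled-out regressor `ζ i`. -/
def zeta (S : IVSample μ n) (β₀ : ℝ) (i : Fin n) (ω : Ω) : ℝ :=
  S.v i ω - S.rho β₀ i * S.eta β₀ i ω

/-- The infeasible (true `ρ`) jackknife first-stage estimate `∑_{j ≠ i} h_{ij} r_j`. -/
def fitI (S : IVSample μ n) (β₀ : ℝ) (i : Fin n) (ω : Ω) : ℝ :=
  ∑ j with j ≠ i, S.H i j * S.r β₀ j ω

/-- The infeasible jackknife K-statistic. -/
def JKI (S : IVSample μ n) (β₀ : ℝ) (ω : Ω) : ℝ :=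
  (∑ i, S.nullErr β₀ i ω * S.fitI β₀ i ω) ^ 2
      / (∑ i, S.nullErr β₀ i ω ^ 2 * S.fitI β₀ i ω ^ 2)
    * (if 0 < ∑ i, S.nullErr β₀ i ω ^ 2 * S.fitI β₀ i ω ^ 2 then 1 else 0)

/-- The scaling factor `s_n > 0`, with `s_n⁻² = max_i E[(fitI i)²]`. -/
def scale (S : IVSample μ n) (β₀ : ℝ) : ℝ :=
  (Real.sqrt (⨆ i, ∫ ω, S.fitI β₀ i ω ^ 2 ∂μ))⁻¹

/-- Moment conditions with constant `c`. -/
structure MomentCond (S : IVSample μ n) (β₀ c : ℝ) : Prop where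
  bounded : ∀ i, |S.firstStage i| + |S.β - β₀| + |S.rho β₀ i| ≤ c
  integrable : ∀ i, ∀ l k : ℕ, l + k ≤ 6 →
    Integrable (fun ω => |S.eta β₀ i ω| ^ l * |S.zeta β₀ i ω| ^ k) μ
  lower : ∀ i, ∀ l k : ℕ, l + k ≤ 6 →
    c⁻¹ ≤ ∫ ω, |S.eta β₀ i ω| ^ l * |S.zeta β₀ i ω| ^ k ∂μ
  upper : ∀ i, ∀ l k : ℕ, l + k ≤ 6 →
    ∫ ω, |S.eta β₀ i ω| ^ l * |S.zeta β₀ i ω| ^ k ∂μ ≤ c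

/-- The eigenvalues of `H Hᵀ` in decreasing order, with multiplicity; index `k` (from `0`)
is the `(k+1)`-st largest. -/
def eigHHt (H : Matrix (Fin n) (Fin n) ℝ) : Fin (Fintype.card (Fin n)) → ℝ :=
  Matrix.IsHermitian.eigenvalues₀ (A := H * H.transpose)
    (Matrix.isHermitian_mul_conjTranspose_self H)

/-- Balanced design with constant `c`. -/
structure BalancedDesign (S : IVSample μ n) (β₀ c : ℝ) : Prop where
  average : c⁻¹ ≤ ∫ ω, S.scale β₀ ^ 2 / n * ∑ i, S.fitI β₀ i ω ^ 2 ∂μ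
  leverage : ∀ i, S.scale β₀ ^ 2 * ∑ j with j ≠ i, S.H j i ^ 2 ≤ c
  eigen : c⁻¹ ≤ (∑ k with 1 ≤ k.val, eigHHt S.H k ^ 2) / ∑ k, eigHHt S.H k ^ 2

/-- The local power index `P`. -/
def powerIndex (S : IVSample μ n) (β₀ : ℝ) : ℝ :=
  (S.β - β₀) ^ 2 *
    ∫ ω, (S.scale β₀ / Real.sqrt n * ∑ i, S.firstStage i * S.fitI β₀ i ω) ^ 2 ∂μ

/-- Local identification with constant `c`. -/
structure LocalIdentification (S : IVSample μ n) (β₀ c : ℝ) : Prop where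
  power : S.powerIndex β₀ ≤ c
  means : ∀ i, ∫ ω, (S.scale β₀ * ∑ j with j ≠ i, S.H j i * S.nullErr β₀ j ω) ^ 2 ∂μ ≤ c

variable {Ω' : Type*} [MeasurableSpace Ω']

/-- `(εt i, rt i)` are Gaussian analogues of `(ε i (β₀), r i)`: jointly Gaussian pairs,
independent across `i`, with the same means and covariance matrices. They may live on a
probability space of their own, or on that of the data (independently of the data or not): only
their joint law matters. -/
structure IsGaussianAnalogue (S : IVSample μ n) (β₀ : ℝ) (ν : Measure Ω')
    (εt rt : Fin n → Ω' → ℝ) : Prop where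
  measurable_ε : ∀ i, Measurable (εt i)
  measurable_r : ∀ i, Measurable (rt i)
  gaussian : ∀ i, HasGaussianLaw (fun ω => (εt i ω, rt i ω)) ν
  indep : iIndepFun (fun i ω => (εt i ω, rt i ω)) ν
  mean_ε : ∀ i, ∫ ω, εt i ω ∂ν = ∫ ω, S.nullErr β₀ i ω ∂μ
  mean_r : ∀ i, ∫ ω, rt i ω ∂ν = ∫ ω, S.r β₀ i ω ∂μ
  var_ε : ∀ i, Var[εt i; ν] = Var[S.nullErr β₀ i; μ]
  var_r : ∀ i, Var[rt i; ν] = Var[S.r β₀ i; μ]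
  cov_εr : ∀ i, cov[εt i, rt i; ν] = cov[S.nullErr β₀ i, S.r β₀ i; μ]

/-- The Gaussian first-stage estimate `∑_{j ≠ i} h_{ij} rt_j`. -/
def fitG (S : IVSample μ n) (rt : Fin n → Ω' → ℝ) (i : Fin n) (ω : Ω') : ℝ :=
  ∑ j with j ≠ i, S.H i j * rt j ω

/-- The Gaussian analogue of the jackknife K-statistic. -/
def JKG (S : IVSample μ n) (β₀ : ℝ) (εt rt : Fin n → Ω' → ℝ) (ω : Ω') : ℝ :=
  (∑ i, εt i ω * S.fitG rt i ω) ^ 2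
    / ∑ i, (∫ ω', S.nullErr β₀ i ω' ^ 2 ∂μ) * S.fitG rt i ω ^ 2

end IVSample

end JackknifeK

end

/-! Write N = s n^(-1/2) Σ ε_i(β₀) Π̂_i and D = s² n^(-1) Σ ε_i(β₀)² Π̂_i². For a ≥ 0 the sublevel
set of the statistic is {N² ≤ aD}, also where D = 0, since there N = 0 as well. It therefore
suffices to compare the joint law of (N, D) with that of its Gaussian analogue on such sets.

The comparison is Lindeberg's. Each observation is recorded as a triple (e, f, r), with f = e² for
the data and f = E[e²] for the analogue. Because h_jj = 0, replacing triple j moves (N, D) from a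
base point by t(e u + r v) + t²(f u' + r² v'), where t = n^(-1/2) and the base point and u, v, u',
v' are free of triple j. Up to order t², the expectation of a smooth function sees only the means of
e, f, r, e², r² and er. These agree: f enters only at order t², hence only through its mean, which
is why ε² may be replaced by its expectation; and E[er] factorises on both sides because r is the
residual of x regressed on e. The remainder is t³ times cubes of u, v, u', v', whose expectations
are bounded through sixth moments (`RegularDesign.integral_influence_le`). The n swaps together cost
O(n^(-1/2)): `RegularDesign.abs_integral_pi_sub_le`.

Passing from smooth functions to events needs anti-concentration on the Gaussian side only
(`RegularDesign.anticoncentration`). There e and r are independent. Given r, the denominator is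
constant and N is Gaussian with variance at least a fixed multiple of it. The denominator may stay
random in the limit, but it is rarely close to 0, by a small-ball estimate for each fit. Hence N² is
rarely within κ of aD, uniformly in a. With tightness of N and D this yields closeness at each fixed
a (`exists_pointwise_comparison`). The sample size needed there depends on a, so uniformity comes
from monotonicity and a finite grid (`exists_uniform_comparison`). -/

/-! ### Taylor estimates, and replacement of one factor of a product measure -/

theorem abs_taylor_two_le {φ φ' φ'' : ℝ → ℝ} {C : ℝ} (hC : 0 ≤ C)
    (h0 : ∀ t, HasDerivAt φ (φ' t) t) (h1 : ∀ t, HasDerivAt φ' (φ'' t) t)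
    (h2 : ∀ t ∈ Set.Icc (0 : ℝ) 1, |φ'' t - φ'' 0| ≤ C) :
    |φ 1 - φ 0 - φ' 0 - φ'' 0 / 2| ≤ C := by
  -- The mean value inequality is used twice: here for φ' minus its affine part at 0, then for φ
  -- minus its quadratic part. Sharp constants are not needed.
  have k1 : ∀ t ∈ Set.Icc (0:ℝ) 1, ‖φ' t - t * φ'' 0 - φ' 0‖ ≤ C := by
    intro t ht
    have := norm_image_sub_le_of_norm_deriv_le_segment' (a := 0) (b := 1)
      (f := fun t : ℝ => φ' t - t * φ'' 0)
      (f' := fun t => φ'' t - φ'' 0) (C := C)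
      (fun x _ => by
        have hq : HasDerivAt (fun t : ℝ => t * φ'' 0) (φ'' 0) x := by
          simpa using (hasDerivAt_id x).mul_const (φ'' 0)
        exact ((h1 x).sub hq).hasDerivWithinAt)
      (fun x hx => h2 x ⟨hx.1, hx.2.le⟩) t ht
    simp only [zero_mul, sub_zero] at this
    exact this.trans (mul_le_of_le_one_right hC ht.2)
  have k2 := norm_image_sub_le_of_norm_deriv_le_segment' (a := 0) (b := 1)
      (f := fun t : ℝ => φ t - t ^ 2 / 2 * φ'' 0 - t * φ' 0)
      (f' := fun t => φ' t - t * φ'' 0 - φ' 0) (C := C)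
      (fun x _ => by
        have hq : HasDerivAt (fun t : ℝ => t ^ 2 / 2 * φ'' 0) (x * φ'' 0) x := by
          exact (((hasDerivAt_pow 2 x).div_const 2).mul_const (φ'' 0)).congr_deriv (by norm_num)
        have hl : HasDerivAt (fun t : ℝ => t * φ' 0) (φ' 0) x := by
          simpa using (hasDerivAt_id x).mul_const (φ' 0)
        exact (((h0 x).sub hq).sub hl).hasDerivWithinAt)
      (fun x hx => k1 x ⟨hx.1, hx.2.le⟩) 1 (by simp)
  rw [Real.norm_eq_abs, sub_zero, mul_one] at k2
  convert k2 using 2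
  ring

/-- Restriction to the segment t ↦ p + t w reduces to one variable: the second derivative there is
D₂(p + t w)(w, w), which varies by at most C‖w‖ · ‖w‖². -/
theorem abs_taylor_two_le_of_lipschitz {V : Type*} [NormedAddCommGroup V] [NormedSpace ℝ V]
    {g : V → ℝ} {D₁ : V → V →L[ℝ] ℝ} {D₂ : V → V →L[ℝ] V →L[ℝ] ℝ} {C : NNReal}
    (d0 : ∀ p, HasFDerivAt g (D₁ p) p) (d1 : ∀ p, HasFDerivAt D₁ (D₂ p) p)
    (hC : LipschitzWith C D₂) (p w : V) :
    |g (p + w) - g p - D₁ p w - D₂ p w w / 2| ≤ C * ‖w‖ ^ 3 := by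
  have hline : ∀ t : ℝ, HasDerivAt (fun t : ℝ => p + t • w) w t := by
    intro t
    simpa using ((hasDerivAt_id t).smul_const w).const_add p
  have hd0 : ∀ t : ℝ, HasDerivAt (fun t : ℝ => g (p + t • w)) (D₁ (p + t • w) w) t :=
    fun t => (d0 _).comp_hasDerivAt t (hline t)
  have hd1 : ∀ t : ℝ, HasDerivAt (fun t : ℝ => D₁ (p + t • w) w) (D₂ (p + t • w) w w) t := by
    intro t
    have hw : HasFDerivAt (fun q => D₁ q w)
        ((ContinuousLinearMap.apply ℝ ℝ w).comp (D₂ (p + t • w))) (p + t • w) :=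
      (ContinuousLinearMap.apply ℝ ℝ w).hasFDerivAt.comp (p + t • w) (d1 (p + t • w))
    exact hw.comp_hasDerivAt t (hline t)
  have hb : ∀ t ∈ Set.Icc (0:ℝ) 1, |D₂ (p + t • w) w w - D₂ (p + (0 : ℝ) • w) w w|
      ≤ C * ‖w‖ ^ 3 := by
    intro t ht
    rw [zero_smul, add_zero]
    have e : D₂ (p + t • w) w w - D₂ p w w = (D₂ (p + t • w) - D₂ p) w w := rfl
    rw [e]
    refine ((D₂ (p + t • w) - D₂ p).le_opNorm₂ w w).trans ?_
    have h4 := hC.norm_sub_le (p + t • w) p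
    have h3 : ‖p + t • w - p‖ ≤ ‖w‖ := by
      rw [add_sub_cancel_left, norm_smul, Real.norm_of_nonneg ht.1]
      exact mul_le_of_le_one_left (norm_nonneg _) ht.2
    calc _ ≤ (C * ‖w‖) * ‖w‖ * ‖w‖ := by
          gcongr
          exact h4.trans (by gcongr)
      _ = _ := by ring
  have := abs_taylor_two_le (by positivity) hd0 hd1 hb
  simpa only [one_smul, zero_smul, add_zero] using this

theorem exists_lipschitzWith_and_bound {V W : Type*} [NormedAddCommGroup V] [NormedSpace ℝ V]
    [NormedAddCommGroup W] [NormedSpace ℝ W] {G : V → W} (hG : ContDiff ℝ 1 G)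
    (hs : HasCompactSupport G) : ∃ (C : NNReal) (B : ℝ), LipschitzWith C G ∧ ∀ p, ‖G p‖ ≤ B := by
  obtain ⟨C, hC⟩ := hG.lipschitzWith_of_hasCompactSupport hs one_ne_zero
  obtain ⟨B, hB⟩ := hs.exists_bound_of_continuous hG.continuous
  exact ⟨C, B, hC, hB⟩

/-- Third-order Taylor estimate for a compactly supported smooth function. -/
theorem exists_taylor_bound {V : Type*} [NormedAddCommGroup V] [NormedSpace ℝ V]
    {g : V → ℝ} (hg : ContDiff ℝ 3 g) (hs : HasCompactSupport g) :
    ∃ (M : ℝ) (D₁ : V → V →L[ℝ] ℝ) (D₂ : V → V →L[ℝ] V →L[ℝ] ℝ), 0 ≤ M ∧ (∀ p, ‖D₂ p‖ ≤ M) ∧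
      ∀ p w, |g (p + w) - g p - D₁ p w - D₂ p w w / 2| ≤ M * ‖w‖ ^ 3 := by
  have h1 : ContDiff ℝ 2 (fderiv ℝ g) := hg.fderiv_right (by norm_num)
  have h2 : ContDiff ℝ 1 (fderiv ℝ (fderiv ℝ g)) := h1.fderiv_right (by norm_num)
  have s2 : HasCompactSupport (fderiv ℝ (fderiv ℝ g)) := (hs.fderiv ℝ).fderiv ℝ
  have key := exists_lipschitzWith_and_bound h2 s2
  obtain ⟨C, B, hC, hB⟩ := key
  have d0 : Differentiable ℝ g := hg.differentiable (by norm_num)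
  have d1 : Differentiable ℝ (fderiv ℝ g) := h1.differentiable (by norm_num)
  -- One constant serves as bound and as Lipschitz constant of the second derivative. The first
  -- derivative needs no bound: its contributions are integrated exactly and cancel between the two
  -- laws.
  refine ⟨max B C, fderiv ℝ g, fderiv ℝ (fderiv ℝ g), le_max_of_le_right C.2,
    fun p => (hB p).trans (le_max_left _ _), fun p w => ?_⟩
  refine (abs_taylor_two_le_of_lipschitz (fun p => (d0 p).hasFDerivAt)
    (fun p => (d1 p).hasFDerivAt) hC p w).trans ?_
  exact mul_le_mul_of_nonneg_right (le_max_right _ _) (by positivity)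

/-- Replacing one factor of a product measure. -/
theorem measurePreserving_update {ι : Type*} [Fintype ι] [DecidableEq ι] {E : Type*}
    [MeasurableSpace E] (R : ι → Measure E) [∀ i, IsProbabilityMeasure (R i)]
    (j : ι) (P : Measure E) [IsProbabilityMeasure P] :
    MeasurePreserving (fun q : (ι → E) × E => Function.update q.1 j q.2)
      ((Measure.pi R).prod P) (Measure.pi (Function.update R j P)) := by
  have hm : Measurable (fun q : (ι → E) × E => Function.update q.1 j q.2) := by
    refine measurable_pi_lambda _ fun i => ?_
    by_cases h : i = j
    · subst h; simpa using measurable_snd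
    · simpa [h, Function.comp_def] using (measurable_pi_apply (X := fun _ : ι => E) i).comp measurable_fst
  have hprob : ∀ i, IsProbabilityMeasure (Function.update R j P i) := by
    intro i
    by_cases h : i = j
    · subst h; simpa
    · simpa [h] using inferInstanceAs (IsProbabilityMeasure (R i))
  refine ⟨hm, (Measure.pi_eq fun s hs => ?_).symm⟩
  rw [Measure.map_apply hm (MeasurableSet.univ_pi hs)]
  -- The preimage of a box is a box whose j-th side in the first factor is everything, so `R j`
  -- contributes mass one and `P` takes its place.
  have : (fun q : (ι → E) × E => Function.update q.1 j q.2) ⁻¹' (Set.univ.pi s)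
      = (Set.univ.pi (Function.update s j Set.univ)) ×ˢ (s j) := by
    ext q
    simp only [Set.mem_preimage, Set.mem_pi, Set.mem_univ, true_imp_iff, Set.mem_prod]
    constructor
    · intro h
      refine ⟨fun i => ?_, by simpa using h j⟩
      by_cases hi : i = j
      · subst hi; simp
      · simpa [hi] using h i
    · rintro ⟨h, h'⟩ i
      by_cases hi : i = j
      · subst hi; simpa using h'
      · simpa [hi] using h i
  rw [this, Measure.prod_prod, Measure.pi_pi, ← Finset.mul_prod_erase _ _ (Finset.mem_univ j),
    ← Finset.mul_prod_erase (a := j) _ _ (Finset.mem_univ j), mul_comm]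
  simp only [Function.update_self, measure_univ, one_mul]
  congr 1
  refine Finset.prod_congr rfl fun i hi => ?_
  simp [Finset.ne_of_mem_erase hi]

/-! ### Matched moments and the second-order expansion in one triple -/

namespace JackknifeK

/-- The sixth-moment bounds and the first and second moments of a triple `(e, f, r)`, in which `f`
plays the role of (a substitute for) `e ^ 2`. -/
structure TripleMoments (ρ : Measure (ℝ × ℝ × ℝ)) (K me ve mr vr : ℝ) : Prop where
  int_e : Integrable (fun y => y.1 ^ 6) ρ
  int_f : Integrable (fun y => |y.2.1| ^ 3) ρ
  int_r : Integrable (fun y => y.2.2 ^ 6) ρ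
  e_le : ∫ y, y.1 ^ 6 ∂ρ ≤ K
  f_le : ∫ y, |y.2.1| ^ 3 ∂ρ ≤ K
  r_le : ∫ y, y.2.2 ^ 6 ∂ρ ≤ K
  mean_e : ∫ y, y.1 ∂ρ = me
  mean_f : ∫ y, y.2.1 ∂ρ = me ^ 2 + ve
  mean_r : ∫ y, y.2.2 ∂ρ = mr
  sq_e : ∫ y, y.1 ^ 2 ∂ρ = me ^ 2 + ve
  sq_r : ∫ y, y.2.2 ^ 2 ∂ρ = mr ^ 2 + vr
  mul_er : ∫ y, y.1 * y.2.2 ∂ρ = me * mr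

theorem abs_le_one_add_pow_six (x : ℝ) : |x| ≤ 1 + x ^ 6 := by
  have h : x ^ 6 = |x| ^ 6 := by rw [← abs_pow, abs_of_nonneg (by positivity)]
  rw [h]
  rcases le_total |x| 1 with h | h
  · have : 0 ≤ |x| ^ 6 := by positivity
    linarith
  · have := le_self_pow₀ h (n := 6) (by norm_num)
    linarith

theorem sq_le_one_add_pow_six (x : ℝ) : x ^ 2 ≤ 1 + x ^ 6 := by
  have := sq_nonneg (x ^ 2); have := sq_nonneg (x ^ 2 - 1); nlinarith [sq_nonneg (x ^ 3), sq_nonneg x]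

theorem abs_cube_le_one_add_pow_six (x : ℝ) : |x| ^ 3 ≤ 1 + x ^ 6 := by
  have h : x ^ 6 = (|x| ^ 3) ^ 2 := by
    rw [← pow_mul, ← abs_pow, abs_of_nonneg (Even.pow_nonneg (by decide) x)]
  rw [h]
  nlinarith [sq_nonneg (|x| ^ 3 - 1), sq_nonneg (|x| ^ 3)]

theorem le_one_add_cube {x : ℝ} (hx : 0 ≤ x) : x ≤ 1 + x ^ 3 := by
  nlinarith [sq_nonneg (x - 1), mul_nonneg hx (sq_nonneg (x - 1)), mul_nonneg hx hx]

theorem add_four_cube_le {a b c d : ℝ} (ha : 0 ≤ a) (hb : 0 ≤ b) (hc : 0 ≤ c) (hd : 0 ≤ d) :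
    (a + b + c + d) ^ 3 ≤ 16 * (a ^ 3 + b ^ 3 + c ^ 3 + d ^ 3) := by
  have h2 : ∀ x y : ℝ, 0 ≤ x → 0 ≤ y → (x + y) ^ 3 ≤ 4 * (x ^ 3 + y ^ 3) := by
    intro x y hx hy
    nlinarith [mul_nonneg (add_nonneg hx hy) (sq_nonneg (x - y))]
  have h := h2 (a + b) (c + d) (by positivity) (by positivity)
  have h' := h2 a b ha hb
  have h'' := h2 c d hc hd
  calc (a + b + c + d) ^ 3 = (a + b + (c + d)) ^ 3 := by ring
    _ ≤ _ := by linarith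

section
variable {ρ : Measure (ℝ × ℝ × ℝ)} [IsProbabilityMeasure ρ] {K me ve mr vr : ℝ}

theorem TripleMoments.integrable_e (h : TripleMoments ρ K me ve mr vr) :
    Integrable (fun y : ℝ × ℝ × ℝ => y.1) ρ :=
  ((integrable_const 1).add h.int_e).mono' (by fun_prop)
    (ae_of_all _ fun y => abs_le_one_add_pow_six _)

theorem TripleMoments.integrable_f (h : TripleMoments ρ K me ve mr vr) :
    Integrable (fun y : ℝ × ℝ × ℝ => y.2.1) ρ :=
  ((integrable_const 1).add h.int_f).mono' (by fun_prop)
    (ae_of_all _ fun y => le_one_add_cube (abs_nonneg _))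

theorem TripleMoments.integrable_r (h : TripleMoments ρ K me ve mr vr) :
    Integrable (fun y : ℝ × ℝ × ℝ => y.2.2) ρ :=
  ((integrable_const 1).add h.int_r).mono' (by fun_prop)
    (ae_of_all _ fun y => abs_le_one_add_pow_six _)

theorem TripleMoments.integrable_e_sq (h : TripleMoments ρ K me ve mr vr) :
    Integrable (fun y : ℝ × ℝ × ℝ => y.1 ^ 2) ρ :=
  ((integrable_const 1).add h.int_e).mono' (by fun_prop)
    (ae_of_all _ fun y => by
      rw [Real.norm_of_nonneg (by positivity)]; exact sq_le_one_add_pow_six _)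

theorem TripleMoments.integrable_r_sq (h : TripleMoments ρ K me ve mr vr) :
    Integrable (fun y : ℝ × ℝ × ℝ => y.2.2 ^ 2) ρ :=
  ((integrable_const 1).add h.int_r).mono' (by fun_prop)
    (ae_of_all _ fun y => by
      rw [Real.norm_of_nonneg (by positivity)]; exact sq_le_one_add_pow_six _)

theorem TripleMoments.integrable_mul (h : TripleMoments ρ K me ve mr vr) :
    Integrable (fun y : ℝ × ℝ × ℝ => y.1 * y.2.2) ρ :=
  (h.integrable_e_sq.add h.integrable_r_sq).mono' (by fun_prop)
    (ae_of_all _ fun y => by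
      rw [Real.norm_eq_abs, Pi.add_apply, abs_mul, ← sq_abs y.1, ← sq_abs y.2.2]
      nlinarith [sq_nonneg (|y.1| - |y.2.2|), sq_nonneg (|y.1|), sq_nonneg |y.2.2|])

/-- Integral of a polynomial of the matched moments. -/
theorem TripleMoments.hasIntegral_poly (h : TripleMoments ρ K me ve mr vr)
    (c₀ c₁ c₂ c₃ c₄ c₅ c₆ : ℝ) :
    Integrable (fun y : ℝ × ℝ × ℝ => c₀ + c₁ * y.1 + c₂ * y.2.2 + c₃ * y.2.1 + c₄ * y.2.2 ^ 2
      + c₅ * y.1 ^ 2 + c₆ * (y.1 * y.2.2)) ρ ∧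
    ∫ y, (c₀ + c₁ * y.1 + c₂ * y.2.2 + c₃ * y.2.1 + c₄ * y.2.2 ^ 2
      + c₅ * y.1 ^ 2 + c₆ * (y.1 * y.2.2)) ∂ρ
      = c₀ + c₁ * me + c₂ * mr + c₃ * (me ^ 2 + ve) + c₄ * (mr ^ 2 + vr) + c₅ * (me ^ 2 + ve)
        + c₆ * (me * mr) := by
  have i0 : Integrable (fun _ : ℝ × ℝ × ℝ => c₀) ρ := integrable_const _
  have i1 := i0.add (h.integrable_e.const_mul c₁)
  have i2 := i1.add (h.integrable_r.const_mul c₂)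
  have i3 := i2.add (h.integrable_f.const_mul c₃)
  have i4 := i3.add (h.integrable_r_sq.const_mul c₄)
  have i5 := i4.add (h.integrable_e_sq.const_mul c₅)
  have i6 := i5.add (h.integrable_mul.const_mul c₆)
  refine ⟨i6, ?_⟩
  refine (integral_add i5 (h.integrable_mul.const_mul c₆)).trans ?_
  rw [integral_const_mul, h.mul_er]; congr 1
  refine (integral_add i4 (h.integrable_e_sq.const_mul c₅)).trans ?_
  rw [integral_const_mul, h.sq_e]; congr 1
  refine (integral_add i3 (h.integrable_r_sq.const_mul c₄)).trans ?_
  rw [integral_const_mul, h.sq_r]; congr 1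
  refine (integral_add i2 (h.integrable_f.const_mul c₃)).trans ?_
  rw [integral_const_mul, h.mean_f]; congr 1
  refine (integral_add i1 (h.integrable_r.const_mul c₂)).trans ?_
  rw [integral_const_mul, h.mean_r]; congr 1
  refine (integral_add i0 (h.integrable_e.const_mul c₁)).trans ?_
  rw [integral_const_mul, h.mean_e]; simp

variable {V : Type*} [NormedAddCommGroup V] [NormedSpace ℝ V]

/-- Pointwise error of the matched second-order expansion. -/
theorem abs_expansion_error_le {g : V → ℝ} {M : ℝ} {p : V} {L : V →L[ℝ] ℝ}
    {B : V →L[ℝ] V →L[ℝ] ℝ} (hM : 0 ≤ M) (hB : ‖B‖ ≤ M)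
    (hT : ∀ w, |g (p + w) - g p - L w - B w w / 2| ≤ M * ‖w‖ ^ 3)
    {w c : V} {t α γ : ℝ} (ht : 0 ≤ t) (ht1 : t ≤ 1) (hγ : 0 ≤ γ)
    (hα : 0 ≤ α) (hw : ‖w‖ ≤ t * α) (hc : ‖c‖ ≤ t ^ 2 * γ) :
    |g (p + (w + c)) - (g p + L (w + c) + B w w / 2)| ≤ 3 * M * t ^ 3 * (1 + (α + γ) ^ 3) := by
  have h1 := hT (w + c)
  have hsum : ‖w + c‖ ≤ t * (α + γ) := by
    refine (norm_add_le _ _).trans ?_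
    nlinarith [mul_nonneg (mul_nonneg ht hγ) (sub_nonneg.2 ht1)]
  have hBB : ∀ a b : V, |B a b| ≤ M * ‖a‖ * ‖b‖ := fun a b =>
    (B.le_opNorm₂ a b).trans (by gcongr)
  -- Here w has order t and c has order t². Only B(w, w) has order t²; the other three terms have
  -- order at least t³ and join the remainder.
  have e : B (w + c) (w + c) = B w w + (B w c + B c w + B c c) := by
    simp only [map_add, add_apply]; ring
  have h2 : |B w c + B c w + B c c| ≤ M * t ^ 3 * (2 * α * γ + γ ^ 2) := by
    have b1 : ‖w‖ * ‖c‖ ≤ t ^ 3 * (α * γ) := by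
      calc ‖w‖ * ‖c‖ ≤ (t * α) * (t ^ 2 * γ) := by gcongr
        _ = _ := by ring
    have b2 : ‖c‖ * ‖c‖ ≤ t ^ 3 * (γ ^ 2) := by
      calc ‖c‖ * ‖c‖ ≤ (t ^ 2 * γ) * (t ^ 2 * γ) := by gcongr
        _ = t * (t ^ 3 * γ ^ 2) := by ring
        _ ≤ _ := mul_le_of_le_one_left (by positivity) ht1
    have a1 := hBB w c
    have a2 := hBB c w
    have a3 := hBB c c
    have a4 : |B w c + B c w + B c c| ≤ |B w c| + |B c w| + |B c c| := abs_add_three _ _ _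
    calc _ ≤ M * (‖w‖ * ‖c‖) + M * (‖w‖ * ‖c‖) + M * (‖c‖ * ‖c‖) := by
          linarith [mul_comm ‖w‖ ‖c‖, mul_assoc M ‖w‖ ‖c‖, mul_assoc M ‖c‖ ‖c‖,
            mul_assoc M ‖c‖ ‖w‖, show M * (‖w‖ * ‖c‖) = M * (‖c‖ * ‖w‖) by ring]
      _ ≤ M * (t ^ 3 * (α * γ)) + M * (t ^ 3 * (α * γ)) + M * (t ^ 3 * (γ ^ 2)) := by gcongr
      _ = _ := by ring
  have h3 : ‖w + c‖ ^ 3 ≤ t ^ 3 * (α + γ) ^ 3 := by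
    rw [← mul_pow]; gcongr
  have h4 : 2 * α * γ + γ ^ 2 ≤ 2 * (1 + (α + γ) ^ 3) := by
    have h5 : (α + γ) ^ 2 ≤ 1 + (α + γ) ^ 3 := by
      have : 0 ≤ α + γ := by positivity
      nlinarith [sq_nonneg (α + γ - 1), mul_nonneg this (sq_nonneg (α + γ - 1))]
    nlinarith [sq_nonneg α, sq_nonneg γ, mul_nonneg hα hγ]
  have hX : 0 ≤ M * t ^ 3 := by positivity
  rw [e] at h1
  calc _ = |(g (p + (w + c)) - g p - L (w + c) - (B w w + (B w c + B c w + B c c)) / 2)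
          + (B w c + B c w + B c c) / 2| := by congr 1; ring
    _ ≤ M * ‖w + c‖ ^ 3 + |B w c + B c w + B c c| / 2 := by
        refine (abs_add_le _ _).trans (add_le_add h1 ?_)
        rw [abs_div, abs_two]
    _ ≤ M * (t ^ 3 * (α + γ) ^ 3) + M * t ^ 3 * (2 * (1 + (α + γ) ^ 3)) / 2 := by
        gcongr
        exact h2.trans (by gcongr)
    _ ≤ _ := by
        have : 0 ≤ (α + γ) ^ 3 := by positivity
        nlinarith [mul_nonneg hX this]

/-- Comparison of a smooth function of one replaced coordinate with its quadratic expansion. -/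
theorem TripleMoments.abs_integral_sub_le (h : TripleMoments ρ K me ve mr vr)
    [MeasurableSpace V] [BorelSpace V] [SecondCountableTopology V] {g : V → ℝ} {M : ℝ} {p : V}
    (hg : Continuous g) (hgb : ∃ C, ∀ v, ‖g v‖ ≤ C) {L : V →L[ℝ] ℝ}
    {B : V →L[ℝ] V →L[ℝ] ℝ} (hM : 0 ≤ M) (hB : ‖B‖ ≤ M)
    (hT : ∀ w, |g (p + w) - g p - L w - B w w / 2| ≤ M * ‖w‖ ^ 3)
    {t : ℝ} (ht : 0 ≤ t) (ht1 : t ≤ 1) (u v u' v' : V) :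
    |∫ y, g (p + (t • (y.1 • u + y.2.2 • v) + t ^ 2 • (y.2.1 • u' + y.2.2 ^ 2 • v'))) ∂ρ
      - (g p + t * L u * me + t * L v * mr + t ^ 2 * L u' * (me ^ 2 + ve)
        + (t ^ 2 * L v' + t ^ 2 * B v v / 2) * (mr ^ 2 + vr) + t ^ 2 * B u u / 2 * (me ^ 2 + ve)
        + t ^ 2 * (B u v + B v u) / 2 * (me * mr))|
      ≤ 48 * M * (1 + K) * t ^ 3 * (1 + ‖u‖ ^ 3 + ‖v‖ ^ 3 + ‖u'‖ ^ 3 + ‖v'‖ ^ 3) := by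
  obtain ⟨C, hC⟩ := hgb
  -- The coefficients are those of the expansion to order t²: the linear form acts on the whole
  -- increment, the quadratic form only on its part of order t.
  obtain ⟨iT, eT⟩ := h.hasIntegral_poly (g p) (t * L u) (t * L v) (t ^ 2 * L u')
    (t ^ 2 * L v' + t ^ 2 * B v v / 2) (t ^ 2 * B u u / 2) (t ^ 2 * (B u v + B v u) / 2)
  have hcont : Continuous fun y : ℝ × ℝ × ℝ =>
      g (p + (t • (y.1 • u + y.2.2 • v) + t ^ 2 • (y.2.1 • u' + y.2.2 ^ 2 • v'))) := by fun_prop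
  have ig : Integrable (fun y : ℝ × ℝ × ℝ =>
      g (p + (t • (y.1 • u + y.2.2 • v) + t ^ 2 • (y.2.1 • u' + y.2.2 ^ 2 • v')))) ρ :=
    (integrable_const C).mono' hcont.aestronglyMeasurable (ae_of_all _ fun y => hC _)
  rw [← eT, ← integral_sub ig iT]
  -- In the majorant |e|³ and |r|³ are bounded by one plus a sixth power, whereas (r²)³ and |f|³
  -- appear as they are. This is why sixth moments of e and r and third moments of f are the natural
  -- requirement.
  have ib : Integrable (fun y : ℝ × ℝ × ℝ => 3 * M * t ^ 3 * (1 + 16 * (‖u‖ ^ 3 * (1 + y.1 ^ 6)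
      + ‖v‖ ^ 3 * (1 + y.2.2 ^ 6) + ‖u'‖ ^ 3 * |y.2.1| ^ 3 + ‖v'‖ ^ 3 * y.2.2 ^ 6))) ρ := by
    refine Integrable.const_mul ((integrable_const _).add (Integrable.const_mul ?_ _)) _
    refine ((Integrable.add ?_ ?_).add ?_).add ?_
    · exact ((integrable_const _).add h.int_e).const_mul _
    · exact ((integrable_const _).add h.int_r).const_mul _
    · exact h.int_f.const_mul _
    · exact h.int_r.const_mul _
  have eb : ∫ y : ℝ × ℝ × ℝ, 3 * M * t ^ 3 * (1 + 16 * (‖u‖ ^ 3 * (1 + y.1 ^ 6)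
      + ‖v‖ ^ 3 * (1 + y.2.2 ^ 6) + ‖u'‖ ^ 3 * |y.2.1| ^ 3 + ‖v'‖ ^ 3 * y.2.2 ^ 6)) ∂ρ
      = 3 * M * t ^ 3 * (1 + 16 * (‖u‖ ^ 3 * (1 + ∫ y, y.1 ^ 6 ∂ρ)
      + ‖v‖ ^ 3 * (1 + ∫ y, y.2.2 ^ 6 ∂ρ) + ‖u'‖ ^ 3 * ∫ y, |y.2.1| ^ 3 ∂ρ
      + ‖v'‖ ^ 3 * ∫ y, y.2.2 ^ 6 ∂ρ)) := by
    have j0 : Integrable (fun _ : ℝ × ℝ × ℝ => (1 + 16 * (‖u‖ ^ 3 + ‖v‖ ^ 3))) ρ :=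
      integrable_const _
    have j1 := h.int_e.const_mul (16 * ‖u‖ ^ 3)
    have j2 := h.int_r.const_mul (16 * (‖v‖ ^ 3 + ‖v'‖ ^ 3))
    have j3 := h.int_f.const_mul (16 * ‖u'‖ ^ 3)
    have e : ∫ y : ℝ × ℝ × ℝ, (1 + 16 * (‖u‖ ^ 3 + ‖v‖ ^ 3) + 16 * ‖u‖ ^ 3 * y.1 ^ 6
        + 16 * (‖v‖ ^ 3 + ‖v'‖ ^ 3) * y.2.2 ^ 6 + 16 * ‖u'‖ ^ 3 * |y.2.1| ^ 3) ∂ρ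
        = 1 + 16 * (‖u‖ ^ 3 + ‖v‖ ^ 3) + 16 * ‖u‖ ^ 3 * ∫ y, y.1 ^ 6 ∂ρ
        + 16 * (‖v‖ ^ 3 + ‖v'‖ ^ 3) * ∫ y, y.2.2 ^ 6 ∂ρ
        + 16 * ‖u'‖ ^ 3 * ∫ y, |y.2.1| ^ 3 ∂ρ := by
      refine (integral_add ((j0.add j1).add j2) j3).trans ?_
      rw [integral_const_mul]; congr 1
      refine (integral_add (j0.add j1) j2).trans ?_
      rw [integral_const_mul]; congr 1
      refine (integral_add j0 j1).trans ?_
      rw [integral_const_mul]; congr 1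
      simp
    rw [integral_const_mul]
    congr 1
    refine Eq.trans (integral_congr_ae (ae_of_all _ fun y => ?_)) (e.trans ?_)
    · simp only; ring
    · ring
  have hle : ∀ y : ℝ × ℝ × ℝ, ‖g (p + (t • (y.1 • u + y.2.2 • v)
      + t ^ 2 • (y.2.1 • u' + y.2.2 ^ 2 • v'))) - (g p + t * L u * y.1 + t * L v * y.2.2
        + t ^ 2 * L u' * y.2.1 + (t ^ 2 * L v' + t ^ 2 * B v v / 2) * y.2.2 ^ 2
        + t ^ 2 * B u u / 2 * y.1 ^ 2 + t ^ 2 * (B u v + B v u) / 2 * (y.1 * y.2.2))‖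
      ≤ 3 * M * t ^ 3 * (1 + 16 * (‖u‖ ^ 3 * (1 + y.1 ^ 6)
      + ‖v‖ ^ 3 * (1 + y.2.2 ^ 6) + ‖u'‖ ^ 3 * |y.2.1| ^ 3 + ‖v'‖ ^ 3 * y.2.2 ^ 6)) := by
    intro y
    obtain ⟨e, f, r⟩ := y
    simp only
    have hw : ‖t • (e • u + r • v)‖ ≤ t * (|e| * ‖u‖ + |r| * ‖v‖) := by
      rw [norm_smul, Real.norm_of_nonneg ht]
      gcongr
      refine (norm_add_le _ _).trans ?_
      simp [norm_smul]
    have hc : ‖t ^ 2 • (f • u' + r ^ 2 • v')‖ ≤ t ^ 2 * (|f| * ‖u'‖ + r ^ 2 * ‖v'‖) := by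
      rw [norm_smul, Real.norm_of_nonneg (by positivity)]
      gcongr
      refine (norm_add_le _ _).trans ?_
      simp [norm_smul]
    have := abs_expansion_error_le hM hB hT ht ht1 (by positivity) (by positivity) hw hc
    have e1 : g p + L (t • (e • u + r • v) + t ^ 2 • (f • u' + r ^ 2 • v'))
        + B (t • (e • u + r • v)) (t • (e • u + r • v)) / 2
      = g p + t * L u * e + t * L v * r
        + t ^ 2 * L u' * f + (t ^ 2 * L v' + t ^ 2 * B v v / 2) * r ^ 2
        + t ^ 2 * B u u / 2 * e ^ 2 + t ^ 2 * (B u v + B v u) / 2 * (e * r) := by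
      simp only [map_add, map_smul, add_apply, smul_apply,
        smul_eq_mul]
      ring
    rw [e1] at this
    refine this.trans ?_
    gcongr
    have := add_four_cube_le (a := |e| * ‖u‖) (b := |r| * ‖v‖) (c := |f| * ‖u'‖)
      (d := r ^ 2 * ‖v'‖) (by positivity) (by positivity) (by positivity) (by positivity)
    rw [← add_assoc]
    refine this.trans ?_
    have q1 : (|e| * ‖u‖) ^ 3 ≤ ‖u‖ ^ 3 * (1 + e ^ 6) := by
      rw [mul_pow, mul_comm]; gcongr; exact abs_cube_le_one_add_pow_six e
    have q2 : (|r| * ‖v‖) ^ 3 ≤ ‖v‖ ^ 3 * (1 + r ^ 6) := by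
      rw [mul_pow, mul_comm]; gcongr; exact abs_cube_le_one_add_pow_six r
    have q3 : (|f| * ‖u'‖) ^ 3 = ‖u'‖ ^ 3 * |f| ^ 3 := by ring
    have q4 : (r ^ 2 * ‖v'‖) ^ 3 = ‖v'‖ ^ 3 * r ^ 6 := by ring
    linarith
  refine (norm_integral_le_of_norm_le ib (ae_of_all _ hle)).trans ?_
  rw [eb]
  have hK : 0 ≤ K := (integral_nonneg fun y : ℝ × ℝ × ℝ => by positivity).trans h.f_le
  calc _ ≤ 3 * M * t ^ 3 * (1 + 16 * (‖u‖ ^ 3 * (1 + K) + ‖v‖ ^ 3 * (1 + K) + ‖u'‖ ^ 3 * K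
        + ‖v'‖ ^ 3 * K)) := by
        gcongr
        exacts [h.e_le, h.r_le, h.f_le, h.r_le]
    _ ≤ 3 * M * t ^ 3 * (16 * (1 + K) * (1 + ‖u‖ ^ 3 + ‖v‖ ^ 3 + ‖u'‖ ^ 3 + ‖v'‖ ^ 3)) := by
        gcongr
        have : 0 ≤ ‖u'‖ ^ 3 := by positivity
        have : 0 ≤ ‖v'‖ ^ 3 := by positivity
        nlinarith
    _ = _ := by ring

end

end JackknifeK

/-! ### Sixth moments of linear forms in independent variables -/

namespace JackknifeK

theorem add_pow_six_le (x y : ℝ) : (x + y) ^ 6 ≤ 32 * (x ^ 6 + y ^ 6) := by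
  have h1 : (x + y) ^ 2 ≤ 2 * (x ^ 2 + y ^ 2) := by nlinarith [sq_nonneg (x - y)]
  have h2 : (x ^ 2 + y ^ 2) ^ 3 ≤ 4 * ((x ^ 2) ^ 3 + (y ^ 2) ^ 3) := by
    nlinarith [mul_nonneg (add_nonneg (sq_nonneg x) (sq_nonneg y)) (sq_nonneg (x ^ 2 - y ^ 2))]
  calc (x + y) ^ 6 = ((x + y) ^ 2) ^ 3 := by ring
    _ ≤ (2 * (x ^ 2 + y ^ 2)) ^ 3 := by gcongr
    _ = 8 * (x ^ 2 + y ^ 2) ^ 3 := by ring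
    _ ≤ 8 * (4 * ((x ^ 2) ^ 3 + (y ^ 2) ^ 3)) := by gcongr
    _ = _ := by ring

theorem integrable_add_pow_six {Ω : Type*} [MeasurableSpace Ω] {μ : Measure Ω} {S Y : Ω → ℝ}
    (hS : AEStronglyMeasurable S μ) (hY : AEStronglyMeasurable Y μ)
    (hS6 : Integrable (fun ω => S ω ^ 6) μ) (hY6 : Integrable (fun ω => Y ω ^ 6) μ) :
    Integrable (fun ω => (S ω + Y ω) ^ 6) μ :=
  ((hS6.add hY6).const_mul 32).mono' ((hS.add hY).pow 6) (ae_of_all _ fun ω => by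
    rw [Real.norm_of_nonneg (Even.pow_nonneg (by decide) _)]; exact add_pow_six_le _ _)

section SixthMoment

variable {Ω : Type*} [MeasurableSpace Ω] {μ : Measure Ω} [IsProbabilityMeasure μ]

theorem abs_pow_le_one_add_pow_six (x : ℝ) {k : ℕ} (hk : k ≤ 6) : |x ^ k| ≤ 1 + x ^ 6 := by
  have h : x ^ 6 = |x| ^ 6 := by rw [← abs_pow, abs_of_nonneg (Even.pow_nonneg (by decide) x)]
  rw [h, abs_pow]
  rcases le_total |x| 1 with h1 | h1
  · have : 0 ≤ |x| ^ 6 := by positivity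
    have := pow_le_one₀ (n := k) (abs_nonneg x) h1
    linarith
  · have := pow_le_pow_right₀ h1 hk
    linarith

theorem integrable_pow_of_pow_six {S : Ω → ℝ} (hS : AEStronglyMeasurable S μ)
    (h6 : Integrable (fun ω => S ω ^ 6) μ) {k : ℕ} (hk : k ≤ 6) :
    Integrable (fun ω => S ω ^ k) μ :=
  ((integrable_const 1).add h6).mono' (hS.pow k)
    (ae_of_all _ fun _ => abs_pow_le_one_add_pow_six _ hk)

theorem integral_pow_le_one_add {S : Ω → ℝ} (hS : AEStronglyMeasurable S μ)
    (h6 : Integrable (fun ω => S ω ^ 6) μ) {k : ℕ} (hk : k ≤ 6) :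
    ∫ ω, S ω ^ k ∂μ ≤ 1 + ∫ ω, S ω ^ 6 ∂μ := by
  have h := integral_mono (integrable_pow_of_pow_six hS h6 hk) ((integrable_const (1:ℝ)).add h6)
    (fun ω => (le_abs_self _).trans (abs_pow_le_one_add_pow_six (S ω) hk))
  refine h.trans (le_of_eq ?_)
  refine (integral_add (integrable_const (1:ℝ)) h6).trans ?_
  simp

theorem integral_pow_mul_pow {S Y : Ω → ℝ} (hS : AEStronglyMeasurable S μ)
    (hY : AEStronglyMeasurable Y μ) (hS6 : Integrable (fun ω => S ω ^ 6) μ)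
    (hY6 : Integrable (fun ω => Y ω ^ 6) μ) (hSY : IndepFun S Y μ)
    {k l : ℕ} (hk : k ≤ 6) (hl : l ≤ 6) :
    Integrable (fun ω => S ω ^ k * Y ω ^ l) μ ∧
      ∫ ω, S ω ^ k * Y ω ^ l ∂μ = (∫ ω, S ω ^ k ∂μ) * ∫ ω, Y ω ^ l ∂μ := by
  have hi : IndepFun (fun ω => S ω ^ k) (fun ω => Y ω ^ l) μ :=
    hSY.comp (φ := fun x => x ^ k) (ψ := fun x => x ^ l) (by fun_prop) (by fun_prop)
  exact ⟨hi.integrable_mul (integrable_pow_of_pow_six hS hS6 hk)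
    (integrable_pow_of_pow_six hY hY6 hl),
    hi.integral_fun_mul_eq_mul_integral (hS.pow k) (hY.pow l)⟩

/-- In the expansion of (S + Y)^k the term of degree one in Y has mean zero by independence. The
other mixed terms are absorbed, by completing squares, into S^(k-2) Y² and Y^k, which leaves
recursions suited to adding summands one at a time. -/
theorem add_moments_le {S Y : Ω → ℝ} (hS : AEStronglyMeasurable S μ)
    (hY : AEStronglyMeasurable Y μ) (hS6 : Integrable (fun ω => S ω ^ 6) μ)
    (hY6 : Integrable (fun ω => Y ω ^ 6) μ) (hSY : IndepFun S Y μ) (hY0 : ∫ ω, Y ω ∂μ = 0) :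
    (∫ ω, (S ω + Y ω) ^ 2 ∂μ = ∫ ω, S ω ^ 2 ∂μ + ∫ ω, Y ω ^ 2 ∂μ) ∧
    (∫ ω, (S ω + Y ω) ^ 4 ∂μ ≤ ∫ ω, S ω ^ 4 ∂μ + 8 * ((∫ ω, S ω ^ 2 ∂μ) * ∫ ω, Y ω ^ 2 ∂μ)
      + 3 * ∫ ω, Y ω ^ 4 ∂μ) ∧
    (∫ ω, (S ω + Y ω) ^ 6 ∂μ ≤ ∫ ω, S ω ^ 6 ∂μ + 40 * ((∫ ω, S ω ^ 4 ∂μ) * ∫ ω, Y ω ^ 2 ∂μ)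
      + 20 * ∫ ω, Y ω ^ 6 ∂μ) := by
  have iS : ∀ {k : ℕ}, k ≤ 6 → Integrable (fun ω => S ω ^ k) μ :=
    fun hk => integrable_pow_of_pow_six hS hS6 hk
  have iY : ∀ {k : ℕ}, k ≤ 6 → Integrable (fun ω => Y ω ^ k) μ :=
    fun hk => integrable_pow_of_pow_six hY hY6 hk
  have iA : ∀ {k : ℕ}, k ≤ 6 → Integrable (fun ω => (S ω + Y ω) ^ k) μ :=
    fun hk => integrable_pow_of_pow_six (hS.add hY) (integrable_add_pow_six hS hY hS6 hY6) hk
  have iM : ∀ {k l : ℕ}, k ≤ 6 → l ≤ 6 → _ := fun {k l} hk hl =>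
    integral_pow_mul_pow (k := k) (l := l) hS hY hS6 hY6 hSY hk hl
  have z : ∀ {k : ℕ}, k ≤ 6 → ∫ ω, S ω ^ k * Y ω ^ 1 ∂μ = 0 := by
    intro k hk
    rw [(iM hk (by norm_num : 1 ≤ 6)).2]
    simp [hY0]
  have comb : ∀ {f g h k : Ω → ℝ} (b c d : ℝ), Integrable f μ → Integrable g μ → Integrable h μ →
      Integrable k μ → Integrable (fun ω => f ω + b * g ω + c * h ω + d * k ω) μ ∧
      ∫ ω, (f ω + b * g ω + c * h ω + d * k ω) ∂μ
        = ∫ ω, f ω ∂μ + b * ∫ ω, g ω ∂μ + c * ∫ ω, h ω ∂μ + d * ∫ ω, k ω ∂μ := by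
    intro f g h k b c d hf hg hh hk
    refine ⟨((hf.add (hg.const_mul b)).add (hh.const_mul c)).add (hk.const_mul d), ?_⟩
    refine (integral_add ((hf.add (hg.const_mul b)).add (hh.const_mul c)) (hk.const_mul d)).trans ?_
    rw [integral_const_mul]; congr 1
    refine (integral_add (hf.add (hg.const_mul b)) (hh.const_mul c)).trans ?_
    rw [integral_const_mul]; congr 1
    refine (integral_add hf (hg.const_mul b)).trans ?_
    rw [integral_const_mul]
  refine ⟨?_, ?_, ?_⟩
  · have := (comb 2 1 0 (iS (k := 2) (by norm_num)) (iM (k := 1) (l := 1) (by norm_num)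
      (by norm_num)).1 (iY (k := 2) (by norm_num)) (iY (k := 2) (by norm_num))).2
    rw [z (by norm_num)] at this
    calc _ = _ := integral_congr_ae (ae_of_all _ fun ω => by ring)
      _ = _ := this
      _ = _ := by ring
  · have := comb 4 8 3 (iS (k := 4) (by norm_num)) (iM (k := 3) (l := 1) (by norm_num)
      (by norm_num)).1 (iM (k := 2) (l := 2) (by norm_num) (by norm_num)).1
      (iY (k := 4) (by norm_num))
    rw [z (by norm_num), (iM (k := 2) (l := 2) (by norm_num) (by norm_num)).2] at this
    calc _ ≤ _ := integral_mono (iA (k := 4) (by norm_num)) this.1 (fun ω => by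
            nlinarith [mul_nonneg (sq_nonneg (Y ω)) (sq_nonneg (S ω - Y ω))])
      _ = _ := this.2
      _ = _ := by ring
  · have := comb 6 40 20 (iS (k := 6) (by norm_num)) (iM (k := 5) (l := 1) (by norm_num)
      (by norm_num)).1 (iM (k := 4) (l := 2) (by norm_num) (by norm_num)).1
      (iY (k := 6) (by norm_num))
    rw [z (by norm_num), (iM (k := 4) (l := 2) (by norm_num) (by norm_num)).2] at this
    calc _ ≤ _ := integral_mono (iA (k := 6) (by norm_num)) this.1 (fun ω => by
            show (S ω + Y ω) ^ 6 ≤ S ω ^ 6 + 6 * (S ω ^ 5 * Y ω ^ 1) + 40 * (S ω ^ 4 * Y ω ^ 2)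
              + 20 * Y ω ^ 6
            have e : S ω ^ 6 + 6 * (S ω ^ 5 * Y ω ^ 1) + 40 * (S ω ^ 4 * Y ω ^ 2)
              + 20 * Y ω ^ 6 - (S ω + Y ω) ^ 6 = 10 * (S ω * Y ω * (S ω - Y ω)) ^ 2
                + 3 * (Y ω ^ 2 * (S ω - Y ω)) ^ 2 + 14 * (Y ω * (S ω ^ 2 - Y ω ^ 2)) ^ 2
                + (S ω ^ 2 * Y ω) ^ 2 + 2 * (Y ω ^ 3) ^ 2 := by ring
            have : 0 ≤ 10 * (S ω * Y ω * (S ω - Y ω)) ^ 2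
                + 3 * (Y ω ^ 2 * (S ω - Y ω)) ^ 2 + 14 * (Y ω * (S ω ^ 2 - Y ω ^ 2)) ^ 2
                + (S ω ^ 2 * Y ω) ^ 2 + 2 * (Y ω ^ 3) ^ 2 := by positivity
            linarith)
      _ = _ := this.2
      _ = _ := by ring

/-- A Rosenthal-type bound by induction on the number of summands. The recursion for order six uses
order four, which uses order two, so all three orders are carried through the induction. -/
theorem integral_pow_six_centered_sum_le {ι : Type*} {X : ι → Ω → ℝ} (hX : ∀ i, Measurable (X i))
    (hi : iIndepFun X μ) (h0 : ∀ i, ∫ ω, X i ω ∂μ = 0)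
    (h6 : ∀ i, Integrable (fun ω => X i ω ^ 6) μ) {κ : ℝ} (hκ : ∀ i, ∫ ω, X i ω ^ 6 ∂μ ≤ κ)
    (a : ι → ℝ) (s : Finset ι) :
    Integrable (fun ω => (∑ i ∈ s, a i * X i ω) ^ 6) μ ∧
    ∫ ω, (∑ i ∈ s, a i * X i ω) ^ 6 ∂μ ≤ 54 * (1 + κ) ^ 3 * (∑ i ∈ s, a i ^ 2) ^ 3 := by
  classical
  have hXa : iIndepFun (fun i ω => a i * X i ω) μ :=
    hi.comp (fun i x => a i * x) (fun i => by fun_prop)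
  -- With K = 1 + κ bounding the moments of orders 2, 4 and 6, the recursions close: 4(B + b)²
  -- dominates 4B² + 8Bb + 3b², and 54(B + b)³ dominates 54B³ + 160B²b + 20b³, where 160 = 40 · 4.
  suffices H : Integrable (fun ω => (∑ i ∈ s, a i * X i ω) ^ 6) μ ∧
      ∫ ω, (∑ i ∈ s, a i * X i ω) ^ 2 ∂μ ≤ (1 + κ) * ∑ i ∈ s, a i ^ 2 ∧
      ∫ ω, (∑ i ∈ s, a i * X i ω) ^ 4 ∂μ ≤ 4 * (1 + κ) ^ 2 * (∑ i ∈ s, a i ^ 2) ^ 2 ∧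
      ∫ ω, (∑ i ∈ s, a i * X i ω) ^ 6 ∂μ ≤ 54 * (1 + κ) ^ 3 * (∑ i ∈ s, a i ^ 2) ^ 3 from
    ⟨H.1, H.2.2.2⟩
  induction s using Finset.induction_on with
  | empty => simp
  | insert j s hj ih =>
    obtain ⟨ih6, ih2, ih4, ihs⟩ := ih
    have hκ0 : 0 ≤ κ :=
      (integral_nonneg fun ω => Even.pow_nonneg (by decide) (X j ω)).trans (hκ j)
    set S : Ω → ℝ := fun ω => ∑ i ∈ s, a i * X i ω with hS
    set Y : Ω → ℝ := fun ω => a j * X j ω with hY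
    have mS : Measurable S := Finset.measurable_sum _ fun i _ => (hX i).const_mul _
    have mY : Measurable Y := (hX j).const_mul _
    have iYk : ∀ k : ℕ, ∫ ω, Y ω ^ k ∂μ = a j ^ k * ∫ ω, X j ω ^ k ∂μ := by
      intro k
      rw [← integral_const_mul]
      exact integral_congr_ae (ae_of_all _ fun ω => by simp only [hY]; ring)
    have hY6 : Integrable (fun ω => Y ω ^ 6) μ := by
      simp only [hY, mul_pow]; exact (h6 j).const_mul _
    have hY0 : ∫ ω, Y ω ∂μ = 0 := by simp only [hY]; rw [integral_const_mul, h0, mul_zero]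
    have hind : IndepFun S Y μ := by
      have := hXa.indepFun_finsetSum_of_notMem (fun i => (hX i).const_mul _) hj
      convert this using 1
      ext ω; simp [hS]
    obtain ⟨e2, e4, e6⟩ := add_moments_le mS.aestronglyMeasurable mY.aestronglyMeasurable ih6 hY6
      hind hY0
    have hsum : ∀ ω, ∑ i ∈ insert j s, a i * X i ω = S ω + Y ω := by
      intro ω; rw [Finset.sum_insert hj, add_comm]
    have hB : ∑ i ∈ insert j s, a i ^ 2 = ∑ i ∈ s, a i ^ 2 + a j ^ 2 := by
      rw [Finset.sum_insert hj, add_comm]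
    simp only [hsum, hB]
    have hm : ∀ k : ℕ, k ≤ 6 → Even k → ∫ ω, Y ω ^ k ∂μ ≤ a j ^ k * (1 + κ) := by
      intro k hk he
      rw [iYk]
      refine mul_le_mul_of_nonneg_left ?_ (he.pow_nonneg _)
      exact (integral_pow_le_one_add (hX j).aestronglyMeasurable (h6 j) hk).trans
        (by linarith [hκ j])
    have m2 := hm 2 (by norm_num) (by decide)
    have m4 := hm 4 (by norm_num) (by decide)
    have m6 := hm 6 (by norm_num) (by decide)
    have B0 : 0 ≤ ∑ i ∈ s, a i ^ 2 := Finset.sum_nonneg fun i _ => sq_nonneg _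
    have S2 : 0 ≤ ∫ ω, S ω ^ 2 ∂μ := integral_nonneg fun ω => sq_nonneg _
    have S4 : 0 ≤ ∫ ω, S ω ^ 4 ∂μ := integral_nonneg fun ω => Even.pow_nonneg (by decide) _
    have Y2 : 0 ≤ ∫ ω, Y ω ^ 2 ∂μ := integral_nonneg fun ω => sq_nonneg _
    generalize ∑ i ∈ s, a i ^ 2 = B at *
    have K1 : 1 ≤ 1 + κ := by linarith
    generalize 1 + κ = K at *
    have b0 : 0 ≤ a j ^ 2 := sq_nonneg _
    have r4 : a j ^ 4 = (a j ^ 2) ^ 2 := by ring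
    have r6 : a j ^ 6 = (a j ^ 2) ^ 3 := by ring
    rw [r4] at m4; rw [r6] at m6
    generalize a j ^ 2 = b at *
    refine ⟨integrable_add_pow_six mS.aestronglyMeasurable mY.aestronglyMeasurable ih6 hY6,
      ?_, ?_, ?_⟩
    · rw [e2]; linarith
    · have p1 : (∫ ω, S ω ^ 2 ∂μ) * ∫ ω, Y ω ^ 2 ∂μ ≤ (K * B) * (b * K) :=
        mul_le_mul ih2 m2 Y2 (by positivity)
      have p2 : b ^ 2 * K ≤ b ^ 2 * K ^ 2 := by
        gcongr; nlinarith
      have p3 : 0 ≤ b ^ 2 * K ^ 2 := by positivity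
      calc _ ≤ _ := e4
        _ ≤ 4 * K ^ 2 * B ^ 2 + 8 * ((K * B) * (b * K)) + 3 * (b ^ 2 * K ^ 2) := by linarith
        _ ≤ _ := by nlinarith
    · have p1 : (∫ ω, S ω ^ 4 ∂μ) * ∫ ω, Y ω ^ 2 ∂μ ≤ (4 * K ^ 2 * B ^ 2) * (b * K) :=
        mul_le_mul ih4 m2 Y2 (by positivity)
      have p2 : b ^ 3 * K ≤ b ^ 3 * K ^ 3 := by
        gcongr; exact le_self_pow₀ K1 (by norm_num)
      have p3 : 0 ≤ b ^ 3 * K ^ 3 := by positivity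
      have p4 : 0 ≤ K ^ 3 * (B ^ 2 * b) := by positivity
      have p5 : 0 ≤ K ^ 3 * (B * b ^ 2) := by positivity
      calc _ ≤ _ := e6
        _ ≤ 54 * K ^ 3 * B ^ 3 + 40 * ((4 * K ^ 2 * B ^ 2) * (b * K)) + 20 * (b ^ 3 * K ^ 3) := by
          linarith
        _ ≤ _ := by nlinarith

/-- Sixth moment of a linear form in independent variables. -/
theorem integral_pow_six_sum_le {ι : Type*} [Fintype ι] {X : ι → Ω → ℝ}
    (hX : ∀ i, Measurable (X i)) (hi : iIndepFun X μ)
    (h6 : ∀ i, Integrable (fun ω => X i ω ^ 6) μ) {κ : ℝ} (hκ : ∀ i, ∫ ω, X i ω ^ 6 ∂μ ≤ κ)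
    (a : ι → ℝ) :
    Integrable (fun ω => (∑ i, a i * X i ω) ^ 6) μ ∧
    ∫ ω, (∑ i, a i * X i ω) ^ 6 ∂μ ≤ 32 * ((∑ i, a i * ∫ ω, X i ω ∂μ) ^ 6
      + 54 * (1 + 64 * (1 + κ) ^ 6) ^ 3 * (∑ i, a i ^ 2) ^ 3) := by
  set m : ι → ℝ := fun i => ∫ ω, X i ω ∂μ with hm
  have hm6 : ∀ i, m i ^ 6 ≤ (1 + κ) ^ 6 := by
    intro i
    have i1 := integrable_pow_of_pow_six (k := 1) (hX i).aestronglyMeasurable (h6 i) (by norm_num)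
    have : |m i| ≤ 1 + κ := by
      refine abs_integral_le_integral_abs.trans ?_
      simp only [pow_one] at i1
      have h := integral_mono i1.abs ((integrable_const (1:ℝ)).add (h6 i))
        (fun ω => abs_le_one_add_pow_six (X i ω))
      have e : ∫ ω, ((fun _ : Ω => (1 : ℝ)) + fun ω => X i ω ^ 6) ω ∂μ = 1 + ∫ ω, X i ω ^ 6 ∂μ := by
        refine (integral_add (integrable_const (1:ℝ)) (h6 i)).trans ?_
        simp
      rw [e] at h
      exact h.trans (by linarith [hκ i])
    calc m i ^ 6 = |m i| ^ 6 := by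
          rw [← abs_pow, abs_of_nonneg (Even.pow_nonneg (by decide) _)]
      _ ≤ _ := by gcongr
  -- Centring costs a constant: E(X - m)⁶ ≤ 32(κ + m⁶), and both κ and m⁶ are at most (1 + κ)⁶.
  have hXc6 : ∀ i, Integrable (fun ω => (X i ω - m i) ^ 6) μ ∧
      ∫ ω, (X i ω - m i) ^ 6 ∂μ ≤ 64 * (1 + κ) ^ 6 := by
    intro i
    have j := ((h6 i).add (integrable_const (m i ^ 6))).const_mul 32
    have hb : ∀ ω, (X i ω - m i) ^ 6 ≤ 32 * (X i ω ^ 6 + m i ^ 6) := fun ω => by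
      have := add_pow_six_le (X i ω) (-m i)
      rwa [← sub_eq_add_neg, Even.neg_pow (by decide)] at this
    have i1 : Integrable (fun ω => (X i ω - m i) ^ 6) μ :=
      j.mono' (by fun_prop) (ae_of_all _ fun ω => by
        rw [Real.norm_of_nonneg (Even.pow_nonneg (by decide) _)]; exact hb ω)
    refine ⟨i1, (integral_mono i1 j hb).trans ?_⟩
    have e : ∫ ω, 32 * (X i ω ^ 6 + m i ^ 6) ∂μ
        = 32 * (∫ ω, X i ω ^ 6 ∂μ + m i ^ 6) := by
      rw [integral_const_mul]
      congr 1
      refine (integral_add (h6 i) (integrable_const _)).trans ?_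
      simp
    refine (le_of_eq e).trans ?_
    have hκ0 : 0 ≤ κ :=
      (integral_nonneg fun ω => Even.pow_nonneg (by decide) (X i ω)).trans (hκ i)
    have h1 : κ ≤ (1 + κ) ^ 6 := by
      have := le_self_pow₀ (show (1:ℝ) ≤ 1 + κ by linarith) (n := 6) (by norm_num)
      linarith
    linarith [hκ i, hm6 i]
  have hic : iIndepFun (fun i ω => X i ω - m i) μ :=
    hi.comp (fun i x => x - m i) (fun i => by fun_prop)
  obtain ⟨c1, c2⟩ := integral_pow_six_centered_sum_le (fun i => (hX i).sub_const (m i)) hic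
    (fun i => by
      have i1 := integrable_pow_of_pow_six (k := 1) (hX i).aestronglyMeasurable (h6 i)
        (by norm_num)
      simp only [pow_one] at i1
      rw [integral_sub i1 (integrable_const _)]
      simp [hm]) (fun i => (hXc6 i).1) (fun i => (hXc6 i).2) a Finset.univ
  have esum : ∀ ω, ∑ i, a i * X i ω = ∑ i, a i * m i + ∑ i, a i * (X i ω - m i) := by
    intro ω
    rw [← Finset.sum_add_distrib]
    exact Finset.sum_congr rfl fun i _ => by ring
  have hb : ∀ ω, (∑ i, a i * X i ω) ^ 6 ≤
      32 * ((∑ i, a i * m i) ^ 6 + (∑ i, a i * (X i ω - m i)) ^ 6) := fun ω => by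
    rw [esum]; exact add_pow_six_le _ _
  have j := ((integrable_const ((∑ i, a i * m i) ^ 6)).add c1).const_mul 32
  have i1 : Integrable (fun ω => (∑ i, a i * X i ω) ^ 6) μ :=
    j.mono' (by fun_prop) (ae_of_all _ fun ω => by
      rw [Real.norm_of_nonneg (Even.pow_nonneg (by decide) _)]; exact hb ω)
  refine ⟨i1, (integral_mono i1 j hb).trans ?_⟩
  rw [integral_const_mul]
  gcongr
  refine (integral_add (integrable_const _) c1).trans_le ?_
  simp only [integral_const, probReal_univ, one_smul]
  exact add_le_add le_rfl c2

end SixthMoment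

end JackknifeK

/-! ### Numerator, denominator and the influence of one coordinate -/

namespace JackknifeK

/-- Two Cauchy–Schwarz inequalities. If c, a, b, d are the weighted sums of z⁰, z¹, z², z³, then a²
≤ cb and b² ≤ ad, so a⁴ ≤ c²ad; divide by a when a > 0. -/
theorem sum_mul_cube_le {ι : Type*} (s : Finset ι) {w z : ι → ℝ} (hw : ∀ i, 0 ≤ w i)
    (hz : ∀ i, 0 ≤ z i) :
    (∑ i ∈ s, w i * z i) ^ 3 ≤ (∑ i ∈ s, w i) ^ 2 * ∑ i ∈ s, w i * z i ^ 3 := by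
  have n1 : 0 ≤ ∑ i ∈ s, w i * z i := Finset.sum_nonneg fun i _ => mul_nonneg (hw i) (hz i)
  have n0 : 0 ≤ ∑ i ∈ s, w i := Finset.sum_nonneg fun i _ => hw i
  have n2 : 0 ≤ ∑ i ∈ s, w i * z i ^ 2 :=
    Finset.sum_nonneg fun i _ => mul_nonneg (hw i) (sq_nonneg _)
  have n3 : 0 ≤ ∑ i ∈ s, w i * z i ^ 3 :=
    Finset.sum_nonneg fun i _ => mul_nonneg (hw i) (pow_nonneg (hz i) _)
  have h1 : (∑ i ∈ s, w i * z i) ^ 2 ≤ (∑ i ∈ s, w i) * ∑ i ∈ s, w i * z i ^ 2 :=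
    Finset.sum_sq_le_sum_mul_sum_of_sq_le_mul s (fun i _ => hw i)
      (fun i _ => mul_nonneg (hw i) (sq_nonneg _)) (fun i _ => le_of_eq (by ring))
  have h2 : (∑ i ∈ s, w i * z i ^ 2) ^ 2 ≤ (∑ i ∈ s, w i * z i) * ∑ i ∈ s, w i * z i ^ 3 :=
    Finset.sum_sq_le_sum_mul_sum_of_sq_le_mul s (fun i _ => mul_nonneg (hw i) (hz i))
      (fun i _ => mul_nonneg (hw i) (pow_nonneg (hz i) _)) (fun i _ => le_of_eq (by ring))
  generalize ∑ i ∈ s, w i * z i = a at *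
  generalize ∑ i ∈ s, w i * z i ^ 2 = b at *
  generalize ∑ i ∈ s, w i * z i ^ 3 = d at *
  generalize ∑ i ∈ s, w i = c at *
  rcases n1.eq_or_lt with h | h
  · rw [← h]
    exact (by simp : (0 : ℝ) ^ 3 = 0).trans_le (mul_nonneg (sq_nonneg _) n3)
  · have h3 : (a ^ 2) ^ 2 ≤ (c * b) ^ 2 := by gcongr
    have h4 : c ^ 2 * b ^ 2 ≤ c ^ 2 * (a * d) := by gcongr
    have : a * a ^ 3 ≤ a * (c ^ 2 * d) := by nlinarith
    exact le_of_mul_le_mul_left this h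

section
variable {n : ℕ}

/-- The jackknife fit as a function of the sample of triples. -/
noncomputable def fit (H : Matrix (Fin n) (Fin n) ℝ) (x : Fin n → ℝ × ℝ × ℝ) (i : Fin n) : ℝ :=
  ∑ j, H i j * (x j).2.2

/-- The scaled numerator (before squaring). -/
noncomputable def numer (H : Matrix (Fin n) (Fin n) ℝ) (s : ℝ) (x : Fin n → ℝ × ℝ × ℝ) : ℝ :=
  s / √n * ∑ i, (x i).1 * fit H x i

/-- The scaled denominator. -/
noncomputable def denom (H : Matrix (Fin n) (Fin n) ℝ) (s : ℝ) (x : Fin n → ℝ × ℝ × ℝ) : ℝ :=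
  s ^ 2 / n * ∑ i, (x i).2.1 * fit H x i ^ 2

/-- Deterministic consequences of the assumptions on the design and on the first two moments. -/
structure RegularDesign (H : Matrix (Fin n) (Fin n) ℝ) (s K : ℝ) (me ve mr vr : Fin n → ℝ) :
    Prop where
  one_le : 1 ≤ K
  pos : 0 < n
  scale_pos : 0 < s
  diag : ∀ i, H i i = 0
  ve_le : ∀ i, me i ^ 2 + ve i ≤ K
  le_ve : ∀ i, K⁻¹ ≤ ve i
  le_vr : ∀ i, K⁻¹ ≤ vr i
  fit_le : ∀ i, s ^ 2 * ((∑ j, H i j * mr j) ^ 2 + ∑ j, H i j ^ 2 * vr j) ≤ 1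
  col_le : ∀ j, s ^ 2 * ∑ i, H i j ^ 2 ≤ K
  means_le : ∀ j, (s * ∑ i, H i j * me i) ^ 2 ≤ K
  average : K⁻¹ ≤ s ^ 2 / n * ∑ i, ((∑ j, H i j * mr j) ^ 2 + ∑ j, H i j ^ 2 * vr j)
  power : s ^ 2 / n * ((∑ i, me i * ∑ j, H i j * mr j) ^ 2
    + ∑ j, (∑ i, me i * H i j) ^ 2 * vr j) ≤ K

/-- A bound for the sixth moments of the linear forms. -/
noncomputable def sixthBound (K : ℝ) : ℝ := 32 * (K ^ 3 + 54 * (1 + 64 * (1 + K) ^ 6) ^ 3 * K ^ 3)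

variable {H : Matrix (Fin n) (Fin n) ℝ} {s K : ℝ} {me ve mr vr : Fin n → ℝ}

/-- The normalisation of the second moment of the fit controls the row norm because each variance
`vr j` is at least 1/K. -/
theorem RegularDesign.row_le (h : RegularDesign H s K me ve mr vr) (i : Fin n) :
    ∑ j, (s * H i j) ^ 2 ≤ K := by
  have hK : 0 < K := by linarith [h.one_le]
  have h1 := h.fit_le i
  have h2 : ∑ j, H i j ^ 2 * K⁻¹ ≤ ∑ j, H i j ^ 2 * vr j :=
    Finset.sum_le_sum fun j _ => mul_le_mul_of_nonneg_left (h.le_vr j) (sq_nonneg _)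
  rw [← Finset.sum_mul] at h2
  have h3 : s ^ 2 * ((∑ j, H i j ^ 2) * K⁻¹) ≤ 1 :=
    le_trans (by gcongr; nlinarith [sq_nonneg (∑ j, H i j * mr j)]) h1
  simp only [mul_pow]
  rw [← Finset.mul_sum]
  have : (s ^ 2 * ∑ j, H i j ^ 2) / K ≤ 1 := by rw [div_eq_mul_inv]; linarith
  rwa [div_le_one hK] at this

theorem RegularDesign.col_le' (h : RegularDesign H s K me ve mr vr) (j : Fin n) :
    ∑ i, (s * H i j) ^ 2 ≤ K := by
  simp only [mul_pow]
  rw [← Finset.mul_sum]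
  exact h.col_le j

theorem RegularDesign.entry_le (h : RegularDesign H s K me ve mr vr) (i j : Fin n) :
    (s * H i j) ^ 6 ≤ K ^ 3 := by
  have h1 := (Finset.single_le_sum (f := fun i => (s * H i j) ^ 2) (fun i _ => sq_nonneg _)
    (Finset.mem_univ i)).trans (h.col_le' j)
  calc (s * H i j) ^ 6 = ((s * H i j) ^ 2) ^ 3 := by ring
    _ ≤ _ := by gcongr

variable {R : Fin n → Measure (ℝ × ℝ × ℝ)} [∀ i, IsProbabilityMeasure (R i)]

theorem integrable_eval {i : Fin n} {F : ℝ × ℝ × ℝ → ℝ} (hF : Integrable F (R i)) :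
    Integrable (fun x : Fin n → ℝ × ℝ × ℝ => F (x i)) (Measure.pi R) ∧
      ∫ x, F (x i) ∂Measure.pi R = ∫ y, F y ∂(R i) := by
  have hp := measurePreserving_eval R i
  refine ⟨hp.integrable_comp_of_integrable hF, ?_⟩
  rw [← hp.map_eq] at hF ⊢
  rw [integral_map hp.aemeasurable hF.1]

/-- Redrawing coordinate i from its own law preserves the product measure and leaves G unchanged, so
F and G become functions of different factors. -/
theorem integral_eval_mul {i : Fin n} {F : ℝ × ℝ × ℝ → ℝ} (hF : Integrable F (R i))
    {G : (Fin n → ℝ × ℝ × ℝ) → ℝ} (hG : Integrable G (Measure.pi R))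
    (hu : ∀ x y, G (Function.update x i y) = G x) :
    Integrable (fun x => F (x i) * G x) (Measure.pi R) ∧
      ∫ x, F (x i) * G x ∂Measure.pi R = (∫ y, F y ∂(R i)) * ∫ x, G x ∂Measure.pi R := by
  have hp := measurePreserving_update R i (R i)
  rw [Function.update_eq_self] at hp
  have hm : AEStronglyMeasurable (fun x => F (x i) * G x) (Measure.pi R) :=
    (integrable_eval hF).1.1.mul hG.1
  have e : (fun x => F (x i) * G x) ∘ (fun q : (Fin n → ℝ × ℝ × ℝ) × (ℝ × ℝ × ℝ) =>
      Function.update q.1 i q.2) = fun q => G q.1 * F q.2 := by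
    funext q
    simp [hu, mul_comm]
  constructor
  · rw [← hp.integrable_comp hm, e]
    exact hG.mul_prod hF
  · rw [← hp.map_eq] at hm
    conv_lhs => rw [← hp.map_eq]
    rw [integral_map hp.aemeasurable hm]
    refine (integral_congr_ae (ae_of_all _ fun q => congrFun e q)).trans ?_
    rw [integral_prod_mul, mul_comm]

theorem RegularDesign.fit_pow_six (h : RegularDesign H s K me ve mr vr)
    (hR : ∀ i, TripleMoments (R i) K (me i) (ve i) (mr i) (vr i)) (i : Fin n) :
    Integrable (fun x => (s * fit H x i) ^ 6) (Measure.pi R) ∧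
      ∫ x, (s * fit H x i) ^ 6 ∂Measure.pi R ≤ sixthBound K := by
  have hi : iIndepFun (fun (j : Fin n) (x : Fin n → ℝ × ℝ × ℝ) => (x j).2.2) (Measure.pi R) :=
    iIndepFun_pi (X := fun _ (y : ℝ × ℝ × ℝ) => y.2.2) (fun j => by fun_prop)
  have k := integral_pow_six_sum_le (fun j => by fun_prop) hi
    (fun j => (integrable_eval (F := fun y => y.2.2 ^ 6) (hR j).int_r).1)
    (κ := K) (fun j => by
      rw [(integrable_eval (F := fun y => y.2.2 ^ 6) (hR j).int_r).2]; exact (hR j).r_le)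
    (fun j => s * H i j)
  have e : ∀ x : Fin n → ℝ × ℝ × ℝ, ∑ j, s * H i j * (x j).2.2 = s * fit H x i := by
    intro x; rw [fit, Finset.mul_sum]; exact Finset.sum_congr rfl fun _ _ => by ring
  simp only [e] at k
  refine ⟨k.1, k.2.trans ?_⟩
  have em : ∑ j, s * H i j * ∫ x : Fin n → ℝ × ℝ × ℝ, (x j).2.2 ∂Measure.pi R
      = s * ∑ j, H i j * mr j := by
    rw [Finset.mul_sum]
    refine Finset.sum_congr rfl fun j _ => ?_
    rw [(integrable_eval (F := fun y => y.2.2) (hR j).integrable_r).2, (hR j).mean_r]; ring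
  rw [em, sixthBound]
  have hs := h.row_le i
  have hK := h.one_le
  have hm : (s * ∑ j, H i j * mr j) ^ 2 ≤ K := by
    have := h.fit_le i
    have h2 : 0 ≤ s ^ 2 * ∑ j, H i j ^ 2 * vr j := by
      refine mul_nonneg (sq_nonneg _) (Finset.sum_nonneg fun j _ => mul_nonneg (sq_nonneg _) ?_)
      exact le_trans (by positivity) (h.le_vr j)
    rw [mul_pow]; linarith
  have h0 : 0 ≤ ∑ j, (s * H i j) ^ 2 := Finset.sum_nonneg fun j _ => sq_nonneg _
  gcongr
  calc (s * ∑ j, H i j * mr j) ^ 6 = ((s * ∑ j, H i j * mr j) ^ 2) ^ 3 := by ring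
    _ ≤ _ := by gcongr

theorem RegularDesign.col_pow_six (h : RegularDesign H s K me ve mr vr)
    (hR : ∀ i, TripleMoments (R i) K (me i) (ve i) (mr i) (vr i)) (j : Fin n) :
    Integrable (fun x => (s * ∑ i, H i j * (x i).1) ^ 6) (Measure.pi R) ∧
      ∫ x, (s * ∑ i, H i j * (x i).1) ^ 6 ∂Measure.pi R ≤ sixthBound K := by
  have hi : iIndepFun (fun (j : Fin n) (x : Fin n → ℝ × ℝ × ℝ) => (x j).1) (Measure.pi R) :=
    iIndepFun_pi (X := fun _ (y : ℝ × ℝ × ℝ) => y.1) (fun j => by fun_prop)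
  have k := integral_pow_six_sum_le (fun j => by fun_prop) hi
    (fun i => (integrable_eval (F := fun y => y.1 ^ 6) (hR i).int_e).1)
    (κ := K) (fun i => by
      rw [(integrable_eval (F := fun y => y.1 ^ 6) (hR i).int_e).2]; exact (hR i).e_le)
    (fun i => s * H i j)
  have e : ∀ x : Fin n → ℝ × ℝ × ℝ, ∑ i, s * H i j * (x i).1 = s * ∑ i, H i j * (x i).1 := by
    intro x; rw [Finset.mul_sum]; exact Finset.sum_congr rfl fun _ _ => by ring
  simp only [e] at k
  refine ⟨k.1, k.2.trans ?_⟩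
  have em : ∑ i, s * H i j * ∫ x : Fin n → ℝ × ℝ × ℝ, (x i).1 ∂Measure.pi R
      = s * ∑ i, H i j * me i := by
    rw [Finset.mul_sum]
    refine Finset.sum_congr rfl fun i _ => ?_
    rw [(integrable_eval (F := fun y => y.1) (hR i).integrable_e).2, (hR i).mean_e]; ring
  rw [em, sixthBound]
  have hs := h.col_le' j
  have hK := h.one_le
  have hm := h.means_le j
  have h0 : 0 ≤ ∑ i, (s * H i j) ^ 2 := Finset.sum_nonneg fun j _ => sq_nonneg _
  gcongr
  calc (s * ∑ i, H i j * me i) ^ 6 = ((s * ∑ i, H i j * me i) ^ 2) ^ 3 := by ring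
    _ ≤ _ := by gcongr

/-- The random bound for the influence of coordinate `j`. -/
noncomputable def influence (H : Matrix (Fin n) (Fin n) ℝ) (s K : ℝ) (j : Fin n)
    (x : Fin n → ℝ × ℝ × ℝ) : ℝ :=
  1 + (s * fit H x j) ^ 6 + (s * ∑ i, H i j * (x i).1) ^ 6
    + K ^ 2 * ∑ i, (s * H i j) ^ 2 * |(x i).2.1| ^ 3
    + (n : ℝ)⁻¹ * ∑ i, (|(x i).2.1| ^ 3 * (32 * (s * fit H x i) ^ 6)
      + |(x i).2.1| ^ 3 * (32 * (s * H i j) ^ 6 * (x j).2.2 ^ 6))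

/-- This is the point of the jackknife: the fit at i ignores observation i, so it is independent of
e_i and f_i. -/
theorem fit_update_self (hd : ∀ i, H i i = 0) (x : Fin n → ℝ × ℝ × ℝ) (i : Fin n)
    (y : ℝ × ℝ × ℝ) : fit H (Function.update x i y) i = fit H x i := by
  refine Finset.sum_congr rfl fun j _ => ?_
  by_cases hj : j = i
  · subst hj; simp [hd]
  · simp [hj]

/-- A bound for the expected influence of one coordinate. -/
noncomputable def influenceBound (K : ℝ) : ℝ :=
  1 + 2 * sixthBound K + K ^ 4 + 32 * (K * sixthBound K + K ^ 5)

/-- Only the third moment of |f_i| is available, so |f_i|³ may be multiplied only by something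
independent of triple i. This holds for the full fit at i, hence `influence` is written with `fit`
and a separate correction for the removed coordinate j. -/
theorem RegularDesign.integral_influence_le (h : RegularDesign H s K me ve mr vr)
    (hR : ∀ i, TripleMoments (R i) K (me i) (ve i) (mr i) (vr i)) (j : Fin n) :
    Integrable (influence H s K j) (Measure.pi R) ∧
      ∫ x, influence H s K j x ∂Measure.pi R ≤ influenceBound K := by
  have hK := h.one_le
  have hf0 : ∀ i, 0 ≤ ∫ y, |y.2.1| ^ 3 ∂(R i) := fun i => integral_nonneg fun y => by positivity
  have f1 := h.fit_pow_six hR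
  have f2 := h.col_pow_six hR j
  have f3 : ∀ i, _ := fun i => integrable_eval (F := fun y => |y.2.1| ^ 3) (hR i).int_f
  have f4 : ∀ i, Integrable (fun x : Fin n → ℝ × ℝ × ℝ =>
      |(x i).2.1| ^ 3 * (32 * (s * fit H x i) ^ 6)) (Measure.pi R) ∧
      ∫ x : Fin n → ℝ × ℝ × ℝ, |(x i).2.1| ^ 3 * (32 * (s * fit H x i) ^ 6) ∂Measure.pi R
        ≤ 32 * (K * sixthBound K) := by
    intro i
    have := integral_eval_mul (F := fun y => |y.2.1| ^ 3) (hR i).int_f ((f1 i).1.const_mul 32)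
      (fun x y => by rw [fit_update_self h.diag])
    refine ⟨this.1, ?_⟩
    rw [this.2, integral_const_mul]
    have p := mul_le_mul (hR i).f_le (f1 i).2
      (integral_nonneg fun x => Even.pow_nonneg (by decide) _) (by linarith)
    linarith
  have f5 : ∀ i, Integrable (fun x : Fin n → ℝ × ℝ × ℝ =>
      |(x i).2.1| ^ 3 * (32 * (s * H i j) ^ 6 * (x j).2.2 ^ 6)) (Measure.pi R) ∧
      ∫ x : Fin n → ℝ × ℝ × ℝ, |(x i).2.1| ^ 3 * (32 * (s * H i j) ^ 6 * (x j).2.2 ^ 6)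
        ∂Measure.pi R ≤ 32 * K ^ 5 := by
    intro i
    -- For i = j the factors f_i and r_j could be dependent, but then the coefficient h_ij is zero.
    by_cases hij : i = j
    · subst hij
      simp [h.diag]; positivity
    · have k := integrable_eval (F := fun y => y.2.2 ^ 6) (hR j).int_r
      have := integral_eval_mul (F := fun y => |y.2.1| ^ 3) (hR i).int_f
        (k.1.const_mul (32 * (s * H i j) ^ 6)) (fun x y => by simp [Ne.symm hij])
      refine ⟨this.1, ?_⟩
      rw [this.2, integral_const_mul, k.2]
      have p := mul_le_mul (h.entry_le i j) (hR j).r_le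
        (integral_nonneg fun x => Even.pow_nonneg (by decide) _) (by positivity)
      have p' := mul_le_mul (hR i).f_le p (mul_nonneg (Even.pow_nonneg (by decide) _)
        (integral_nonneg fun x => Even.pow_nonneg (by decide) _)) (by linarith)
      calc _ = 32 * ((∫ y, |y.2.1| ^ 3 ∂(R i)) * ((s * H i j) ^ 6 * ∫ y, y.2.2 ^ 6 ∂(R j))) := by ring
        _ ≤ 32 * (K * (K ^ 3 * K)) := by gcongr
        _ = _ := by ring
  have i0 : Integrable (fun _ : Fin n → ℝ × ℝ × ℝ => (1 : ℝ)) (Measure.pi R) :=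
    integrable_const _
  have i1 := i0.add (f1 j).1
  have i2 := i1.add f2.1
  have k3 : Integrable (fun x : Fin n → ℝ × ℝ × ℝ =>
      ∑ i, (s * H i j) ^ 2 * |(x i).2.1| ^ 3) (Measure.pi R) :=
    integrable_finsetSum _ fun i _ => (f3 i).1.const_mul _
  have i3 := i2.add (k3.const_mul (K ^ 2))
  have k4 : Integrable (fun x : Fin n → ℝ × ℝ × ℝ =>
      ∑ i, (|(x i).2.1| ^ 3 * (32 * (s * fit H x i) ^ 6)
      + |(x i).2.1| ^ 3 * (32 * (s * H i j) ^ 6 * (x j).2.2 ^ 6))) (Measure.pi R) :=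
    integrable_finsetSum _ fun i _ => (f4 i).1.add (f5 i).1
  have i4 := i3.add (k4.const_mul (n : ℝ)⁻¹)
  refine ⟨i4, ?_⟩
  have b3 : ∫ x : Fin n → ℝ × ℝ × ℝ, ∑ i, (s * H i j) ^ 2 * |(x i).2.1| ^ 3 ∂Measure.pi R
      ≤ K * K := by
    rw [integral_finsetSum _ fun i _ => (f3 i).1.const_mul _]
    calc _ ≤ ∑ i, (s * H i j) ^ 2 * K := by
          refine Finset.sum_le_sum fun i _ => ?_
          rw [integral_const_mul, (f3 i).2]
          gcongr
          exact (hR i).f_le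
      _ ≤ _ := by
          rw [← Finset.sum_mul]
          gcongr
          exact h.col_le' j
  have b4 : ∫ x : Fin n → ℝ × ℝ × ℝ, ∑ i, (|(x i).2.1| ^ 3 * (32 * (s * fit H x i) ^ 6)
      + |(x i).2.1| ^ 3 * (32 * (s * H i j) ^ 6 * (x j).2.2 ^ 6)) ∂Measure.pi R
      ≤ n * (32 * (K * sixthBound K) + 32 * K ^ 5) := by
    refine (integral_finsetSum _ fun i _ => (f4 i).1.add (f5 i).1).trans_le ?_
    calc _ ≤ ∑ i : Fin n, (32 * (K * sixthBound K) + 32 * K ^ 5) := by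
          refine Finset.sum_le_sum fun i _ => ?_
          refine (integral_add (f4 i).1 (f5 i).1).trans_le ?_
          exact add_le_add (f4 i).2 (f5 i).2
      _ = _ := by simp [mul_add]
  have hn : (0 : ℝ) < n := Nat.cast_pos.2 h.pos
  have e : ∫ x, influence H s K j x ∂Measure.pi R = 1 + ∫ x, (s * fit H x j) ^ 6 ∂Measure.pi R
      + ∫ x : Fin n → ℝ × ℝ × ℝ, (s * ∑ i, H i j * (x i).1) ^ 6 ∂Measure.pi R
      + K ^ 2 * ∫ x : Fin n → ℝ × ℝ × ℝ, ∑ i, (s * H i j) ^ 2 * |(x i).2.1| ^ 3 ∂Measure.pi R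
      + (n : ℝ)⁻¹ * ∫ x : Fin n → ℝ × ℝ × ℝ, ∑ i, (|(x i).2.1| ^ 3 * (32 * (s * fit H x i) ^ 6)
      + |(x i).2.1| ^ 3 * (32 * (s * H i j) ^ 6 * (x j).2.2 ^ 6)) ∂Measure.pi R := by
    refine (integral_add i3 (k4.const_mul (n : ℝ)⁻¹)).trans ?_
    rw [integral_const_mul]; congr 1
    refine (integral_add i2 (k3.const_mul (K ^ 2))).trans ?_
    rw [integral_const_mul]; congr 1
    refine (integral_add i1 f2.1).trans ?_
    congr 1
    refine (integral_add i0 (f1 j).1).trans ?_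
    simp
  rw [e, influenceBound]
  have c3 : K ^ 2 * ∫ x : Fin n → ℝ × ℝ × ℝ, ∑ i, (s * H i j) ^ 2 * |(x i).2.1| ^ 3 ∂Measure.pi R
      ≤ K ^ 2 * (K * K) := by gcongr
  have c4 : (n : ℝ)⁻¹ * ∫ x : Fin n → ℝ × ℝ × ℝ, ∑ i, (|(x i).2.1| ^ 3 * (32 * (s * fit H x i) ^ 6)
      + |(x i).2.1| ^ 3 * (32 * (s * H i j) ^ 6 * (x j).2.2 ^ 6)) ∂Measure.pi R
      ≤ 32 * (K * sixthBound K) + 32 * K ^ 5 := by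
    rw [inv_mul_le_iff₀ hn]; exact b4
  have c1 := (f1 j).2
  have c2 := f2.2
  nlinarith

end

end JackknifeK

/-! ### Swapping one coordinate and summing the swaps -/

namespace JackknifeK

section
variable {n : ℕ} {H : Matrix (Fin n) (Fin n) ℝ} {s K : ℝ} {me ve mr vr : Fin n → ℝ}

/-- The fit with the contribution of coordinate `j` removed. -/
noncomputable def fitWithout (H : Matrix (Fin n) (Fin n) ℝ) (j : Fin n) (x : Fin n → ℝ × ℝ × ℝ)
    (i : Fin n) : ℝ := fit H x i - H i j * (x j).2.2

theorem fit_update (x : Fin n → ℝ × ℝ × ℝ) (i j : Fin n) (y : ℝ × ℝ × ℝ) :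
    fit H (Function.update x j y) i = fitWithout H j x i + H i j * y.2.2 := by
  have h1 := Finset.add_sum_erase Finset.univ
    (fun k => H i k * (Function.update x j y k).2.2) (Finset.mem_univ j)
  have h2 := Finset.add_sum_erase Finset.univ (fun k => H i k * (x k).2.2) (Finset.mem_univ j)
  have h3 : ∑ k ∈ Finset.univ.erase j, H i k * (Function.update x j y k).2.2
      = ∑ k ∈ Finset.univ.erase j, H i k * (x k).2.2 :=
    Finset.sum_congr rfl fun k hk => by simp [Finset.ne_of_mem_erase hk]
  simp only [Function.update_self] at h1
  rw [fitWithout, fit, fit, ← h1, ← h2, h3]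
  ring

/-- Coordinate j enters once through its own error and once, through column j of `H`, in the fits of
the others. No product of its error with its regressor appears, as h_jj = 0. -/
theorem numer_update (hd : ∀ i, H i i = 0) (x : Fin n → ℝ × ℝ × ℝ) (j : Fin n)
    (y : ℝ × ℝ × ℝ) :
    numer H s (Function.update x j y)
      = s / √n * ∑ i ∈ Finset.univ.erase j, (x i).1 * fitWithout H j x i
        + (√n)⁻¹ * (y.1 * (s * fit H x j) + y.2.2 * (s * ∑ i, H i j * (x i).1)) := by
  have h1 := Finset.add_sum_erase Finset.univ (fun i => (Function.update x j y i).1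
    * fit H (Function.update x j y) i) (Finset.mem_univ j)
  have h3 : ∑ i ∈ Finset.univ.erase j, (Function.update x j y i).1
      * fit H (Function.update x j y) i
      = ∑ i ∈ Finset.univ.erase j, ((x i).1 * fitWithout H j x i + y.2.2 * (H i j * (x i).1)) :=
    Finset.sum_congr rfl fun k hk => by
      rw [fit_update]; simp [Finset.ne_of_mem_erase hk]; ring
  have h2 := Finset.add_sum_erase Finset.univ (fun i => H i j * (x i).1) (Finset.mem_univ j)
  simp only [Function.update_self, hd, zero_mul, zero_add] at h1 h2
  rw [numer, ← h1, h3, Finset.sum_add_distrib, ← Finset.mul_sum, h2, fit_update_self hd]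
  ring

/-- One factor n^(-1/2) is kept inside the coefficient of r_j: the sum there can be of order √n, so
the increment has the form t(...) + t²(...) with bounded coefficients. -/
theorem denom_update (hd : ∀ i, H i i = 0) (x : Fin n → ℝ × ℝ × ℝ) (j : Fin n)
    (y : ℝ × ℝ × ℝ) :
    denom H s (Function.update x j y)
      = s ^ 2 / n * ∑ i ∈ Finset.univ.erase j, (x i).2.1 * fitWithout H j x i ^ 2
        + ((√n)⁻¹ * (y.2.2 * (2 * (√n)⁻¹ * ∑ i, s ^ 2 * ((x i).2.1 * H i j * fitWithout H j x i)))
          + ((√n)⁻¹) ^ 2 * (y.2.1 * (s * fit H x j) ^ 2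
            + y.2.2 ^ 2 * ∑ i, s ^ 2 * ((x i).2.1 * H i j ^ 2))) := by
  have h1 := Finset.add_sum_erase Finset.univ (fun i => (Function.update x j y i).2.1
    * fit H (Function.update x j y) i ^ 2) (Finset.mem_univ j)
  have h3 : ∑ i ∈ Finset.univ.erase j, (Function.update x j y i).2.1
      * fit H (Function.update x j y) i ^ 2
      = ∑ i ∈ Finset.univ.erase j, ((x i).2.1 * fitWithout H j x i ^ 2
        + 2 * y.2.2 * ((x i).2.1 * H i j * fitWithout H j x i)
        + y.2.2 ^ 2 * ((x i).2.1 * H i j ^ 2)) :=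
    Finset.sum_congr rfl fun k hk => by
      rw [fit_update]; simp only [ne_eq, Finset.ne_of_mem_erase hk, not_false_eq_true,
        Function.update_of_ne]; ring
  have h2 := Finset.add_sum_erase Finset.univ (fun i => (x i).2.1 * H i j * fitWithout H j x i)
    (Finset.mem_univ j)
  have h4 := Finset.add_sum_erase Finset.univ (fun i => (x i).2.1 * H i j ^ 2)
    (Finset.mem_univ j)
  simp only [Function.update_self, hd, zero_mul, mul_zero, zero_add, ne_eq, OfNat.ofNat_ne_zero,
    not_false_eq_true, zero_pow] at h1 h2 h4
  rw [denom, ← h1, h3, Finset.sum_add_distrib, Finset.sum_add_distrib, ← Finset.mul_sum,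
    ← Finset.mul_sum, h2, h4, fit_update_self hd, ← Finset.mul_sum, ← Finset.mul_sum]
  have e : (s ^ 2 / n : ℝ) = s ^ 2 * ((√n)⁻¹) ^ 2 := by
    rw [inv_pow, Real.sq_sqrt (Nat.cast_nonneg n)]; rfl
  rw [e]
  ring

/-- The only delicate coefficient is the cross term L of the denominator. Cauchy–Schwarz gives L² ≤
4QG, where Q is a weighted column sum of |f_i| and G an average of |f_i| times squared fits. Hence
|L|³ ≤ 4(Q³ + G³), and the weighted power-mean inequality bounds both cubes. -/
theorem RegularDesign.norms_le_influence (h : RegularDesign H s K me ve mr vr)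
    (x : Fin n → ℝ × ℝ × ℝ) (j : Fin n) :
    1 + ‖(s * fit H x j, (0 : ℝ))‖ ^ 3
      + ‖(s * ∑ i, H i j * (x i).1,
          2 * (√n)⁻¹ * ∑ i, s ^ 2 * ((x i).2.1 * H i j * fitWithout H j x i))‖ ^ 3
      + ‖((0 : ℝ), (s * fit H x j) ^ 2)‖ ^ 3
      + ‖((0 : ℝ), ∑ i, s ^ 2 * ((x i).2.1 * H i j ^ 2))‖ ^ 3 ≤ 5 * influence H s K j x := by
  have hK := h.one_le
  have hn : (0 : ℝ) < n := Nat.cast_pos.2 h.pos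
  set A := s * fit H x j with hA
  set B := s * ∑ i, H i j * (x i).1 with hB
  set L := 2 * (√n)⁻¹ * ∑ i, s ^ 2 * ((x i).2.1 * H i j * fitWithout H j x i) with hL
  set Q := ∑ i, (s * H i j) ^ 2 * |(x i).2.1| with hQ
  set G := ∑ i, (n : ℝ)⁻¹ * (|(x i).2.1| * (s * fitWithout H j x i) ^ 2) with hG
  have Q0 : 0 ≤ Q := Finset.sum_nonneg fun i _ => by positivity
  have G0 : 0 ≤ G := Finset.sum_nonneg fun i _ => by positivity
  have hQ3 : Q ^ 3 ≤ K ^ 2 * ∑ i, (s * H i j) ^ 2 * |(x i).2.1| ^ 3 := by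
    refine (sum_mul_cube_le _ (fun i => sq_nonneg _) (fun i => abs_nonneg _)).trans ?_
    have : 0 ≤ ∑ i, (s * H i j) ^ 2 := Finset.sum_nonneg fun i _ => by positivity
    gcongr
    exact h.col_le' j
  have hG3 : G ^ 3 ≤ (n : ℝ)⁻¹ * ∑ i, (|(x i).2.1| ^ 3 * (32 * (s * fit H x i) ^ 6)
      + |(x i).2.1| ^ 3 * (32 * (s * H i j) ^ 6 * (x j).2.2 ^ 6)) := by
    refine (sum_mul_cube_le _ (fun i => by positivity) (fun i => by positivity)).trans ?_
    simp only [Finset.sum_const, Finset.card_univ, Fintype.card_fin, nsmul_eq_mul]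
    rw [mul_inv_cancel₀ hn.ne', one_pow, one_mul, ← Finset.mul_sum]
    gcongr with i
    have := add_pow_six_le (s * fit H x i) (-(s * H i j * (x j).2.2))
    rw [Even.neg_pow (by decide)] at this
    calc _ = |(x i).2.1| ^ 3 * (s * fit H x i + -(s * H i j * (x j).2.2)) ^ 6 := by
          rw [fitWithout]; ring
      _ ≤ |(x i).2.1| ^ 3 * (32 * ((s * fit H x i) ^ 6 + (s * H i j * (x j).2.2) ^ 6)) := by
          gcongr
      _ = _ := by ring
  have hL2 : L ^ 2 ≤ 4 * (Q * G) := by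
    have : (∑ i, (√n)⁻¹ * (s ^ 2 * ((x i).2.1 * H i j * fitWithout H j x i))) ^ 2 ≤ Q * G := by
      refine Finset.sum_sq_le_sum_mul_sum_of_sq_le_mul _ (fun i _ => by positivity)
        (fun i _ => by positivity) (fun i _ => le_of_eq ?_)
      rw [mul_pow, inv_pow, Real.sq_sqrt hn.le]
      have : (x i).2.1 ^ 2 = |(x i).2.1| * |(x i).2.1| := by rw [← sq, sq_abs]
      calc _ = (n : ℝ)⁻¹ * (s ^ 4 * H i j ^ 2 * fitWithout H j x i ^ 2 * (x i).2.1 ^ 2) := by ring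
        _ = _ := by rw [this]; ring
    rw [← Finset.mul_sum] at this
    calc L ^ 2 = 4 * ((√n)⁻¹ * ∑ i, s ^ 2 * ((x i).2.1 * H i j * fitWithout H j x i)) ^ 2 := by
          rw [hL]; ring
      _ ≤ _ := by gcongr
  have hL3 : |L| ^ 3 ≤ 4 * (Q ^ 3 + G ^ 3) := by
    have hq : 0 ≤ 4 * (Q ^ 3 + G ^ 3) := by positivity
    refine (sq_le_sq₀ (by positivity) hq).1 ?_
    calc (|L| ^ 3) ^ 2 = (L ^ 2) ^ 3 := by rw [← sq_abs L]; ring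
      _ ≤ (4 * (Q * G)) ^ 3 := by gcongr
      _ = 64 * (Q ^ 3 * G ^ 3) := by ring
      _ ≤ _ := by nlinarith [sq_nonneg (Q ^ 3 - G ^ 3)]
  have hq : ∑ i, s ^ 2 * ((x i).2.1 * H i j ^ 2) = ∑ i, (s * H i j) ^ 2 * (x i).2.1 :=
    Finset.sum_congr rfl fun i _ => by ring
  have hq' : |∑ i, s ^ 2 * ((x i).2.1 * H i j ^ 2)| ≤ Q := by
    rw [hq]
    refine (Finset.abs_sum_le_sum_abs _ _).trans (le_of_eq (Finset.sum_congr rfl fun i _ => ?_))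
    rw [abs_mul, abs_of_nonneg (sq_nonneg _)]
  have n1 : ‖(A, (0 : ℝ))‖ ^ 3 ≤ 1 + A ^ 6 := by
    rw [Prod.norm_def]
    simpa using abs_cube_le_one_add_pow_six A
  have n2 : ‖(B, L)‖ ^ 3 ≤ (1 + B ^ 6) + |L| ^ 3 := by
    rw [Prod.norm_def]
    simp only [Real.norm_eq_abs]
    have p1 := abs_cube_le_one_add_pow_six B
    have p2 : 0 ≤ |L| ^ 3 := by positivity
    have p3 : 0 ≤ |B| ^ 3 := by positivity
    rcases max_choice |B| |L| with hh | hh <;> rw [hh] <;> linarith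
  have n3 : ‖((0 : ℝ), A ^ 2)‖ ^ 3 ≤ A ^ 6 := by
    rw [Prod.norm_def]
    simp only [norm_zero, Real.norm_eq_abs, abs_pow, sq_abs]
    rw [max_eq_right (sq_nonneg _)]
    exact le_of_eq (by ring)
  have n4 : ‖((0 : ℝ), ∑ i, s ^ 2 * ((x i).2.1 * H i j ^ 2))‖ ^ 3 ≤ Q ^ 3 := by
    rw [Prod.norm_def]
    simp only [norm_zero, Real.norm_eq_abs]
    rw [max_eq_right (abs_nonneg _)]
    gcongr
  have a6 : 0 ≤ A ^ 6 := Even.pow_nonneg (by decide) _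
  have b6 : 0 ≤ B ^ 6 := Even.pow_nonneg (by decide) _
  have q3 : 0 ≤ Q ^ 3 := by positivity
  have g3 : 0 ≤ G ^ 3 := by positivity
  rw [influence, ← hA, ← hB]
  linarith

/-- Replacing the law of one coordinate changes the expectation of a smooth function of numerator
and denominator by `O(n ^ (-3/2))`. -/
theorem RegularDesign.abs_integral_swap_le (h : RegularDesign H s K me ve mr vr)
    {R : Fin n → Measure (ℝ × ℝ × ℝ)} [∀ i, IsProbabilityMeasure (R i)]
    (hR : ∀ i, TripleMoments (R i) K (me i) (ve i) (mr i) (vr i)) (j : Fin n)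
    {P Q : Measure (ℝ × ℝ × ℝ)} [IsProbabilityMeasure P] [IsProbabilityMeasure Q]
    (hP : TripleMoments P K (me j) (ve j) (mr j) (vr j))
    (hQ : TripleMoments Q K (me j) (ve j) (mr j) (vr j))
    {g : ℝ × ℝ → ℝ} (hg : Continuous g) (hgb : ∃ C, ∀ v, ‖g v‖ ≤ C) {M : ℝ} (hM : 0 ≤ M)
    {D₁ : ℝ × ℝ → ℝ × ℝ →L[ℝ] ℝ} {D₂ : ℝ × ℝ → ℝ × ℝ →L[ℝ] ℝ × ℝ →L[ℝ] ℝ}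
    (hB : ∀ p, ‖D₂ p‖ ≤ M)
    (hT : ∀ p w, |g (p + w) - g p - D₁ p w - D₂ p w w / 2| ≤ M * ‖w‖ ^ 3) :
    |∫ x, g (numer H s x, denom H s x) ∂Measure.pi (Function.update R j P)
      - ∫ x, g (numer H s x, denom H s x) ∂Measure.pi (Function.update R j Q)|
      ≤ 480 * M * (1 + K) * influenceBound K * ((√n)⁻¹) ^ 3 := by
  obtain ⟨C, hC⟩ := hgb
  set F : (Fin n → ℝ × ℝ × ℝ) → ℝ := fun x => g (numer H s x, denom H s x) with hF
  have hFc : Continuous F := by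
    simp only [hF, numer, denom, fit]
    fun_prop
  -- Fubini with coordinate j drawn last. The other coordinates have the same law whichever measure
  -- is put at j.
  have key : ∀ (ρ : Measure (ℝ × ℝ × ℝ)) [IsProbabilityMeasure ρ],
      Integrable (fun x => ∫ y, F (Function.update x j y) ∂ρ) (Measure.pi R) ∧
      ∫ x, F x ∂Measure.pi (Function.update R j ρ)
        = ∫ x, ∫ y, F (Function.update x j y) ∂ρ ∂Measure.pi R := by
    intro ρ _
    have hp := measurePreserving_update R j ρ
    have : IsProbabilityMeasure (Measure.pi (Function.update R j ρ)) := by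
      rw [← hp.map_eq]; exact Measure.isProbabilityMeasure_map hp.aemeasurable
    have iF : Integrable F (Measure.pi (Function.update R j ρ)) :=
      (integrable_const C).mono' hFc.aestronglyMeasurable (ae_of_all _ fun x => hC _)
    have iF' := hp.integrable_comp_of_integrable iF
    refine ⟨iF'.integral_prod_left, ?_⟩
    rw [← hp.map_eq] at iF ⊢
    rw [integral_map hp.aemeasurable iF.1]
    exact integral_prod _ iF'
  rw [(key P).2, (key Q).2, ← integral_sub (key P).1 (key Q).1]
  have hn : (1 : ℝ) ≤ n := Nat.one_le_cast.2 h.pos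
  have ht : 0 ≤ (√n)⁻¹ := by positivity
  have ht1 : (√n)⁻¹ ≤ 1 := inv_le_one_of_one_le₀ (Real.one_le_sqrt.2 hn)
  have hpt : ∀ x, ‖∫ y, F (Function.update x j y) ∂P - ∫ y, F (Function.update x j y) ∂Q‖
      ≤ 480 * M * (1 + K) * ((√n)⁻¹) ^ 3 * influence H s K j x := by
    intro x
    set p : ℝ × ℝ := (s / √n * ∑ i ∈ Finset.univ.erase j, (x i).1 * fitWithout H j x i,
      s ^ 2 / n * ∑ i ∈ Finset.univ.erase j, (x i).2.1 * fitWithout H j x i ^ 2) with hp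
    set u : ℝ × ℝ := (s * fit H x j, (0 : ℝ)) with hu
    set v : ℝ × ℝ := (s * ∑ i, H i j * (x i).1,
          2 * (√n)⁻¹ * ∑ i, s ^ 2 * ((x i).2.1 * H i j * fitWithout H j x i)) with hv
    set u' : ℝ × ℝ := ((0 : ℝ), (s * fit H x j) ^ 2) with hu'
    set v' : ℝ × ℝ := ((0 : ℝ), ∑ i, s ^ 2 * ((x i).2.1 * H i j ^ 2)) with hv'
    -- The base point p and the directions u, v, u', v' do not involve y, so the one-triple
    -- expansion applies conditionally on x.
    have e : ∀ y : ℝ × ℝ × ℝ, F (Function.update x j y)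
        = g (p + ((√n)⁻¹ • (y.1 • u + y.2.2 • v)
          + ((√n)⁻¹) ^ 2 • (y.2.1 • u' + y.2.2 ^ 2 • v'))) := by
      intro y
      simp only [hF]
      rw [numer_update h.diag, denom_update h.diag]
      congr 1
      ext <;> simp [hp, hu, hv, hu', hv']
    simp only [e]
    have bP := hP.abs_integral_sub_le hg ⟨C, hC⟩ hM (hB p) (hT p) ht ht1 u v u' v'
    have bQ := hQ.abs_integral_sub_le hg ⟨C, hC⟩ hM (hB p) (hT p) ht ht1 u v u' v'
    have hnorm := h.norms_le_influence x j
    rw [← hu, ← hv, ← hu', ← hv'] at hnorm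
    rw [Real.norm_eq_abs]
    -- Both laws have the same expansion, so it serves as the intermediate point. The constant is
    -- 480 = 2 · 48 · 5: two laws, the one-triple bound, and the factor in front of `influence`.
    refine (abs_sub_le _ _ _).trans ((add_le_add bP ((abs_sub_comm _ _).trans_le bQ)).trans ?_)
    have hc : 0 ≤ 96 * M * (1 + K) * ((√n)⁻¹) ^ 3 := by
      have := h.one_le; positivity
    have := mul_le_mul_of_nonneg_left hnorm hc
    linarith
  have hI := h.integral_influence_le hR j
  refine (norm_integral_le_of_norm_le (hI.1.const_mul _) (ae_of_all _ hpt)).trans ?_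
  rw [integral_const_mul]
  have hc : 0 ≤ 480 * M * (1 + K) * ((√n)⁻¹) ^ 3 := by
    have := h.one_le; positivity
  have := mul_le_mul_of_nonneg_left hI.2 hc
  linarith

/-- Lindeberg comparison of the two joint laws of numerator and denominator. -/
theorem RegularDesign.abs_integral_pi_sub_le (h : RegularDesign H s K me ve mr vr)
    {P Q : Fin n → Measure (ℝ × ℝ × ℝ)} [∀ i, IsProbabilityMeasure (P i)]
    [∀ i, IsProbabilityMeasure (Q i)]
    (hP : ∀ i, TripleMoments (P i) K (me i) (ve i) (mr i) (vr i))
    (hQ : ∀ i, TripleMoments (Q i) K (me i) (ve i) (mr i) (vr i))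
    {g : ℝ × ℝ → ℝ} (hg : Continuous g) (hgb : ∃ C, ∀ v, ‖g v‖ ≤ C) {M : ℝ} (hM : 0 ≤ M)
    {D₁ : ℝ × ℝ → ℝ × ℝ →L[ℝ] ℝ} {D₂ : ℝ × ℝ → ℝ × ℝ →L[ℝ] ℝ × ℝ →L[ℝ] ℝ}
    (hB : ∀ p, ‖D₂ p‖ ≤ M)
    (hT : ∀ p w, |g (p + w) - g p - D₁ p w - D₂ p w w / 2| ≤ M * ‖w‖ ^ 3) :
    |∫ x, g (numer H s x, denom H s x) ∂Measure.pi P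
      - ∫ x, g (numer H s x, denom H s x) ∂Measure.pi Q|
      ≤ 480 * M * (1 + K) * influenceBound K * (√n)⁻¹ := by
  classical
  set c := 480 * M * (1 + K) * influenceBound K * ((√n)⁻¹) ^ 3 with hc
  -- Hybrid argument: the coordinates in T already carry the law `Q`, and inserting one more index
  -- costs one swap.
  have main : ∀ T : Finset (Fin n),
      |∫ x, g (numer H s x, denom H s x) ∂Measure.pi P
        - ∫ x, g (numer H s x, denom H s x) ∂Measure.pi (fun i => if i ∈ T then Q i else P i)|
      ≤ T.card * c := by
    intro T
    induction T using Finset.induction_on with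
    | empty => simp
    | insert j T hj ih =>
      have inst : ∀ i, IsProbabilityMeasure (if i ∈ T then Q i else P i) := by
        intro i; split_ifs <;> infer_instance
      have hR : ∀ i, TripleMoments (if i ∈ T then Q i else P i) K (me i) (ve i) (mr i) (vr i) := by
        intro i; split_ifs
        · exact hQ i
        · exact hP i
      have e1 : Function.update (fun i => if i ∈ T then Q i else P i) j (P j)
          = fun i => if i ∈ T then Q i else P i := by
        rw [Function.update_eq_self_iff]; simp [hj]
      have e2 : Function.update (fun i => if i ∈ T then Q i else P i) j (Q j)
          = fun i => if i ∈ insert j T then Q i else P i := by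
        funext i
        by_cases hi : i = j
        · subst hi; simp
        · simp [hi]
      have := h.abs_integral_swap_le hR j (hP j) (hQ j) hg hgb hM hB hT
      rw [e1, e2, ← hc] at this
      rw [Finset.card_insert_of_notMem hj]
      refine (abs_sub_le _ _ _).trans ((add_le_add ih this).trans (le_of_eq ?_))
      push_cast; ring
  have := main Finset.univ
  simp only [Finset.mem_univ, if_true, Finset.card_univ, Fintype.card_fin] at this
  refine this.trans (le_of_eq ?_)
  have hn : (0 : ℝ) < n := Nat.cast_pos.2 h.pos
  -- There are n swaps of cost n^(-3/2) each.
  have e : (n : ℝ) * ((√n)⁻¹) ^ 2 = 1 := by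
    rw [inv_pow, Real.sq_sqrt hn.le, mul_inv_cancel₀ hn.ne']
  calc n * c = (n * ((√n)⁻¹) ^ 2) * (480 * M * (1 + K) * influenceBound K * (√n)⁻¹) := by
        rw [hc]; ring
    _ = _ := by rw [e, one_mul]

end

end JackknifeK

/-! ### Small-ball bounds for Gaussian variables -/

namespace JackknifeK

theorem gaussianReal_real_Icc_le (m : ℝ) {v : NNReal} (hv : 0 < v) {a b : ℝ} (hab : a ≤ b) :
    (gaussianReal m v).real (Set.Icc a b) ≤ (b - a) / √v := by
  have hv' : (0 : ℝ) < v := by exact_mod_cast hv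
  have hpdf : ∀ x, gaussianPDFReal m v x ≤ (√v)⁻¹ := by
    intro x
    rw [gaussianPDFReal]
    have h1 : Real.exp (-(x - m) ^ 2 / (2 * v)) ≤ 1 := by
      rw [Real.exp_le_one_iff]
      exact div_nonpos_of_nonpos_of_nonneg (by nlinarith [sq_nonneg (x - m)]) (by positivity)
    have h2 : (√(2 * Real.pi * v))⁻¹ ≤ (√v)⁻¹ := by
      gcongr
      nlinarith [Real.pi_gt_three]
    calc _ ≤ (√(2 * Real.pi * v))⁻¹ * 1 := by gcongr
      _ ≤ _ := by rwa [mul_one]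
  rw [measureReal_def, gaussianReal_apply_eq_integral m hv.ne',
    ENNReal.toReal_ofReal (setIntegral_nonneg measurableSet_Icc fun x _ =>
      gaussianPDFReal_nonneg m v x)]
  have h := setIntegral_mono_on (integrable_gaussianPDFReal m v).integrableOn
    (integrableOn_const (C := (√(v : ℝ))⁻¹) (by simp : volume (Set.Icc a b) ≠ ⊤)) measurableSet_Icc
    (fun x _ => hpdf x)
  refine h.trans (le_of_eq ?_)
  rw [setIntegral_const, smul_eq_mul, Real.volume_real_Icc_of_le hab]
  rfl

theorem integral_sq_gaussianReal (m : ℝ) (v : NNReal) :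
    ∫ x, x ^ 2 ∂gaussianReal m v = m ^ 2 + v := by
  have h1 := variance_eq_sub (memLp_id_gaussianReal' (μ := m) (v := v) 2 (by simp))
  rw [variance_id_gaussianReal] at h1
  simp only [Pi.pow_apply, id_eq] at h1
  rw [integral_id_gaussianReal] at h1
  linarith

theorem integrable_sq_gaussianReal (m : ℝ) (v : NNReal) :
    Integrable (fun x => x ^ 2) (gaussianReal m v) :=
  (memLp_id_gaussianReal' (μ := m) (v := v) 2 (by simp)).integrable_sq

theorem gaussianReal_real_abs_sub_ge_le (m : ℝ) (v : NNReal) {c : ℝ} (hc : 0 < c) :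
    (gaussianReal m v).real {x | c ≤ |x - m|} ≤ v / c ^ 2 := by
  have h := meas_ge_le_variance_div_sq (memLp_id_gaussianReal' (μ := m) (v := v) 2 (by simp)) hc
  simp only [id_eq] at h
  rw [integral_id_gaussianReal, variance_id_gaussianReal] at h
  exact ENNReal.toReal_le_of_le_ofReal (by positivity) h

/-- A Gaussian variable is rarely much smaller than its second moment. -/
theorem gaussianReal_real_small_ball (m : ℝ) (v : NNReal) (hT : 0 < m ^ 2 + v) {ε : ℝ}
    (hε : 0 < ε) (hε2 : ε ≤ 1 / 2) :
    (gaussianReal m v).real {x | x ^ 2 ≤ ε ^ 4 * (m ^ 2 + v)} ≤ 2 * ε := by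
  set T : ℝ := m ^ 2 + v with hTd
  -- If the variance is at least the fraction ε² of the second moment, the density bound suffices.
  -- Otherwise the mean dominates, and a small value forces a deviation of at least √T/2, to which
  -- Chebyshev applies.
  rcases le_total (ε ^ 2 * T) v with h | h
  · have hv' : (0 : ℝ) < v := lt_of_lt_of_le (by positivity) h
    have hv : 0 < v := by exact_mod_cast hv'
    have hsub : {x : ℝ | x ^ 2 ≤ ε ^ 4 * T} ⊆ Set.Icc (-(ε ^ 2 * √T)) (ε ^ 2 * √T) := by
      intro x hx
      have h1 : x ^ 2 ≤ (ε ^ 2 * √T) ^ 2 := by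
        rw [mul_pow, Real.sq_sqrt hT.le]
        calc x ^ 2 ≤ _ := hx
          _ = _ := by ring
      exact abs_le.1 (abs_le_of_sq_le_sq h1 (by positivity))
    refine (measureReal_mono hsub).trans ?_
    refine (gaussianReal_real_Icc_le m hv (by linarith [show 0 ≤ ε ^ 2 * √T by positivity])).trans ?_
    rw [div_le_iff₀ (by positivity)]
    have h2 : ε * √T ≤ √v := by
      refine Real.le_sqrt_of_sq_le ?_
      rw [mul_pow, Real.sq_sqrt hT.le]; exact h
    have : ε * (ε * √T) ≤ ε * √v := by gcongr
    linarith
  · have hsub : {x : ℝ | x ^ 2 ≤ ε ^ 4 * T} ⊆ {x | √T / 2 ≤ |x - m|} := by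
      intro x hx
      have hx' : x ^ 2 ≤ ε ^ 4 * T := hx
      have e2 : ε ^ 2 ≤ 1 / 4 := by nlinarith
      have e4 : ε ^ 4 ≤ 1 / 16 := by nlinarith [sq_nonneg ε]
      have hm : 3 / 4 * T ≤ m ^ 2 := by nlinarith
      have hx2 : x ^ 2 ≤ T / 16 := by nlinarith
      refine (sq_le_sq₀ (a := √T / 2) (b := |x - m|) (by positivity) (abs_nonneg _)).1 ?_
      rw [sq_abs, div_pow, Real.sq_sqrt hT.le]
      nlinarith [sq_nonneg (2 * x - m)]
    refine (measureReal_mono hsub).trans ((gaussianReal_real_abs_sub_ge_le m v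
      (by positivity)).trans ?_)
    rw [div_pow, Real.sq_sqrt hT.le, div_le_iff₀ (by positivity)]
    have e2 : ε ^ 2 ≤ ε / 2 := by nlinarith
    nlinarith

/-- The set lies in two intervals of length √(u + κ) - √(u - κ) ≤ 2√κ, where the root of a negative
number is 0. The bound does not depend on u, which is what later makes anti-concentration uniform in
a. -/
theorem gaussianReal_real_abs_sq_sub_le (m : ℝ) {v : NNReal} (hv : 0 < v) (u : ℝ) {κ : ℝ}
    (hκ : 0 ≤ κ) : (gaussianReal m v).real {x | |x ^ 2 - u| ≤ κ} ≤ 4 * √κ / √v := by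
  have hv' : (0 : ℝ) < √v := Real.sqrt_pos.2 (by exact_mod_cast hv)
  set b := √(u + κ)
  set a := √(u - κ)
  have hab : a ≤ b := Real.sqrt_le_sqrt (by linarith)
  have hba : b - a ≤ 2 * √κ := by
    have h1 : u + κ ≤ (a + 2 * √κ) ^ 2 := by
      have h2 : u - κ ≤ a ^ 2 := by
        rcases le_total 0 (u - κ) with h | h
        · rw [Real.sq_sqrt h]
        · exact h.trans (sq_nonneg _)
      nlinarith [Real.sq_sqrt hκ, Real.sqrt_nonneg κ, Real.sqrt_nonneg (u - κ),
        mul_nonneg (Real.sqrt_nonneg κ) (Real.sqrt_nonneg (u - κ))]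
    have := Real.sqrt_le_sqrt h1
    rw [Real.sqrt_sq (by positivity)] at this
    linarith
  have hsub : {x : ℝ | |x ^ 2 - u| ≤ κ} ⊆ Set.Icc a b ∪ Set.Icc (-b) (-a) := by
    intro x hx
    obtain ⟨h1, h2⟩ := abs_le.1 (show |x ^ 2 - u| ≤ κ from hx)
    have hb : |x| ≤ b := Real.abs_le_sqrt (by linarith)
    have ha : a ≤ |x| := by
      rw [← Real.sqrt_sq_eq_abs]; exact Real.sqrt_le_sqrt (by linarith)
    rcases le_total 0 x with h | h
    · rw [abs_of_nonneg h] at hb ha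
      exact Or.inl ⟨ha, hb⟩
    · rw [abs_of_nonpos h] at hb ha
      exact Or.inr ⟨by linarith, by linarith⟩
  calc _ ≤ (gaussianReal m v).real (Set.Icc a b ∪ Set.Icc (-b) (-a)) := measureReal_mono hsub
    _ ≤ _ := measureReal_union_le _ _
    _ ≤ (b - a) / √v + (-a - -b) / √v := add_le_add (gaussianReal_real_Icc_le m hv hab)
        (gaussianReal_real_Icc_le m hv (by linarith))
    _ = 2 * (b - a) / √v := by ring
    _ ≤ _ := div_le_div_of_nonneg_right (by linarith) hv'.le

/-- The weighted small-ball bound for a sum of squares. -/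
theorem measureReal_sum_sq_le {Ω ι : Type*} [MeasurableSpace Ω] [Fintype ι] {ρ : Measure Ω}
    [IsProbabilityMeasure ρ] {X : ι → Ω → ℝ} (hX : ∀ i, Measurable (X i)) {T : ι → ℝ}
    (hT : ∀ i, 0 ≤ T i) (hpos : 0 < ∑ i, T i) {δ p : ℝ} (hδ : 0 < δ)
    (hp : ∀ i, 0 < T i → ρ.real {ω | X i ω ^ 2 ≤ δ * T i} ≤ p) :
    ρ.real {ω | ∑ i, X i ω ^ 2 ≤ δ / 2 * ∑ i, T i} ≤ 2 * p := by
  set A : ι → Set Ω := fun i => {ω | X i ω ^ 2 ≤ δ * T i} with hA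
  have mA : ∀ i, MeasurableSet (A i) := fun i =>
    measurableSet_le ((hX i).pow_const 2) measurable_const
  set B : Set Ω := {ω | ∑ i, X i ω ^ 2 ≤ δ / 2 * ∑ i, T i} with hB
  have mB : MeasurableSet B :=
    measurableSet_le (Finset.measurable_sum _ fun i _ => (hX i).pow_const 2) measurable_const
  -- On B, the indices with X_i² > δ T_i carry at most half of the total weight Σ T_i, so those with
  -- X_i² ≤ δ T_i carry at least half. Taking expectations, no joint information about the X_i is
  -- needed.
  have hpt : ∀ ω, (∑ i, T i) * B.indicator 1 ω ≤ 2 * ∑ i, T i * (A i).indicator 1 ω := by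
    intro ω
    by_cases hω : ω ∈ B
    · rw [Set.indicator_of_mem hω, Pi.one_apply, mul_one]
      have h1 : ∀ i, T i ≤ T i * (A i).indicator 1 ω + δ⁻¹ * X i ω ^ 2 := by
        intro i
        by_cases hi : ω ∈ A i
        · rw [Set.indicator_of_mem hi, Pi.one_apply, mul_one]
          have : 0 ≤ δ⁻¹ * X i ω ^ 2 := by positivity
          linarith
        · rw [Set.indicator_of_notMem hi, mul_zero, zero_add]
          have : δ * T i < X i ω ^ 2 := not_le.1 hi
          rw [inv_mul_eq_div, le_div_iff₀ hδ]; linarith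
      have h2 := Finset.sum_le_sum fun i (_ : i ∈ Finset.univ) => h1 i
      rw [Finset.sum_add_distrib, ← Finset.mul_sum] at h2
      have h3 : δ⁻¹ * ∑ i, X i ω ^ 2 ≤ δ⁻¹ * (δ / 2 * ∑ i, T i) := by
        gcongr; exact hω
      have h4 : δ⁻¹ * (δ / 2 * ∑ i, T i) = (∑ i, T i) / 2 := by field_simp
      linarith
    · rw [Set.indicator_of_notMem hω, mul_zero]
      refine mul_nonneg zero_le_two (Finset.sum_nonneg fun i _ => mul_nonneg (hT i) ?_)
      exact Set.indicator_nonneg (fun _ _ => zero_le_one) _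
  have iA : ∀ i, Integrable (fun ω => T i * (A i).indicator (1 : Ω → ℝ) ω) ρ := fun i =>
    ((integrable_const (1 : ℝ)).indicator (mA i)).const_mul _
  have h := integral_mono (((integrable_const (1 : ℝ)).indicator mB).const_mul (∑ i, T i))
    ((integrable_finsetSum _ fun i _ => iA i).const_mul 2) hpt
  have e1 : ∫ ω, (∑ i, T i) * B.indicator (1 : Ω → ℝ) ω ∂ρ = (∑ i, T i) * ρ.real B := by
    rw [integral_const_mul, integral_indicator_one mB]
  have e2 : ∫ ω, 2 * ∑ i, T i * (A i).indicator (1 : Ω → ℝ) ω ∂ρ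
      = 2 * ∑ i, T i * ρ.real (A i) := by
    rw [integral_const_mul, integral_finsetSum _ fun i _ => iA i]
    congr 1
    refine Finset.sum_congr rfl fun i _ => ?_
    rw [integral_const_mul, integral_indicator_one (mA i)]
  have h' : (∑ i, T i) * ρ.real B ≤ 2 * ∑ i, T i * ρ.real (A i) := by
    rw [← e1, ← e2]; exact h
  have h3 : ∑ i, T i * ρ.real (A i) ≤ ∑ i, T i * p := by
    refine Finset.sum_le_sum fun i _ => ?_
    rcases (hT i).eq_or_lt with h0 | h0
    · simp [← h0]
    · exact mul_le_mul_of_nonneg_left (hp i h0) (hT i)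
  rw [← Finset.sum_mul] at h3
  have : (∑ i, T i) * ρ.real B ≤ (∑ i, T i) * (2 * p) := by linarith
  exact le_of_mul_le_mul_left this hpos

/-- The law of a linear form in independent Gaussian variables. -/
theorem map_sum_pi_gaussianReal {n : ℕ} (m : Fin n → ℝ) (v : Fin n → NNReal) (a : Fin n → ℝ) :
    (Measure.pi fun i => gaussianReal (m i) (v i)).map (fun x => ∑ i, a i * x i)
      = gaussianReal (∑ i, a i * m i) (∑ i, a i ^ 2 * (v i : ℝ)).toNNReal := by
  set ρ := Measure.pi fun i => gaussianReal (m i) (v i)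
  have hev : ∀ i, MeasurePreserving (Function.eval i) ρ (gaussianReal (m i) (v i)) := fun i =>
    measurePreserving_eval _ i
  have hm : ∀ i, Measurable (fun x : Fin n → ℝ => a i * x i) := fun i => by fun_prop
  have hlaw : ∀ i, ρ.map (fun x => a i * x i)
      = gaussianReal (a i * m i) (.mk (a i ^ 2) (sq_nonneg _) * v i) := by
    intro i
    rw [← gaussianReal_map_const_mul, ← (hev i).map_eq, Measure.map_map (by fun_prop) (by fun_prop)]
    rfl
  have hg : ∀ i, HasGaussianLaw (fun x : Fin n → ℝ => a i * x i) ρ := fun i =>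
    ⟨by rw [hlaw i]; infer_instance⟩
  have hi : iIndepFun (fun (i : Fin n) (x : Fin n → ℝ) => a i * x i) ρ :=
    iIndepFun_pi (X := fun i (y : ℝ) => a i * y) (fun i => by fun_prop)
  have hL2 : ∀ i, MemLp (fun x : Fin n → ℝ => a i * x i) 2 ρ := fun i => (hg i).memLp_two
  rw [(hi.hasGaussianLaw_fun_sum hg).map_eq_gaussianReal]
  congr 1
  · rw [integral_finsetSum _ fun i _ => (hL2 i).integrable (by norm_num)]
    refine Finset.sum_congr rfl fun i _ => ?_
    have := integral_map (μ := ρ) (φ := fun x : Fin n → ℝ => a i * x i) (f := fun y => y)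
      (hm i).aemeasurable (by fun_prop)
    rw [hlaw, integral_id_gaussianReal] at this
    exact this.symm
  · congr 1
    have hs : (fun x : Fin n → ℝ => ∑ i, a i * x i) = ∑ i, fun x : Fin n → ℝ => a i * x i := by
      ext x; simp
    rw [hs, IndepFun.variance_sum (fun i _ => hL2 i) (fun i _ j _ hij => hi.indepFun hij)]
    refine Finset.sum_congr rfl fun i _ => ?_
    have := variance_map (μ := ρ) (Y := fun x : Fin n → ℝ => a i * x i) (X := id)
      (by fun_prop) (hm i).aemeasurable
    rw [hlaw, variance_id_gaussianReal] at this
    rw [show (fun x : Fin n → ℝ => a i * x i) = id ∘ (fun x : Fin n → ℝ => a i * x i) from rfl,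
      ← this]
    simp

end JackknifeK

/-! ### The Gaussian analogue: anti-concentration and tightness -/

namespace JackknifeK

/-- The law of `(e, E e², r)` for independent Gaussian `e` and `r`. -/
noncomputable def gaussTriple (me ve mr vr : ℝ) : Measure (ℝ × ℝ × ℝ) :=
  ((gaussianReal me ve.toNNReal).prod (gaussianReal mr vr.toNNReal)).map
    (fun p => (p.1, me ^ 2 + ve, p.2))

instance (me ve mr vr : ℝ) : IsProbabilityMeasure (gaussTriple me ve mr vr) :=
  Measure.isProbabilityMeasure_map (by fun_prop)

/-- Independent Gaussian variables with given means and variances. -/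
noncomputable def gaussPi {n : ℕ} (m v : Fin n → ℝ) : Measure (Fin n → ℝ) :=
  Measure.pi fun i => gaussianReal (m i) (v i).toNNReal

instance {n : ℕ} (m v : Fin n → ℝ) : IsProbabilityMeasure (gaussPi m v) := by
  unfold gaussPi; infer_instance

/-- Errors and regressors are regrouped into two independent vectors, so that the regressors can be
frozen by Fubini. -/
theorem pi_gaussTriple {n : ℕ} (me ve mr vr : Fin n → ℝ) :
    Measure.pi (fun i => gaussTriple (me i) (ve i) (mr i) (vr i))
      = ((gaussPi me ve).prod (gaussPi mr vr)).map
        (fun q i => (q.1 i, me i ^ 2 + ve i, q.2 i)) := by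
  have h := (measurePreserving_arrowProdEquivProdArrow ℝ ℝ (Fin n)
    (fun i => gaussianReal (me i) (ve i).toNNReal)
    (fun i => gaussianReal (mr i) (vr i).toNNReal)).symm
  have hm : ∀ i, Measurable (fun p : ℝ × ℝ => (p.1, me i ^ 2 + ve i, p.2)) := fun i => by fun_prop
  have : ∀ i, SigmaFinite (((gaussianReal (me i) (ve i).toNNReal).prod
      (gaussianReal (mr i) (vr i).toNNReal)).map (fun p => (p.1, me i ^ 2 + ve i, p.2))) :=
    fun i => inferInstanceAs (SigmaFinite (gaussTriple (me i) (ve i) (mr i) (vr i)))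
  refine (Measure.pi_map_pi fun i => (hm i).aemeasurable).symm.trans ?_
  rw [← h.map_eq, Measure.map_map (by fun_prop) h.measurable]
  rfl

theorem integral_sq_sum_gaussPi {n : ℕ} {m v : Fin n → ℝ} (hv : ∀ i, 0 ≤ v i) (a : Fin n → ℝ) :
    Integrable (fun x => (∑ i, a i * x i) ^ 2) (gaussPi m v) ∧
      ∫ x, (∑ i, a i * x i) ^ 2 ∂gaussPi m v = (∑ i, a i * m i) ^ 2 + ∑ i, a i ^ 2 * v i := by
  have h := map_sum_pi_gaussianReal m (fun i => (v i).toNNReal) a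
  have hm : Measurable (fun x : Fin n → ℝ => ∑ i, a i * x i) := by fun_prop
  have i1 := integrable_sq_gaussianReal (∑ i, a i * m i)
    (∑ i, a i ^ 2 * ((v i).toNNReal : ℝ)).toNNReal
  have i2 := integral_sq_gaussianReal (∑ i, a i * m i)
    (∑ i, a i ^ 2 * ((v i).toNNReal : ℝ)).toNNReal
  rw [← h] at i1 i2
  rw [integrable_map_measure (by fun_prop) hm.aemeasurable] at i1
  rw [integral_map hm.aemeasurable (by fun_prop)] at i2
  refine ⟨i1, i2.trans ?_⟩
  congr 1
  rw [Real.coe_toNNReal _ (Finset.sum_nonneg fun i _ => by positivity)]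
  exact Finset.sum_congr rfl fun i _ => by rw [Real.coe_toNNReal _ (hv i)]

theorem gaussPi_real_preimage {n : ℕ} {m v : Fin n → ℝ} (hv : ∀ i, 0 ≤ v i) (a : Fin n → ℝ)
    {A : Set ℝ} (hA : MeasurableSet A) :
    (gaussPi m v).real {x | ∑ i, a i * x i ∈ A}
      = (gaussianReal (∑ i, a i * m i) (∑ i, a i ^ 2 * v i).toNNReal).real A := by
  have h := map_sum_pi_gaussianReal m (fun i => (v i).toNNReal) a
  have e : ∑ i, a i ^ 2 * ((v i).toNNReal : ℝ) = ∑ i, a i ^ 2 * v i :=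
    Finset.sum_congr rfl fun i _ => by rw [Real.coe_toNNReal _ (hv i)]
  rw [e] at h
  rw [← h, map_measureReal_apply (by fun_prop) hA]
  rfl

theorem prod_real_le_integral {α β : Type*} [MeasurableSpace α] [MeasurableSpace β]
    {ρ : Measure α} {σ : Measure β} [IsProbabilityMeasure ρ] [IsProbabilityMeasure σ]
    {S : Set (α × β)} (hS : MeasurableSet S) {f : β → ℝ} (hf : Integrable f σ)
    (h : ∀ b, ρ.real {a | (a, b) ∈ S} ≤ f b) : (ρ.prod σ).real S ≤ ∫ b, f b ∂σ := by
  have hf0 : ∀ b, 0 ≤ f b := fun b => measureReal_nonneg.trans (h b)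
  rw [measureReal_def]
  refine ENNReal.toReal_le_of_le_ofReal (integral_nonneg hf0) ?_
  rw [Measure.prod_apply_symm hS, ofReal_integral_eq_lintegral_ofReal hf (ae_of_all _ hf0)]
  refine lintegral_mono fun b => ?_
  exact (ENNReal.le_ofReal_iff_toReal_le (measure_ne_top _ _) (hf0 b)).2 (h b)

section
variable {n : ℕ} {H : Matrix (Fin n) (Fin n) ℝ} {s K : ℝ} {me ve mr vr : Fin n → ℝ}

theorem RegularDesign.ve_nonneg (h : RegularDesign H s K me ve mr vr) (i : Fin n) : 0 ≤ ve i :=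
  le_trans (inv_nonneg.2 (by linarith [h.one_le])) (h.le_ve i)

theorem RegularDesign.vr_nonneg (h : RegularDesign H s K me ve mr vr) (i : Fin n) : 0 ≤ vr i :=
  le_trans (inv_nonneg.2 (by linarith [h.one_le])) (h.le_vr i)

/-- The denominator in terms of the Gaussian first-stage variables. -/
noncomputable def gaussDenom (H : Matrix (Fin n) (Fin n) ℝ) (s : ℝ) (w : Fin n → ℝ)
    (r : Fin n → ℝ) : ℝ := s ^ 2 / n * ∑ i, w i * (∑ j, H i j * r j) ^ 2

/-- The fits at different i may be strongly dependent, so no law of large numbers is available. Each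
fit is Gaussian, and the marginal small-ball bounds combine through `measureReal_sum_sq_le`. In the
threshold, one factor 1/K comes from the weights E[e²] and one from the lower bound on the average
second moment. -/
theorem RegularDesign.gaussDenom_small (h : RegularDesign H s K me ve mr vr) {ε : ℝ}
    (hε : 0 < ε) (hε2 : ε ≤ 1 / 2) :
    (gaussPi mr vr).real {r | gaussDenom H s (fun i => me i ^ 2 + ve i) r ≤ ε ^ 4 / (2 * K ^ 2)}
      ≤ 4 * ε := by
  have hK : 0 < K := by linarith [h.one_le]
  have hn : (0 : ℝ) < n := Nat.cast_pos.2 h.pos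
  have hs : 0 < s ^ 2 / n := div_pos (pow_pos h.scale_pos 2) hn
  set T : Fin n → ℝ := fun i => (∑ j, H i j * mr j) ^ 2 + ∑ j, H i j ^ 2 * vr j with hT
  have hT0 : ∀ i, 0 ≤ T i := fun i => add_nonneg (sq_nonneg _)
    (Finset.sum_nonneg fun j _ => mul_nonneg (sq_nonneg _) (h.vr_nonneg j))
  have hTs : 0 < ∑ i, T i := by
    have h1 : 0 < s ^ 2 / n * ∑ i, T i := lt_of_lt_of_le (inv_pos.2 hK) h.average
    exact pos_of_mul_pos_right h1 hs.le
  have key := measureReal_sum_sq_le (ρ := gaussPi mr vr)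
    (X := fun i (r : Fin n → ℝ) => ∑ j, H i j * r j) (fun i => by fun_prop) hT0 hTs
    (δ := ε ^ 4) (p := 2 * ε) (by positivity) (fun i hi => by
      have e := gaussPi_real_preimage (m := mr) h.vr_nonneg (H i)
        (A := {x | x ^ 2 ≤ ε ^ 4 * T i}) (measurableSet_le (by fun_prop) (by fun_prop))
      refine (le_of_eq e).trans ?_
      have hv0 : 0 ≤ ∑ j, H i j ^ 2 * vr j :=
        Finset.sum_nonneg fun j _ => mul_nonneg (sq_nonneg _) (h.vr_nonneg j)
      have := gaussianReal_real_small_ball (∑ j, H i j * mr j)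
        (∑ j, H i j ^ 2 * vr j).toNNReal (by rw [Real.coe_toNNReal _ hv0]; exact hi) hε hε2
      rwa [Real.coe_toNNReal _ hv0] at this)
  refine (measureReal_mono (fun r hr => ?_)).trans (key.trans (by linarith))
  have hr' : gaussDenom H s (fun i => me i ^ 2 + ve i) r ≤ ε ^ 4 / (2 * K ^ 2) := hr
  rw [gaussDenom] at hr'
  have h1 : K⁻¹ * ∑ i, (∑ j, H i j * r j) ^ 2
      ≤ ∑ i, (me i ^ 2 + ve i) * (∑ j, H i j * r j) ^ 2 := by
    rw [Finset.mul_sum]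
    refine Finset.sum_le_sum fun i _ => mul_le_mul_of_nonneg_right ?_ (sq_nonneg _)
    nlinarith [h.le_ve i, sq_nonneg (me i)]
  have h2 : s ^ 2 / n * (K⁻¹ * ∑ i, (∑ j, H i j * r j) ^ 2) ≤ ε ^ 4 / (2 * K ^ 2) :=
    (mul_le_mul_of_nonneg_left h1 hs.le).trans hr'
  have h3 : ε ^ 4 / (2 * K ^ 2) ≤ K⁻¹ * (ε ^ 4 / 2 * (s ^ 2 / n * ∑ i, T i)) := by
    calc ε ^ 4 / (2 * K ^ 2) = K⁻¹ * (ε ^ 4 / 2 * K⁻¹) := by field_simp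
      _ ≤ _ := by gcongr; exact h.average
  have h4 : (K⁻¹ * (s ^ 2 / n)) * ∑ i, (∑ j, H i j * r j) ^ 2
      ≤ (K⁻¹ * (s ^ 2 / n)) * (ε ^ 4 / 2 * ∑ i, T i) := by linarith
  exact le_of_mul_le_mul_left h4 (by positivity)

/-- The numerator in terms of the Gaussian variables. -/
noncomputable def gaussNumer (H : Matrix (Fin n) (Fin n) ℝ) (s : ℝ)
    (q : (Fin n → ℝ) × (Fin n → ℝ)) : ℝ := ∑ i, s / √n * (∑ j, H i j * q.2 j) * q.1 i

theorem numer_triple (w : Fin n → ℝ) (q : (Fin n → ℝ) × (Fin n → ℝ)) :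
    numer H s (fun i => (q.1 i, w i, q.2 i)) = gaussNumer H s q := by
  simp only [numer, fit, gaussNumer, Finset.mul_sum]
  refine Finset.sum_congr rfl fun i _ => ?_
  rw [Finset.sum_mul]
  exact Finset.sum_congr rfl fun j _ => by ring

theorem denom_triple (w : Fin n → ℝ) (q : (Fin n → ℝ) × (Fin n → ℝ)) :
    denom H s (fun i => (q.1 i, w i, q.2 i)) = gaussDenom H s w q.2 := rfl

theorem measurable_numer : Measurable (numer H s) := by
  unfold numer fit; fun_prop

theorem measurable_denom : Measurable (denom H s) := by
  unfold denom fit; fun_prop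

theorem pi_gaussTriple_real {A : Set (ℝ × ℝ)} (hA : MeasurableSet A) :
    (Measure.pi (fun i => gaussTriple (me i) (ve i) (mr i) (vr i))).real
        {x | (numer H s x, denom H s x) ∈ A}
      = ((gaussPi me ve).prod (gaussPi mr vr)).real
        {q | (gaussNumer H s q, gaussDenom H s (fun i => me i ^ 2 + ve i) q.2) ∈ A} := by
  rw [pi_gaussTriple, map_measureReal_apply (by fun_prop)
    (show MeasurableSet {x | (numer H s x, denom H s x) ∈ A} from
      (measurable_numer.prodMk measurable_denom) hA)]
  simp only [Set.preimage_ofPred_eq, numer_triple, denom_triple]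

/-- Anti-concentration of `N² - a D` for the Gaussian analogue, uniformly in `a`. -/
theorem RegularDesign.anticoncentration (h : RegularDesign H s K me ve mr vr) {ε : ℝ}
    (hε : 0 < ε) (hε2 : ε ≤ 1 / 2) {κ : ℝ} (hκ : 0 ≤ κ) (a : ℝ) :
    (Measure.pi (fun i => gaussTriple (me i) (ve i) (mr i) (vr i))).real
        {x | |numer H s x ^ 2 - a * denom H s x| ≤ κ}
      ≤ 4 * ε + 4 * √κ / √(ε ^ 4 / (2 * K ^ 2) / K ^ 2) := by
  have hK : 0 < K := by linarith [h.one_le]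
  have hn : (0 : ℝ) < n := Nat.cast_pos.2 h.pos
  set w : Fin n → ℝ := fun i => me i ^ 2 + ve i with hw
  set d : ℝ := ε ^ 4 / (2 * K ^ 2) with hd
  have hd0 : 0 < d := by positivity
  have mN : Measurable (gaussNumer H s) := by unfold gaussNumer; fun_prop
  have mD : Measurable (gaussDenom H s w) := by unfold gaussDenom; fun_prop
  have e := pi_gaussTriple_real (H := H) (s := s) (me := me) (ve := ve) (mr := mr) (vr := vr)
    (A := {p : ℝ × ℝ | |p.1 ^ 2 - a * p.2| ≤ κ}) (measurableSet_le (by fun_prop) (by fun_prop))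
  refine (le_of_eq e).trans ?_
  set B : Set (Fin n → ℝ) := {r | gaussDenom H s w r ≤ d} with hB
  have mB : MeasurableSet B := measurableSet_le mD measurable_const
  have iB : Integrable (B.indicator (1 : (Fin n → ℝ) → ℝ)) (gaussPi mr vr) :=
    (integrable_const (1 : ℝ)).indicator mB
  refine (prod_real_le_integral (S := {q : (Fin n → ℝ) × (Fin n → ℝ) |
    |gaussNumer H s q ^ 2 - a * gaussDenom H s w q.2| ≤ κ})
    -- Conditional bound given r: the trivial bound 1 where the denominator is below d, the Gaussian
    -- density bound elsewhere.
    (f := fun r => B.indicator (1 : (Fin n → ℝ) → ℝ) r + 4 * √κ / √(d / K ^ 2))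
    (measurableSet_le (by fun_prop) (by fun_prop)) (iB.add (integrable_const _)) ?_).trans ?_
  · intro r
    have hc : 0 ≤ 4 * √κ / √(d / K ^ 2) := by positivity
    by_cases hr : r ∈ B
    · rw [Set.indicator_of_mem hr, Pi.one_apply]
      exact measureReal_le_one.trans (by linarith)
    · rw [Set.indicator_of_notMem hr, zero_add]
      have hr' : d < gaussDenom H s w r := not_le.1 hr
      set c : Fin n → ℝ := fun i => s / √n * ∑ j, H i j * r j with hcd
      have e1 := gaussPi_real_preimage (m := me) h.ve_nonneg c
        (A := {x | |x ^ 2 - a * gaussDenom H s w r| ≤ κ})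
        (measurableSet_le (by fun_prop) (by fun_prop))
      refine (le_of_eq e1).trans ?_
      -- Given r, the numerator is a linear form in the errors with coefficients c. Its variance is
      -- at least D/K², because me² + ve ≤ K ≤ K² ve.
      have hv : d / K ^ 2 ≤ ∑ i, c i ^ 2 * ve i := by
        have h1 : ∀ i, w i * (∑ j, H i j * r j) ^ 2
            ≤ K ^ 2 * (ve i * (∑ j, H i j * r j) ^ 2) := by
          intro i
          have h2 : w i ≤ K ^ 2 * ve i := by
            calc w i ≤ K := h.ve_le i
              _ = K ^ 2 * K⁻¹ := by field_simp
              _ ≤ _ := by gcongr; exact h.le_ve i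
          calc _ ≤ (K ^ 2 * ve i) * (∑ j, H i j * r j) ^ 2 :=
                mul_le_mul_of_nonneg_right h2 (sq_nonneg _)
            _ = _ := by ring
        have h3 : gaussDenom H s w r ≤ K ^ 2 * ∑ i, c i ^ 2 * ve i := by
          have h4 := Finset.sum_le_sum fun i (_ : i ∈ Finset.univ) => h1 i
          rw [← Finset.mul_sum] at h4
          have h5 : ∑ i, c i ^ 2 * ve i = s ^ 2 / n * ∑ i, ve i * (∑ j, H i j * r j) ^ 2 := by
            rw [Finset.mul_sum]
            refine Finset.sum_congr rfl fun i _ => ?_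
            rw [hcd]
            simp only
            rw [mul_pow, div_pow, Real.sq_sqrt hn.le]; ring
          rw [h5, gaussDenom]
          have := mul_le_mul_of_nonneg_left h4 (show 0 ≤ s ^ 2 / (n : ℝ) by positivity)
          linarith
        rw [div_le_iff₀ (by positivity)]
        linarith
      have hv0 : 0 < ∑ i, c i ^ 2 * ve i := lt_of_lt_of_le (by positivity) hv
      refine (gaussianReal_real_abs_sq_sub_le _ (Real.toNNReal_pos.2 hv0) _ hκ).trans ?_
      rw [Real.coe_toNNReal _ hv0.le]
      gcongr
  · refine (integral_add iB (integrable_const _)).trans_le ?_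
    rw [integral_indicator_one mB]
    simp only [integral_const, probReal_univ, one_smul]
    gcongr
    exact h.gaussDenom_small hε hε2

theorem measureReal_ge_le_integral_div {Ω : Type*} [MeasurableSpace Ω] {ρ : Measure Ω}
    [IsProbabilityMeasure ρ] {f : Ω → ℝ} (hf : Integrable f ρ) (h0 : ∀ ω, 0 ≤ f ω) {R : ℝ}
    (hR : 0 < R) : ρ.real {ω | R ≤ f ω} ≤ (∫ ω, f ω ∂ρ) / R := by
  rw [le_div_iff₀ hR, mul_comm]
  exact mul_meas_ge_le_integral_of_nonneg (ae_of_all _ h0) hf R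

/-- Tightness of the Gaussian numerator. -/
theorem RegularDesign.numer_tight (h : RegularDesign H s K me ve mr vr) {R : ℝ} (hR : 0 < R) :
    (Measure.pi (fun i => gaussTriple (me i) (ve i) (mr i) (vr i))).real
        {x | R ≤ numer H s x ^ 2} ≤ 2 * K / R := by
  have hK : 0 < K := by linarith [h.one_le]
  have hn : (0 : ℝ) < n := Nat.cast_pos.2 h.pos
  have mN : Measurable (gaussNumer H s) := by unfold gaussNumer; fun_prop
  have e := pi_gaussTriple_real (H := H) (s := s) (me := me) (ve := ve) (mr := mr) (vr := vr)
    (A := {p : ℝ × ℝ | R ≤ p.1 ^ 2}) (measurableSet_le (by fun_prop) (by fun_prop))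
  refine (le_of_eq e).trans ?_
  set c : (Fin n → ℝ) → Fin n → ℝ := fun r i => s / √n * ∑ j, H i j * r j with hcd
  -- Given r, the numerator has mean Σ b_j r_j.
  set b : Fin n → ℝ := fun j => s / √n * ∑ i, me i * H i j with hb
  have hs2 : (s / √n) ^ 2 = s ^ 2 / n := by rw [div_pow, Real.sq_sqrt hn.le]
  have e1 : ∀ r, ∑ i, c r i * me i = ∑ j, b j * r j := by
    intro r
    simp only [hcd, hb, Finset.mul_sum, Finset.sum_mul]
    rw [Finset.sum_comm]
    exact Finset.sum_congr rfl fun j _ => Finset.sum_congr rfl fun i _ => by ring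
  have e2 : ∀ r, ∑ i, c r i ^ 2 * ve i = ∑ i, (s ^ 2 / n * ve i) * (∑ j, H i j * r j) ^ 2 := by
    intro r
    refine Finset.sum_congr rfl fun i _ => ?_
    simp only [hcd]
    rw [mul_pow, hs2]; ring
  have q1 := integral_sq_sum_gaussPi (m := mr) h.vr_nonneg b
  have q2 : ∀ i, _ := fun i => integral_sq_sum_gaussPi (m := mr) h.vr_nonneg (H i)
  have i2 : Integrable (fun r : Fin n → ℝ => ∑ i, (s ^ 2 / n * ve i) * (∑ j, H i j * r j) ^ 2)
      (gaussPi mr vr) := integrable_finsetSum _ fun i _ => (q2 i).1.const_mul _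
  have i3 := (q1.1.add i2).div_const R
  refine (prod_real_le_integral (S := {q : (Fin n → ℝ) × (Fin n → ℝ) |
    R ≤ gaussNumer H s q ^ 2}) (measurableSet_le (by fun_prop) (by fun_prop)) i3 ?_).trans ?_
  · intro r
    have e3 := gaussPi_real_preimage (m := me) h.ve_nonneg (c r)
        (A := {x | R ≤ x ^ 2}) (measurableSet_le (by fun_prop) (by fun_prop))
    refine (le_of_eq e3).trans ?_
    refine (measureReal_ge_le_integral_div (integrable_sq_gaussianReal _ _)
      (fun _ => sq_nonneg _) hR).trans ?_
    rw [integral_sq_gaussianReal, Real.coe_toNNReal _ (Finset.sum_nonneg fun i _ =>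
      mul_nonneg (sq_nonneg _) (h.ve_nonneg i)), e1, e2]
    exact le_rfl
  · rw [integral_div]
    gcongr
    refine (integral_add q1.1 i2).trans_le ?_
    rw [q1.2, integral_finsetSum _ fun i _ => (q2 i).1.const_mul _]
    -- The second moment of the conditional mean is exactly the quantity bounded by `power`; the
    -- conditional variance is handled by the normalisation of the fits.
    have b1 : (∑ i, b i * mr i) ^ 2 + ∑ i, b i ^ 2 * vr i ≤ K := by
      have s1 : ∑ i, b i * mr i = s / √n * ∑ i, me i * ∑ j, H i j * mr j := by
        simp only [hb, Finset.mul_sum, Finset.sum_mul]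
        rw [Finset.sum_comm]
        exact Finset.sum_congr rfl fun j _ => Finset.sum_congr rfl fun i _ => by ring
      have s2 : ∑ j, b j ^ 2 * vr j = s ^ 2 / n * ∑ j, (∑ i, me i * H i j) ^ 2 * vr j := by
        rw [Finset.mul_sum]
        refine Finset.sum_congr rfl fun j _ => ?_
        simp only [hb]
        rw [mul_pow, hs2]; ring
      rw [s1, s2, mul_pow, hs2, ← mul_add]
      exact h.power
    have b2 : ∑ i, ∫ r : Fin n → ℝ, (s ^ 2 / n * ve i) * (∑ j, H i j * r j) ^ 2 ∂gaussPi mr vr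
        ≤ K := by
      calc _ ≤ ∑ i : Fin n, K / n := by
            refine Finset.sum_le_sum fun i _ => ?_
            rw [integral_const_mul, (q2 i).2]
            have h1 := h.fit_le i
            have h2 : ve i ≤ K := by nlinarith [h.ve_le i, sq_nonneg (me i)]
            calc _ = ve i * (s ^ 2 * ((∑ j, H i j * mr j) ^ 2 + ∑ j, H i j ^ 2 * vr j)) / n := by
                  ring
              _ ≤ K * 1 / n := by
                  refine div_le_div_of_nonneg_right ?_ hn.le
                  exact mul_le_mul h2 h1 (mul_nonneg (sq_nonneg _) (add_nonneg (sq_nonneg _)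
                    (Finset.sum_nonneg fun j _ => mul_nonneg (sq_nonneg _) (h.vr_nonneg j)))) hK.le
              _ = _ := by rw [mul_one]
        _ = K := by simp; field_simp
    linarith

/-- Tightness of the Gaussian denominator. -/
theorem RegularDesign.denom_tight (h : RegularDesign H s K me ve mr vr) {R : ℝ} (hR : 0 < R) :
    (Measure.pi (fun i => gaussTriple (me i) (ve i) (mr i) (vr i))).real
        {x | R ≤ denom H s x} ≤ K / R := by
  have hK : 0 < K := by linarith [h.one_le]
  have hn : (0 : ℝ) < n := Nat.cast_pos.2 h.pos
  set w : Fin n → ℝ := fun i => me i ^ 2 + ve i with hw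
  have hw0 : ∀ i, 0 ≤ w i := fun i => add_nonneg (sq_nonneg _) (h.ve_nonneg i)
  have mD : Measurable (gaussDenom H s w) := by unfold gaussDenom; fun_prop
  have e := pi_gaussTriple_real (H := H) (s := s) (me := me) (ve := ve) (mr := mr) (vr := vr)
    (A := {p : ℝ × ℝ | R ≤ p.2}) (measurableSet_le (by fun_prop) (by fun_prop))
  refine (le_of_eq e).trans ?_
  have q2 : ∀ i, _ := fun i => integral_sq_sum_gaussPi (m := mr) h.vr_nonneg (H i)
  have i2 : Integrable (gaussDenom H s w) (gaussPi mr vr) :=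
    (integrable_finsetSum _ fun i _ => (q2 i).1.const_mul _).const_mul _
  have hD0 : ∀ r, 0 ≤ gaussDenom H s w r := fun r => mul_nonneg (by positivity)
    (Finset.sum_nonneg fun i _ => mul_nonneg (hw0 i) (sq_nonneg _))
  have e2 : ((gaussPi me ve).prod (gaussPi mr vr)).real
      {q : (Fin n → ℝ) × (Fin n → ℝ) | R ≤ gaussDenom H s w q.2}
      = (gaussPi mr vr).real {r | R ≤ gaussDenom H s w r} := by
    have mS : MeasurableSet {r | R ≤ gaussDenom H s w r} := measurableSet_le measurable_const mD
    rw [← (measurePreserving_snd (μ := gaussPi me ve) (ν := gaussPi mr vr)).measureReal_preimage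
      mS.nullMeasurableSet]
    rfl
  refine (le_of_eq e2).trans ((measureReal_ge_le_integral_div i2 hD0 hR).trans ?_)
  gcongr
  unfold gaussDenom
  rw [integral_const_mul, integral_finsetSum _ fun i _ => (q2 i).1.const_mul _, Finset.mul_sum]
  calc _ ≤ ∑ i : Fin n, K / n := by
        refine Finset.sum_le_sum fun i _ => ?_
        rw [integral_const_mul, (q2 i).2]
        calc _ = w i * (s ^ 2 * ((∑ j, H i j * mr j) ^ 2 + ∑ j, H i j ^ 2 * vr j)) / n := by
              ring
          _ ≤ K * 1 / n := by
              refine div_le_div_of_nonneg_right ?_ hn.le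
              exact mul_le_mul (h.ve_le i) (h.fit_le i) (mul_nonneg (sq_nonneg _)
                (add_nonneg (sq_nonneg _)
                (Finset.sum_nonneg fun j _ => mul_nonneg (sq_nonneg _) (h.vr_nonneg j)))) hK.le
          _ = _ := by rw [mul_one]
    _ = K := by simp; field_simp

end

end JackknifeK

/-! ### From smooth test functions to distribution functions -/

namespace JackknifeK

theorem RegularDesign.denom_small {n : ℕ} {H : Matrix (Fin n) (Fin n) ℝ} {s K : ℝ}
    {me ve mr vr : Fin n → ℝ} (h : RegularDesign H s K me ve mr vr) {ε : ℝ}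
    (hε : 0 < ε) (hε2 : ε ≤ 1 / 2) :
    (Measure.pi (fun i => gaussTriple (me i) (ve i) (mr i) (vr i))).real
        {x | denom H s x ≤ ε ^ 4 / (2 * K ^ 2)} ≤ 4 * ε := by
  set w : Fin n → ℝ := fun i => me i ^ 2 + ve i with hw
  have mD : Measurable (gaussDenom H s w) := by unfold gaussDenom; fun_prop
  have e := pi_gaussTriple_real (H := H) (s := s) (me := me) (ve := ve) (mr := mr) (vr := vr)
    (A := {p : ℝ × ℝ | p.2 ≤ ε ^ 4 / (2 * K ^ 2)}) (measurableSet_le (by fun_prop) (by fun_prop))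
  have e2 : ((gaussPi me ve).prod (gaussPi mr vr)).real
      {q : (Fin n → ℝ) × (Fin n → ℝ) | gaussDenom H s w q.2 ≤ ε ^ 4 / (2 * K ^ 2)}
      = (gaussPi mr vr).real {r | gaussDenom H s w r ≤ ε ^ 4 / (2 * K ^ 2)} := by
    have mS : MeasurableSet {r | gaussDenom H s w r ≤ ε ^ 4 / (2 * K ^ 2)} :=
      measurableSet_le mD measurable_const
    rw [← (measurePreserving_snd (μ := gaussPi me ve) (ν := gaussPi mr vr)).measureReal_preimage
      mS.nullMeasurableSet]
    rfl
  exact (le_of_eq (e.trans e2)).trans (h.gaussDenom_small hε hε2)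

/-- Lower transfer of probabilities through a smooth cutoff. -/
theorem transfer_le {Ω : Type*} [MeasurableSpace Ω] {P Q : Measure Ω} [IsProbabilityMeasure P]
    [IsProbabilityMeasure Q] {N D : Ω → ℝ} (hN : Measurable N) (hD : Measurable D)
    {g : ℝ × ℝ → ℝ} (hg : Continuous g) (hg0 : ∀ p, 0 ≤ g p) (hg1 : ∀ p, g p ≤ 1)
    {S T : Set (ℝ × ℝ)} (hS : MeasurableSet S) (hT : MeasurableSet T)
    (hgS : ∀ p, p ∉ S → g p = 0) (hgT : ∀ p ∈ T, g p = 1) {ε : ℝ}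
    (he : |∫ x, g (N x, D x) ∂P - ∫ x, g (N x, D x) ∂Q| ≤ ε) :
    Q.real {x | (N x, D x) ∈ T} ≤ P.real {x | (N x, D x) ∈ S} + ε := by
  have hm : Measurable fun x => (N x, D x) := hN.prodMk hD
  have ig : ∀ (ρ : Measure Ω) [IsProbabilityMeasure ρ], Integrable (fun x => g (N x, D x)) ρ :=
    fun ρ _ => (integrable_const (1 : ℝ)).mono' (hg.measurable.comp hm).aestronglyMeasurable
      (ae_of_all _ fun x => by rw [Real.norm_of_nonneg (hg0 _)]; exact hg1 _)
  have h1 : Q.real {x | (N x, D x) ∈ T} ≤ ∫ x, g (N x, D x) ∂Q := by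
    have mT : MeasurableSet {x | (N x, D x) ∈ T} := hm hT
    rw [← integral_indicator_one mT]
    refine integral_mono ((integrable_const (1 : ℝ)).indicator mT) (ig Q) fun x => ?_
    by_cases hx : (N x, D x) ∈ T
    · rw [Set.indicator_of_mem (by exact hx)]; exact (hgT _ hx).ge
    · rw [Set.indicator_of_notMem (by exact hx)]; exact hg0 _
  have h2 : ∫ x, g (N x, D x) ∂P ≤ P.real {x | (N x, D x) ∈ S} := by
    have mS : MeasurableSet {x | (N x, D x) ∈ S} := hm hS
    rw [← integral_indicator_one mS]
    refine integral_mono (ig P) ((integrable_const (1 : ℝ)).indicator mS) fun x => ?_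
    by_cases hx : (N x, D x) ∈ S
    · rw [Set.indicator_of_mem (by exact hx)]; exact hg1 _
    · rw [Set.indicator_of_notMem (by exact hx)]; exact (hgS _ hx).le
  linarith [(abs_le.1 he).1]

/-- A smooth compactly supported minorant of `{0 < σ (a D - N²)}`. -/
noncomputable def testFn (R a σ κ : ℝ) (hR : 0 < R) (p : ℝ × ℝ) : ℝ :=
  (⟨R, R + 1, hR, by linarith⟩ : ContDiffBump (0 : ℝ × ℝ)) p
    * Real.smoothTransition (σ * (a * p.2 - p.1 ^ 2) / κ)

theorem testFn_contDiff (R a σ κ : ℝ) (hR : 0 < R) : ContDiff ℝ 3 (testFn R a σ κ hR) := by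
  unfold testFn
  refine (ContDiffBump.contDiff _).mul (Real.smoothTransition.contDiff.comp ?_)
  fun_prop

theorem testFn_hasCompactSupport (R a σ κ : ℝ) (hR : 0 < R) :
    HasCompactSupport (testFn R a σ κ hR) :=
  (ContDiffBump.hasCompactSupport _).mul_right

theorem testFn_nonneg (R a σ κ : ℝ) (hR : 0 < R) (p) : 0 ≤ testFn R a σ κ hR p :=
  mul_nonneg (ContDiffBump.nonneg _) (Real.smoothTransition.nonneg _)

theorem testFn_le_one (R a σ κ : ℝ) (hR : 0 < R) (p) : testFn R a σ κ hR p ≤ 1 :=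
  mul_le_one₀ (ContDiffBump.le_one _) (Real.smoothTransition.nonneg _)
    (Real.smoothTransition.le_one _)

theorem testFn_eq_zero (R a σ κ : ℝ) (hR : 0 < R) (hκ : 0 < κ) (p : ℝ × ℝ)
    (hp : σ * (a * p.2 - p.1 ^ 2) ≤ 0) : testFn R a σ κ hR p = 0 := by
  rw [testFn, Real.smoothTransition.zero_of_nonpos (div_nonpos_of_nonpos_of_nonneg hp hκ.le),
    mul_zero]

theorem testFn_eq_one (R a σ κ : ℝ) (hR : 0 < R) (hκ : 0 < κ) (p : ℝ × ℝ)
    (h1 : |p.1| ≤ R) (h2 : |p.2| ≤ R) (hp : κ ≤ σ * (a * p.2 - p.1 ^ 2)) :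
    testFn R a σ κ hR p = 1 := by
  rw [testFn, Real.smoothTransition.one_of_one_le ((one_le_div hκ).2 hp), mul_one]
  refine ContDiffBump.one_of_mem_closedBall _ ?_
  rw [mem_closedBall_zero_iff, Prod.norm_def]
  exact max_le h1 h2

/-- The probability that the squared numerator is at most `a` times the denominator. -/
noncomputable def ratioCdf {n : ℕ} (H : Matrix (Fin n) (Fin n) ℝ) (s : ℝ)
    (P : Fin n → Measure (ℝ × ℝ × ℝ)) (a : ℝ) : ℝ :=
  (Measure.pi P).real {x | numer H s x ^ 2 ≤ a * denom H s x}

/-- Pointwise comparison of the two distribution functions. -/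
theorem exists_pointwise_comparison {K ε κ R : ℝ} (hε : 0 < ε) (hε2 : ε ≤ 1 / 2) (hκ : 0 < κ)
    (hκε : 4 * √κ / √(ε ^ 4 / (2 * K ^ 2) / K ^ 2) ≤ ε) (hR : 1 ≤ R) (hRε : 2 * K / R ≤ ε)
    (a : ℝ) :
    ∃ n₀ : ℕ, ∀ n ≥ n₀, ∀ (H : Matrix (Fin n) (Fin n) ℝ) (s : ℝ) (me ve mr vr : Fin n → ℝ)
      (P : Fin n → Measure (ℝ × ℝ × ℝ)), (∀ i, IsProbabilityMeasure (P i)) →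
      RegularDesign H s K me ve mr vr →
      (∀ i, TripleMoments (P i) K (me i) (ve i) (mr i) (vr i)) →
      (∀ i, TripleMoments (gaussTriple (me i) (ve i) (mr i) (vr i)) K
        (me i) (ve i) (mr i) (vr i)) →
      |ratioCdf H s P a
        - ratioCdf H s (fun i => gaussTriple (me i) (ve i) (mr i) (vr i)) a| ≤ 12 * ε := by
  have hR0 : 0 < R := by linarith
  -- The Taylor constant M depends on R, a, σ and κ but not on n or on the model, so the threshold
  -- is uniform over designs for this fixed a.
  have test : ∀ σ : ℝ, ∃ n₀ : ℕ, ∀ n ≥ n₀, ∀ (H : Matrix (Fin n) (Fin n) ℝ) (s : ℝ)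
      (me ve mr vr : Fin n → ℝ) (P : Fin n → Measure (ℝ × ℝ × ℝ)),
      (∀ i, IsProbabilityMeasure (P i)) → RegularDesign H s K me ve mr vr →
      (∀ i, TripleMoments (P i) K (me i) (ve i) (mr i) (vr i)) →
      (∀ i, TripleMoments (gaussTriple (me i) (ve i) (mr i) (vr i)) K
        (me i) (ve i) (mr i) (vr i)) →
      |∫ x, testFn R a σ κ hR0 (numer H s x, denom H s x) ∂Measure.pi P
        - ∫ x, testFn R a σ κ hR0 (numer H s x, denom H s x)
          ∂Measure.pi (fun i => gaussTriple (me i) (ve i) (mr i) (vr i))| ≤ ε := by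
    intro σ
    obtain ⟨M, D₁, D₂, hM, hB, hT⟩ := exists_taylor_bound (testFn_contDiff R a σ κ hR0)
      (testFn_hasCompactSupport R a σ κ hR0)
    have hlim : Tendsto (fun n : ℕ => 480 * M * (1 + K) * influenceBound K * (√n)⁻¹) atTop
        (𝓝 0) := by
      have : Tendsto (fun n : ℕ => (√(n : ℝ))⁻¹) atTop (𝓝 0) :=
        tendsto_inv_atTop_zero.comp (Real.tendsto_sqrt_atTop.comp tendsto_natCast_atTop_atTop)
      simpa using this.const_mul (480 * M * (1 + K) * influenceBound K)
    obtain ⟨n₀, hn₀⟩ := eventually_atTop.1 (hlim.eventually_le_const hε)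
    refine ⟨n₀, fun n hn H s me ve mr vr P hPp hreg hP hQ => ?_⟩
    exact (hreg.abs_integral_pi_sub_le hP hQ (testFn_contDiff R a σ κ hR0).continuous
      ⟨1, fun v => by
        rw [Real.norm_of_nonneg (testFn_nonneg _ _ _ _ _ _)]; exact testFn_le_one _ _ _ _ _ _⟩
      hM hB hT).trans (hn₀ n hn)
  -- The sign 1 bounds the probability of {N² ≤ aD} from below, and the sign -1 does the same for
  -- the complement, hence from above for the event itself.
  obtain ⟨n₁, h₁⟩ := test 1
  obtain ⟨n₂, h₂⟩ := test (-1)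
  refine ⟨max n₁ n₂, fun n hn H s me ve mr vr P hPp hreg hP hQ => ?_⟩
  have t₁ := h₁ n (le_trans (le_max_left _ _) hn) H s me ve mr vr P hPp hreg hP hQ
  have t₂ := h₂ n (le_trans (le_max_right _ _) hn) H s me ve mr vr P hPp hreg hP hQ
  set Q := Measure.pi (fun i => gaussTriple (me i) (ve i) (mr i) (vr i)) with hQd
  have hN : Measurable (numer H s) := measurable_numer
  have hD : Measurable (denom H s) := measurable_denom
  have m1 : MeasurableSet {p : ℝ × ℝ | p.1 ^ 2 ≤ a * p.2} :=
    measurableSet_le (by fun_prop) (by fun_prop)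
  have m2 : MeasurableSet {p : ℝ × ℝ | a * p.2 < p.1 ^ 2} :=
    measurableSet_lt (by fun_prop) (by fun_prop)
  have mbox : ∀ σ : ℝ, MeasurableSet
      {p : ℝ × ℝ | |p.1| ≤ R ∧ |p.2| ≤ R ∧ κ ≤ σ * (a * p.2 - p.1 ^ 2)} := by
    intro σ
    have k1 : MeasurableSet {p : ℝ × ℝ | |p.1| ≤ R} := measurableSet_le (by fun_prop) (by fun_prop)
    have k2 : MeasurableSet {p : ℝ × ℝ | |p.2| ≤ R} := measurableSet_le (by fun_prop) (by fun_prop)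
    have k3 : MeasurableSet {p : ℝ × ℝ | κ ≤ σ * (a * p.2 - p.1 ^ 2)} :=
      measurableSet_le (by fun_prop) (by fun_prop)
    exact k1.inter (k2.inter k3)
  have u₁ := transfer_le hN hD (testFn_contDiff R a 1 κ hR0).continuous
    (testFn_nonneg R a 1 κ hR0) (testFn_le_one R a 1 κ hR0) m1 (mbox 1)
    (fun p hp => testFn_eq_zero R a 1 κ hR0 hκ p (by
      have : a * p.2 < p.1 ^ 2 := not_le.1 hp
      linarith)) (fun p hp => testFn_eq_one R a 1 κ hR0 hκ p hp.1 hp.2.1 hp.2.2) t₁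
  have u₂ := transfer_le hN hD (testFn_contDiff R a (-1) κ hR0).continuous
    (testFn_nonneg R a (-1) κ hR0) (testFn_le_one R a (-1) κ hR0) m2 (mbox (-1))
    (fun p hp => testFn_eq_zero R a (-1) κ hR0 hκ p (by
      have : p.1 ^ 2 ≤ a * p.2 := not_lt.1 hp
      linarith)) (fun p hp => testFn_eq_one R a (-1) κ hR0 hκ p hp.1 hp.2.1 hp.2.2) t₂
  have b1 := hreg.anticoncentration hε hε2 hκ.le a
  have b2 := hreg.numer_tight hR0
  have b3 := hreg.denom_tight hR0
  have b4 := hreg.denom_small hε hε2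
  rw [← hQd] at b1 b2 b3 b4
  have hK : 0 < K := by linarith [hreg.one_le]
  have b3' : K / R ≤ ε := by
    refine le_trans ?_ hRε
    gcongr; linarith
  -- The exceptional events cost 5ε near the boundary N² = aD, ε for each tail, and 4ε for a small
  -- denominator: 11ε in all. The smooth comparison adds one more ε.
  have cover : ∀ S T : Set (Fin n → ℝ × ℝ × ℝ),
      (∀ x ∈ S, x ∉ T → |numer H s x ^ 2 - a * denom H s x| ≤ κ ∨ R ≤ numer H s x ^ 2
        ∨ R ≤ denom H s x ∨ denom H s x ≤ ε ^ 4 / (2 * K ^ 2)) →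
      Q.real S ≤ Q.real T + 11 * ε := by
    intro S T hST
    have hsub : S ⊆ T ∪ ({x | |numer H s x ^ 2 - a * denom H s x| ≤ κ} ∪
        ({x | R ≤ numer H s x ^ 2} ∪ ({x | R ≤ denom H s x} ∪
          {x | denom H s x ≤ ε ^ 4 / (2 * K ^ 2)}))) := by
      intro x hx
      by_cases hxT : x ∈ T
      · exact Or.inl hxT
      · exact Or.inr (hST x hx hxT)
    have c0 := measureReal_mono (μ := Q) hsub
    have c1 := c0.trans (measureReal_union_le _ _)
    have c2 := measureReal_union_le (μ := Q) {x | |numer H s x ^ 2 - a * denom H s x| ≤ κ}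
      ({x | R ≤ numer H s x ^ 2} ∪ ({x | R ≤ denom H s x} ∪
          {x | denom H s x ≤ ε ^ 4 / (2 * K ^ 2)}))
    have c3 := measureReal_union_le (μ := Q) {x | R ≤ numer H s x ^ 2} ({x | R ≤ denom H s x} ∪
          {x | denom H s x ≤ ε ^ 4 / (2 * K ^ 2)})
    have c4 := measureReal_union_le (μ := Q) {x | R ≤ denom H s x}
          {x | denom H s x ≤ ε ^ 4 / (2 * K ^ 2)}
    linarith
  have hdR : ∀ x, ¬ R ≤ denom H s x → ¬ denom H s x ≤ ε ^ 4 / (2 * K ^ 2) →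
      |denom H s x| ≤ R := by
    intro x h1 h2
    have : 0 < ε ^ 4 / (2 * K ^ 2) := by positivity
    rw [abs_le]; constructor <;> linarith
  have hnR : ∀ x, ¬ R ≤ numer H s x ^ 2 → |numer H s x| ≤ R := by
    intro x h1
    refine abs_le_of_sq_le_sq ?_ hR0.le
    nlinarith
  have v₁ := cover {x | numer H s x ^ 2 ≤ a * denom H s x}
    {x | (numer H s x, denom H s x) ∈
      {p : ℝ × ℝ | |p.1| ≤ R ∧ |p.2| ≤ R ∧ κ ≤ 1 * (a * p.2 - p.1 ^ 2)}} (by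
    intro x hx hxT
    by_contra hcon
    push Not at hcon
    obtain ⟨k1, k2, k3, k4⟩ := hcon
    refine hxT ⟨hnR x k2.not_ge, hdR x k3.not_ge k4.not_ge, ?_⟩
    have hx' : numer H s x ^ 2 ≤ a * denom H s x := hx
    rw [abs_of_nonpos (by linarith)] at k1
    simp only; linarith)
  have v₂ := cover {x | a * denom H s x < numer H s x ^ 2}
    {x | (numer H s x, denom H s x) ∈
      {p : ℝ × ℝ | |p.1| ≤ R ∧ |p.2| ≤ R ∧ κ ≤ -1 * (a * p.2 - p.1 ^ 2)}} (by
    intro x hx hxT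
    by_contra hcon
    push Not at hcon
    obtain ⟨k1, k2, k3, k4⟩ := hcon
    refine hxT ⟨hnR x k2.not_ge, hdR x k3.not_ge k4.not_ge, ?_⟩
    have hx' : a * denom H s x < numer H s x ^ 2 := hx
    rw [abs_of_nonneg (by linarith)] at k1
    simp only; linarith)
  have hcompl : ∀ (ρ : Measure (Fin n → ℝ × ℝ × ℝ)) [IsProbabilityMeasure ρ],
      ρ.real {x | a * denom H s x < numer H s x ^ 2}
        = 1 - ρ.real {x | numer H s x ^ 2 ≤ a * denom H s x} := by
    intro ρ _
    rw [← probReal_compl_eq_one_sub (measurableSet_le (by fun_prop) (by fun_prop))]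
    congr 1
    ext x; simp
  have w₁ := hcompl (Measure.pi P)
  have w₂ := hcompl Q
  simp only [Set.mem_ofPred_eq] at u₁ u₂ v₁ v₂
  rw [ratioCdf, ratioCdf, ← hQd, abs_le]
  constructor <;> linarith

/-- Uniform closeness of two monotone functions from closeness on a grid. -/
theorem abs_sub_le_of_grid {F G : ℝ → ℝ} (hF : ∀ a b, 0 ≤ a → a ≤ b → F a ≤ F b)
    (hG : ∀ a b, 0 ≤ a → a ≤ b → G a ≤ G b) (hF1 : ∀ a, F a ≤ 1) (hG1 : ∀ a, G a ≤ 1)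
    {δ : ℝ} (hδ : 0 < δ) {m : ℕ} {p q t : ℝ}
    (hgrid : ∀ k ≤ m, |F (k * δ) - G (k * δ)| ≤ p) (hstep : ∀ a, 0 ≤ a → G (a + δ) ≤ G a + q)
    (htail : 1 - t ≤ G (m * δ)) (hq : 0 ≤ q) (ht : 0 ≤ t) (a : ℝ) (ha : 0 ≤ a) :
    |F a - G a| ≤ p + q + t := by
  rcases le_total (m * δ) a with h | h
  · have h1 := hF _ _ (by positivity) h
    have h2 := hG _ _ (by positivity) h
    have h3 := abs_le.1 (hgrid m le_rfl)
    rw [abs_le]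
    have p0 := (abs_nonneg _).trans (hgrid m le_rfl)
    constructor <;> linarith [hF1 a, hG1 a]
  · rcases h.eq_or_lt with h | h
    · rw [h]; linarith [hgrid m le_rfl]
    -- The grid points kδ and (k + 1)δ bracket a, and a < mδ keeps both in the grid. Monotonicity of
    -- F and G and the step bound for G do the rest.
    set k := ⌊a / δ⌋₊ with hk
    have k1 : k * δ ≤ a := by
      rw [← le_div_iff₀ hδ]; exact Nat.floor_le (by positivity)
    have k2 : a < (k + 1) * δ := by
      rw [← div_lt_iff₀ hδ]; exact Nat.lt_floor_add_one _
    have k3 : k + 1 ≤ m := by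
      have : (k : ℝ) < m := by
        by_contra hc
        push Not at hc
        have : m * δ ≤ k * δ := by gcongr
        linarith
      exact_mod_cast this
    have g1 := abs_le.1 (hgrid k (by omega))
    have g2 := abs_le.1 (hgrid (k + 1) k3)
    push_cast at g2
    have f1 := hF _ _ (by positivity) k1
    have f2 := hF _ _ ha k2.le
    have e1 := hG _ _ (by positivity) k1
    have e2 := hG _ _ ha k2.le
    have s1 := hstep (k * δ) (by positivity)
    have s2 : (k : ℝ) * δ + δ = (k + 1) * δ := by ring
    rw [s2] at s1
    rw [abs_le]
    constructor <;> linarith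

/-- Uniform comparison of the two distribution functions. -/
theorem exists_uniform_comparison {K η : ℝ} (hK : 1 ≤ K) (hη : 0 < η) :
    ∃ n₀ : ℕ, ∀ n ≥ n₀, ∀ (H : Matrix (Fin n) (Fin n) ℝ) (s : ℝ) (me ve mr vr : Fin n → ℝ)
      (P : Fin n → Measure (ℝ × ℝ × ℝ)), (∀ i, IsProbabilityMeasure (P i)) →
      RegularDesign H s K me ve mr vr →
      (∀ i, TripleMoments (P i) K (me i) (ve i) (mr i) (vr i)) →
      (∀ i, TripleMoments (gaussTriple (me i) (ve i) (mr i) (vr i)) K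
        (me i) (ve i) (mr i) (vr i)) →
      (∀ a b, 0 ≤ a → a ≤ b → ratioCdf H s P a ≤ ratioCdf H s P b) →
      (∀ a b, 0 ≤ a → a ≤ b →
        ratioCdf H s (fun i => gaussTriple (me i) (ve i) (mr i) (vr i)) a
          ≤ ratioCdf H s (fun i => gaussTriple (me i) (ve i) (mr i) (vr i)) b) →
      ∀ a, 0 ≤ a → |ratioCdf H s P a
        - ratioCdf H s (fun i => gaussTriple (me i) (ve i) (mr i) (vr i)) a| ≤ η := by
  have hK0 : 0 < K := by linarith
  -- The total error is 12ε on the grid, 6ε between grid points and 5ε in the tail.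
  set ε := min (η / 23) (1 / 2) with hεd
  have hε : 0 < ε := lt_min (by positivity) (by norm_num)
  have hε2 : ε ≤ 1 / 2 := min_le_right _ _
  have hεη : 23 * ε ≤ η := by
    have := min_le_left (η / 23) (1 / 2); linarith
  set d := ε ^ 4 / (2 * K ^ 2) with hd
  have hd0 : 0 < d := by positivity
  -- Chosen so that the density term in the anti-concentration bound equals ε.
  set κ := (ε * √(d / K ^ 2) / 4) ^ 2 with hκd
  have hκ : 0 < κ := by positivity
  have hκε : 4 * √κ / √(d / K ^ 2) ≤ ε := by
    have : 0 < √(d / K ^ 2) := by positivity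
    rw [hκd, Real.sqrt_sq (by positivity)]
    exact le_of_eq (by field_simp)
  set R := 2 * K / ε with hRd
  have hR : 1 ≤ R := by rw [hRd, one_le_div hε]; linarith
  have hRε : 2 * K / R ≤ ε := by rw [hRd]; exact le_of_eq (by field_simp)
  have hR0 : 0 < R := by linarith
  -- On {D < R}, increasing a by δ moves aD by at most κ, so a grid step is covered by
  -- anti-concentration.
  set δ := κ / R with hδd
  have hδ : 0 < δ := by positivity
  -- The last grid point is at least R/d, so N² < R and D > d already force N² ≤ mδ D.
  obtain ⟨m, hm⟩ := exists_nat_ge (R / d / δ)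
  have hmδ : R / d ≤ m * δ := by rwa [← div_le_iff₀ hδ]
  choose N hN using fun a => exists_pointwise_comparison (K := K) hε hε2 hκ hκε hR hRε a
  refine ⟨(Finset.range (m + 1)).sup fun k => N (k * δ), ?_⟩
  intro n hn H s me ve mr vr P hPp hreg hP hQ hmP hmQ a ha
  set Q := fun i => gaussTriple (me i) (ve i) (mr i) (vr i) with hQd
  have b2 := hreg.numer_tight hR0
  have b3 := hreg.denom_tight hR0
  have b4 := hreg.denom_small hε hε2
  rw [← hQd] at b2 b3 b4
  have b3' : K / R ≤ ε := by
    refine le_trans ?_ hRε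
    gcongr; linarith
  have hstep : ∀ a, 0 ≤ a → ratioCdf H s Q (a + δ) ≤ ratioCdf H s Q a + 6 * ε := by
    intro a _
    have b1 := hreg.anticoncentration hε hε2 hκ.le a
    rw [← hQd] at b1
    have hsub : {x | numer H s x ^ 2 ≤ (a + δ) * denom H s x} ⊆
        {x | numer H s x ^ 2 ≤ a * denom H s x} ∪
          ({x | |numer H s x ^ 2 - a * denom H s x| ≤ κ} ∪ {x | R ≤ denom H s x}) := by
      intro x hx
      have hx' : numer H s x ^ 2 ≤ (a + δ) * denom H s x := hx
      by_cases h1 : numer H s x ^ 2 ≤ a * denom H s x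
      · exact Or.inl h1
      · by_cases h2 : R ≤ denom H s x
        · exact Or.inr (Or.inr h2)
        · refine Or.inr (Or.inl ?_)
          push Not at h1 h2
          have h3 : δ * denom H s x ≤ δ * R := by gcongr
          have h4 : δ * R = κ := by rw [hδd]; field_simp
          show |numer H s x ^ 2 - a * denom H s x| ≤ κ
          rw [abs_of_pos (by linarith)]
          linarith
    have c0 := (measureReal_mono (μ := Measure.pi Q) hsub).trans (measureReal_union_le _ _)
    have c1 := measureReal_union_le (μ := Measure.pi Q)
      {x | |numer H s x ^ 2 - a * denom H s x| ≤ κ} {x | R ≤ denom H s x}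
    rw [ratioCdf, ratioCdf]
    linarith
  have htail : 1 - 5 * ε ≤ ratioCdf H s Q (m * δ) := by
    have hsub : (Set.univ : Set (Fin n → ℝ × ℝ × ℝ)) ⊆
        {x | numer H s x ^ 2 ≤ m * δ * denom H s x} ∪
          ({x | R ≤ numer H s x ^ 2} ∪ {x | denom H s x ≤ d}) := by
      intro x _
      by_cases h1 : R ≤ numer H s x ^ 2
      · exact Or.inr (Or.inl h1)
      · by_cases h2 : denom H s x ≤ d
        · exact Or.inr (Or.inr h2)
        · left
          push Not at h1 h2
          show numer H s x ^ 2 ≤ m * δ * denom H s x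
          calc numer H s x ^ 2 ≤ R := h1.le
            _ = R / d * d := by field_simp
            _ ≤ m * δ * denom H s x := by gcongr
    have c0 := (measureReal_mono (μ := Measure.pi Q) hsub).trans (measureReal_union_le _ _)
    have c1 := measureReal_union_le (μ := Measure.pi Q)
      {x | R ≤ numer H s x ^ 2} {x | denom H s x ≤ d}
    rw [probReal_univ] at c0
    rw [ratioCdf]
    linarith
  have := abs_sub_le_of_grid hmP hmQ (fun a => measureReal_le_one) (fun a => measureReal_le_one)
    hδ (m := m) (p := 12 * ε) (fun k hk => hN (k * δ) n
      (le_trans (Finset.le_sup (f := fun k : ℕ => N (k * δ))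
        (Finset.mem_range.2 (Nat.lt_succ_of_le hk))) hn) H s me ve mr vr P hPp hreg hP hQ)
    hstep htail (by positivity) (by positivity) a ha
  linarith

end JackknifeK

/-! ### First, second and sixth moments in the model and its Gaussian analogue -/

namespace JackknifeK

/-- Second moment of a linear form in independent square-integrable variables. -/
theorem integral_sq_sum_of_iIndepFun {Ω : Type*} [MeasurableSpace Ω] {μ : Measure Ω}
    [IsProbabilityMeasure μ] {n : ℕ} {X : Fin n → Ω → ℝ} (hX : ∀ i, MemLp (X i) 2 μ)
    (hi : iIndepFun X μ) (a : Fin n → ℝ) :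
    Integrable (fun ω => (∑ i, a i * X i ω) ^ 2) μ ∧
    ∫ ω, (∑ i, a i * X i ω) ^ 2 ∂μ
      = (∑ i, a i * ∫ ω, X i ω ∂μ) ^ 2 + ∑ i, a i ^ 2 * Var[X i; μ] := by
  have hL : ∀ i, MemLp (fun ω => a i * X i ω) 2 μ := fun i => (hX i).const_mul (a i)
  have hLs : MemLp (fun ω => ∑ i, a i * X i ω) 2 μ := memLp_finsetSum _ fun i _ => hL i
  refine ⟨hLs.integrable_sq, ?_⟩
  have h1 := variance_eq_sub hLs
  have hs : (fun ω => ∑ i, a i * X i ω) = ∑ i, fun ω => a i * X i ω := by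
    ext ω; simp
  have hia : iIndepFun (fun i ω => a i * X i ω) μ :=
    hi.comp (fun i x => a i * x) (fun i => by fun_prop)
  have h2 : Var[fun ω => ∑ i, a i * X i ω; μ] = ∑ i, a i ^ 2 * Var[X i; μ] := by
    rw [hs, IndepFun.variance_sum (fun i _ => hL i) (fun i _ j _ hij => hia.indepFun hij)]
    exact Finset.sum_congr rfl fun i _ => variance_const_mul _ _ _
  have h3 : ∫ ω, ∑ i, a i * X i ω ∂μ = ∑ i, a i * ∫ ω, X i ω ∂μ := by
    rw [integral_finsetSum _ fun i _ => (hL i).integrable (by norm_num)]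
    exact Finset.sum_congr rfl fun i _ => integral_const_mul _ _
  rw [h2, h3] at h1
  have h4 : ∫ ω, ((fun ω => ∑ i, a i * X i ω) ^ 2) ω ∂μ = ∫ ω, (∑ i, a i * X i ω) ^ 2 ∂μ := rfl
  rw [h4] at h1
  linarith

namespace IVSample

variable {Ω : Type*} [MeasurableSpace Ω] {μ : Measure Ω} {n : ℕ}
  (S : IVSample μ n) (β₀ : ℝ)

/-- The mean of the null error. -/
noncomputable def meanErr (i : Fin n) : ℝ := S.firstStage i * (S.β - β₀)

/-- The mean of the partialled-out regressor. -/
noncomputable def meanR (i : Fin n) : ℝ := S.firstStage i * (1 - S.rho β₀ i * (S.β - β₀))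

theorem nullErr_eq (i : Fin n) (ω : Ω) :
    S.nullErr β₀ i ω = S.meanErr β₀ i + S.eta β₀ i ω := by
  simp only [nullErr, y, x, meanErr, eta]; ring

theorem r_eq (i : Fin n) (ω : Ω) : S.r β₀ i ω = S.meanR β₀ i + S.zeta β₀ i ω := by
  simp only [r, nullErr_eq, x, meanR, meanErr, zeta]; ring

theorem memLp_eta (i : Fin n) : MemLp (S.eta β₀ i) 2 μ :=
  ((S.memLp_v i).const_mul _).add (S.memLp_ε i)

theorem memLp_zeta (i : Fin n) : MemLp (S.zeta β₀ i) 2 μ :=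
  (S.memLp_v i).sub ((S.memLp_eta β₀ i).const_mul _)

theorem memLp_nullErr [IsProbabilityMeasure μ] (i : Fin n) : MemLp (S.nullErr β₀ i) 2 μ := by
  have : S.nullErr β₀ i = fun ω => S.meanErr β₀ i + S.eta β₀ i ω := funext (S.nullErr_eq β₀ i)
  rw [this]
  exact (memLp_const (S.meanErr β₀ i)).add (S.memLp_eta β₀ i)

theorem memLp_x [IsProbabilityMeasure μ] (i : Fin n) : MemLp (S.x i) 2 μ := by
  have : S.x i = fun ω => S.firstStage i + S.v i ω := rfl
  rw [this]
  exact (memLp_const (S.firstStage i)).add (S.memLp_v i)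

theorem memLp_r [IsProbabilityMeasure μ] (i : Fin n) : MemLp (S.r β₀ i) 2 μ := by
  have : S.r β₀ i = fun ω => S.meanR β₀ i + S.zeta β₀ i ω := funext (S.r_eq β₀ i)
  rw [this]
  exact (memLp_const (S.meanR β₀ i)).add (S.memLp_zeta β₀ i)

theorem measurable_eta (i : Fin n) : Measurable (S.eta β₀ i) :=
  ((S.measurable_v i).const_mul _).add (S.measurable_ε i)

theorem measurable_zeta (i : Fin n) : Measurable (S.zeta β₀ i) :=
  (S.measurable_v i).sub ((S.measurable_eta β₀ i).const_mul _)

theorem measurable_nullErr (i : Fin n) : Measurable (S.nullErr β₀ i) := by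
  have : S.nullErr β₀ i = fun ω => S.meanErr β₀ i + S.eta β₀ i ω := funext (S.nullErr_eq β₀ i)
  rw [this]
  exact (S.measurable_eta β₀ i).const_add _

theorem measurable_r (i : Fin n) : Measurable (S.r β₀ i) := by
  have : S.r β₀ i = fun ω => S.meanR β₀ i + S.zeta β₀ i ω := funext (S.r_eq β₀ i)
  rw [this]
  exact (S.measurable_zeta β₀ i).const_add _

theorem integral_eta [IsProbabilityMeasure μ] (i : Fin n) : ∫ ω, S.eta β₀ i ω ∂μ = 0 := by
  have h1 := (S.memLp_v i).integrable (by norm_num)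
  have h2 := (S.memLp_ε i).integrable (by norm_num)
  simp only [eta]
  rw [integral_add (h1.const_mul _) h2, integral_const_mul, S.mean_v, S.mean_ε]
  simp

theorem integral_zeta [IsProbabilityMeasure μ] (i : Fin n) : ∫ ω, S.zeta β₀ i ω ∂μ = 0 := by
  have h1 := (S.memLp_v i).integrable (by norm_num)
  have h2 := (S.memLp_eta β₀ i).integrable (by norm_num)
  simp only [zeta]
  rw [integral_sub h1 (h2.const_mul _), integral_const_mul, S.mean_v, S.integral_eta]
  simp

theorem integral_nullErr [IsProbabilityMeasure μ] (i : Fin n) :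
    ∫ ω, S.nullErr β₀ i ω ∂μ = S.meanErr β₀ i := by
  simp only [nullErr_eq]
  rw [integral_add (integrable_const _) ((S.memLp_eta β₀ i).integrable (by norm_num)),
    integral_eta]
  simp

theorem integral_r [IsProbabilityMeasure μ] (i : Fin n) : ∫ ω, S.r β₀ i ω ∂μ = S.meanR β₀ i := by
  simp only [r_eq]
  rw [integral_add (integrable_const _) ((S.memLp_zeta β₀ i).integrable (by norm_num)),
    integral_zeta]
  simp

theorem variance_nullErr [IsProbabilityMeasure μ] (i : Fin n) :
    Var[S.nullErr β₀ i; μ] = ∫ ω, S.eta β₀ i ω ^ 2 ∂μ := by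
  rw [variance_eq_integral (S.measurable_nullErr β₀ i).aemeasurable, integral_nullErr]
  simp [nullErr_eq]

theorem variance_r [IsProbabilityMeasure μ] (i : Fin n) :
    Var[S.r β₀ i; μ] = ∫ ω, S.zeta β₀ i ω ^ 2 ∂μ := by
  rw [variance_eq_integral (S.measurable_r β₀ i).aemeasurable, integral_r]
  simp [r_eq]

theorem integral_nullErr_sq [IsProbabilityMeasure μ] (i : Fin n) :
    ∫ ω, S.nullErr β₀ i ω ^ 2 ∂μ = S.meanErr β₀ i ^ 2 + Var[S.nullErr β₀ i; μ] := by
  have := variance_eq_sub (S.memLp_nullErr β₀ i)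
  rw [integral_nullErr] at this
  simp only [Pi.pow_apply] at this
  linarith

theorem integral_r_sq [IsProbabilityMeasure μ] (i : Fin n) :
    ∫ ω, S.r β₀ i ω ^ 2 ∂μ = S.meanR β₀ i ^ 2 + Var[S.r β₀ i; μ] := by
  have := variance_eq_sub (S.memLp_r β₀ i)
  rw [integral_r] at this
  simp only [Pi.pow_apply] at this
  linarith

/-- The slope ρ_i is the regression coefficient, so r_i is a residual. Nonzero variance is needed
because division by zero would give slope 0. -/
theorem covariance_nullErr_r [IsProbabilityMeasure μ] (i : Fin n)
    (h : Var[S.nullErr β₀ i; μ] ≠ 0) :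
    cov[S.nullErr β₀ i, S.r β₀ i; μ] = 0 := by
  have e : S.r β₀ i = S.x i - fun ω => S.rho β₀ i * S.nullErr β₀ i ω := rfl
  rw [e, covariance_sub_right (S.memLp_nullErr β₀ i) (S.memLp_x i)
    ((S.memLp_nullErr β₀ i).const_mul _), covariance_const_mul_right,
    covariance_self (S.measurable_nullErr β₀ i).aemeasurable, rho, div_mul_cancel₀ _ h, sub_self]

theorem integral_nullErr_mul_r [IsProbabilityMeasure μ] (i : Fin n)
    (h : Var[S.nullErr β₀ i; μ] ≠ 0) :
    ∫ ω, S.nullErr β₀ i ω * S.r β₀ i ω ∂μ = S.meanErr β₀ i * S.meanR β₀ i := by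
  have := covariance_eq_sub (S.memLp_nullErr β₀ i) (S.memLp_r β₀ i)
  rw [S.covariance_nullErr_r β₀ i h, integral_nullErr, integral_r] at this
  simp only [Pi.mul_apply] at this
  linarith

/-- The triple `(ε i (β₀), ε i (β₀)², r i)`. -/
noncomputable def triple (i : Fin n) (ω : Ω) : ℝ × ℝ × ℝ :=
  (S.nullErr β₀ i ω, S.nullErr β₀ i ω ^ 2, S.r β₀ i ω)

theorem measurable_triple (i : Fin n) : Measurable (S.triple β₀ i) :=
  (S.measurable_nullErr β₀ i).prodMk
    (((S.measurable_nullErr β₀ i).pow_const 2).prodMk (S.measurable_r β₀ i))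

theorem iIndepFun_triple : iIndepFun (S.triple β₀) μ := by
  -- Each triple is a measurable function of the pair of errors of the same observation.
  have h := S.indep.comp (fun i (p : ℝ × ℝ) =>
    ((S.meanErr β₀ i + ((S.β - β₀) * p.2 + p.1),
      (S.meanErr β₀ i + ((S.β - β₀) * p.2 + p.1)) ^ 2,
      S.meanR β₀ i + (p.2 - S.rho β₀ i * ((S.β - β₀) * p.2 + p.1))) : ℝ × ℝ × ℝ))
    (fun i => by fun_prop)
  convert h using 2 with i
  funext ω
  simp [triple, nullErr_eq, r_eq, eta, zeta]

theorem iIndepFun_r : iIndepFun (S.r β₀) μ :=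
  (S.iIndepFun_triple β₀).comp (fun _ y => y.2.2) (fun _ => by fun_prop)

theorem iIndepFun_nullErr : iIndepFun (S.nullErr β₀) μ :=
  (S.iIndepFun_triple β₀).comp (fun _ y => y.1) (fun _ => by fun_prop)

theorem sum_ne_eq (f : Fin n → Fin n → ℝ) (hf : ∀ i, f i i = 0) (i : Fin n) :
    ∑ j with j ≠ i, f i j = ∑ j, f i j := by
  refine Finset.sum_filter_of_ne fun j _ hj hji => hj ?_
  rw [hji, hf]

theorem fitI_eq (i : Fin n) (ω : Ω) : S.fitI β₀ i ω = ∑ j, S.H i j * S.r β₀ j ω :=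
  sum_ne_eq (fun i j => S.H i j * S.r β₀ j ω) (fun i => by rw [S.H_diag, zero_mul]) i

theorem integral_fitI_sq [IsProbabilityMeasure μ] (i : Fin n) :
    Integrable (fun ω => S.fitI β₀ i ω ^ 2) μ ∧ ∫ ω, S.fitI β₀ i ω ^ 2 ∂μ
      = (∑ j, S.H i j * S.meanR β₀ j) ^ 2 + ∑ j, S.H i j ^ 2 * Var[S.r β₀ j; μ] := by
  have := integral_sq_sum_of_iIndepFun (S.memLp_r β₀) (S.iIndepFun_r β₀) (S.H i)
  simp only [integral_r] at this
  simpa only [fitI_eq] using this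

theorem scale_nonneg : 0 ≤ S.scale β₀ := inv_nonneg.2 (Real.sqrt_nonneg _)

/-- Positivity of the scale excludes a vanishing supremum, for which the inverse takes its default
value 0. -/
theorem scale_sq_mul_le (h : 0 < S.scale β₀) (i : Fin n) :
    S.scale β₀ ^ 2 * ∫ ω, S.fitI β₀ i ω ^ 2 ∂μ ≤ 1 := by
  have hM : ∫ ω, S.fitI β₀ i ω ^ 2 ∂μ ≤ ⨆ i, ∫ ω, S.fitI β₀ i ω ^ 2 ∂μ :=
    le_ciSup (f := fun i => ∫ ω, S.fitI β₀ i ω ^ 2 ∂μ) (Set.finite_range _).bddAbove i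
  rw [scale] at h ⊢
  have h1 : 0 < ⨆ i, ∫ ω, S.fitI β₀ i ω ^ 2 ∂μ := Real.sqrt_pos.1 (inv_pos.1 h)
  rw [inv_pow, Real.sq_sqrt h1.le, inv_mul_le_iff₀ h1, mul_one]
  exact hM

variable {S β₀} {c : ℝ}

/-- For n = 0 or scale 0 the averaged second moment is 0, which contradicts its positive lower
bound. -/
theorem BalancedDesign.scale_pos (hc : 0 < c) (h : S.BalancedDesign β₀ c) :
    0 < n ∧ 0 < S.scale β₀ := by
  have h1 := h.average
  have hc' : 0 < c⁻¹ := inv_pos.2 hc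
  constructor
  · rcases Nat.eq_zero_or_pos n with hn | hn
    · subst hn
      simp at h1
      linarith
    · exact hn
  · refine (S.scale_nonneg β₀).lt_of_ne fun h0 => ?_
    rw [← h0] at h1
    simp at h1
    linarith

theorem MomentCond.abs_firstStage_le (h : S.MomentCond β₀ c) (i : Fin n) :
    |S.firstStage i| ≤ c ∧ |S.β - β₀| ≤ c ∧ |S.rho β₀ i| ≤ c := by
  have := h.bounded i
  have h1 := abs_nonneg (S.firstStage i)
  have h2 := abs_nonneg (S.β - β₀)
  have h3 := abs_nonneg (S.rho β₀ i)
  refine ⟨?_, ?_, ?_⟩ <;> linarith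

theorem MomentCond.abs_meanErr_le (h : S.MomentCond β₀ c) (i : Fin n) :
    |S.meanErr β₀ i| ≤ c ^ 2 := by
  obtain ⟨h1, h2, h3⟩ := h.abs_firstStage_le i
  rw [meanErr, abs_mul, sq]
  exact mul_le_mul h1 h2 (abs_nonneg _) ((abs_nonneg _).trans h1)

theorem MomentCond.abs_meanR_le (hc : 1 < c) (h : S.MomentCond β₀ c) (i : Fin n) :
    |S.meanR β₀ i| ≤ 2 * c ^ 3 := by
  obtain ⟨h1, h2, h3⟩ := h.abs_firstStage_le i
  rw [meanR, abs_mul]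
  have h4 : |1 - S.rho β₀ i * (S.β - β₀)| ≤ 1 + c * c := by
    refine (abs_sub _ _).trans ?_
    rw [abs_one, abs_mul]
    gcongr
  calc _ ≤ c * (1 + c * c) := mul_le_mul h1 h4 (abs_nonneg _) (by linarith)
    _ ≤ _ := by nlinarith [mul_pos (show 0 < c by linarith) (show 0 < c - 1 by linarith)]

theorem MomentCond.variance_bounds [IsProbabilityMeasure μ] (h : S.MomentCond β₀ c) (i : Fin n) :
    c⁻¹ ≤ Var[S.nullErr β₀ i; μ] ∧ Var[S.nullErr β₀ i; μ] ≤ c ∧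
    c⁻¹ ≤ Var[S.r β₀ i; μ] ∧ Var[S.r β₀ i; μ] ≤ c := by
  have a := h.lower i 2 0 (by norm_num)
  have b := h.upper i 2 0 (by norm_num)
  have a' := h.lower i 0 2 (by norm_num)
  have b' := h.upper i 0 2 (by norm_num)
  simp only [sq_abs, pow_zero, mul_one, one_mul] at a b a' b'
  rw [variance_nullErr, variance_r]
  exact ⟨a, b, a', b'⟩

theorem pow_six_const_add [IsProbabilityMeasure μ] {X : Ω → ℝ} (hX : Measurable X) {m c : ℝ}
    (h6 : Integrable (fun ω => X ω ^ 6) μ) (hc : ∫ ω, X ω ^ 6 ∂μ ≤ c) :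
    Integrable (fun ω => (m + X ω) ^ 6) μ ∧ ∫ ω, (m + X ω) ^ 6 ∂μ ≤ 32 * (m ^ 6 + c) := by
  have j := ((integrable_const (m ^ 6)).add h6).const_mul 32
  have hb : ∀ ω, (m + X ω) ^ 6 ≤ 32 * (m ^ 6 + X ω ^ 6) := fun ω => add_pow_six_le _ _
  have i1 : Integrable (fun ω => (m + X ω) ^ 6) μ :=
    j.mono' (by fun_prop) (ae_of_all _ fun ω => by
      rw [Real.norm_of_nonneg (Even.pow_nonneg (by decide) _)]; exact hb ω)
  refine ⟨i1, (integral_mono i1 j hb).trans ?_⟩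
  rw [integral_const_mul]
  gcongr
  refine (integral_add (integrable_const _) h6).trans_le ?_
  simpa using hc

theorem MomentCond.pow_six (h : S.MomentCond β₀ c) (i : Fin n) :
    (Integrable (fun ω => S.eta β₀ i ω ^ 6) μ ∧ ∫ ω, S.eta β₀ i ω ^ 6 ∂μ ≤ c) ∧
    (Integrable (fun ω => S.zeta β₀ i ω ^ 6) μ ∧ ∫ ω, S.zeta β₀ i ω ^ 6 ∂μ ≤ c) := by
  have a := h.integrable i 6 0 (by norm_num)
  have b := h.upper i 6 0 (by norm_num)
  have a' := h.integrable i 0 6 (by norm_num)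
  have b' := h.upper i 0 6 (by norm_num)
  have e : ∀ x : ℝ, |x| ^ 6 = x ^ 6 := fun x => by
    rw [← abs_pow, abs_of_nonneg (Even.pow_nonneg (by decide) x)]
  simp only [e, pow_zero, mul_one, one_mul] at a b a' b'
  exact ⟨⟨a, b⟩, ⟨a', b'⟩⟩

end IVSample

/-- The constant controlling all moments, as a function of the constant of the assumptions. -/
noncomputable def momentBound (c : ℝ) : ℝ :=
  32 * (64 * c ^ 18 + c ^ 3 * (1 + ∫ x, x ^ 6 ∂gaussianReal 0 1))

theorem integral_gaussianReal_pow_six_nonneg : 0 ≤ ∫ x, x ^ 6 ∂gaussianReal 0 1 :=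
  integral_nonneg fun x => Even.pow_nonneg (by decide) x

theorem le_momentBound {c m t : ℝ} (hm : |m| ≤ 2 * c ^ 3)
    (ht : t ≤ c ^ 3 * (1 + ∫ x, x ^ 6 ∂gaussianReal 0 1)) :
    32 * (m ^ 6 + t) ≤ momentBound c := by
  have h6 : m ^ 6 ≤ 64 * c ^ 18 := by
    calc m ^ 6 = |m| ^ 6 := by rw [← abs_pow, abs_of_nonneg (Even.pow_nonneg (by decide) m)]
      _ ≤ (2 * c ^ 3) ^ 6 := by gcongr
      _ = _ := by ring
  rw [momentBound]
  linarith

theorem le_cube_mul {c : ℝ} (hc : 1 < c) :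
    c ≤ c ^ 3 * (1 + ∫ x, x ^ 6 ∂gaussianReal 0 1) := by
  have h0 := integral_gaussianReal_pow_six_nonneg
  have h1 : c ≤ c ^ 3 := le_self_pow₀ hc.le (by norm_num)
  nlinarith

theorem le_momentBound_self {c : ℝ} (hc : 1 < c) {t : ℝ} (ht : t ≤ 8 * c ^ 12) :
    t ≤ momentBound c := by
  have h0 := integral_gaussianReal_pow_six_nonneg
  have h1 : c ^ 12 ≤ c ^ 18 := pow_le_pow_right₀ hc.le (by norm_num)
  have h2 : 0 ≤ c ^ 3 * (1 + ∫ x, x ^ 6 ∂gaussianReal 0 1) := by positivity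
  have h3 : 0 ≤ c ^ 18 := by positivity
  rw [momentBound]
  linarith

/-- The variable is m + √v Z with Z standard normal. Only finiteness of the sixth moment of Z
matters, so its value stays unevaluated inside `momentBound`. -/
theorem integral_pow_six_gaussianReal_le {m v c : ℝ} (hc : 1 < c) (hv0 : 0 ≤ v) (hv : v ≤ c)
    (hm : |m| ≤ 2 * c ^ 3) :
    Integrable (fun x => x ^ 6) (gaussianReal m v.toNNReal) ∧
      ∫ x, x ^ 6 ∂gaussianReal m v.toNNReal ≤ momentBound c := by
  have hmap : (gaussianReal 0 1).map (fun x => m + √v * x) = gaussianReal m v.toNNReal := by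
    have h1 : (gaussianReal 0 1).map (fun x => √v * x) = gaussianReal 0 v.toNNReal := by
      rw [gaussianReal_map_const_mul]
      congr 1
      · simp
      · ext; simp [Real.sq_sqrt hv0, hv0]
    rw [show (fun x : ℝ => m + √v * x) = (fun x => m + x) ∘ (fun x => √v * x) from rfl,
      ← Measure.map_map (by fun_prop) (by fun_prop), h1, gaussianReal_map_const_add]
    congr 1; simp
  have i0 : Integrable (fun x : ℝ => x ^ 6) (gaussianReal 0 1) := by
    have := (memLp_id_gaussianReal (μ := 0) (v := 1) 6).integrable_norm_pow (p := 6) (by norm_num)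
    refine this.congr (ae_of_all _ fun x => ?_)
    simp only [id_eq, Real.norm_eq_abs]
    rw [← abs_pow, abs_of_nonneg (Even.pow_nonneg (by decide) x)]
  have e6 : ∀ x : ℝ, (√v * x) ^ 6 = v ^ 3 * x ^ 6 := fun x => by
    rw [mul_pow, show (√v) ^ 6 = (√v ^ 2) ^ 3 by ring, Real.sq_sqrt hv0]
  have i1 : Integrable (fun x : ℝ => (√v * x) ^ 6) (gaussianReal 0 1) := by
    simp only [e6]; exact i0.const_mul _
  have b1 : ∫ x : ℝ, (√v * x) ^ 6 ∂gaussianReal 0 1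
      ≤ c ^ 3 * (1 + ∫ x, x ^ 6 ∂gaussianReal 0 1) := by
    simp only [e6]
    rw [integral_const_mul]
    have h0 := integral_gaussianReal_pow_six_nonneg
    gcongr
    linarith
  have h := IVSample.pow_six_const_add (μ := gaussianReal 0 1) (X := fun x => √v * x) (m := m)
    (by fun_prop) i1 b1
  rw [← hmap, integrable_map_measure (by fun_prop) (by fun_prop),
    integral_map (by fun_prop) (by fun_prop)]
  exact ⟨h.1, h.2.trans (le_momentBound hm le_rfl)⟩

theorem tripleMoments_gaussTriple {me ve mr vr c : ℝ} (hc : 1 < c) (hve : 0 ≤ ve) (hve' : ve ≤ c)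
    (hvr : 0 ≤ vr) (hvr' : vr ≤ c) (hme : |me| ≤ c ^ 2) (hmr : |mr| ≤ 2 * c ^ 3) :
    TripleMoments (gaussTriple me ve mr vr) (momentBound c) me ve mr vr := by
  have hm : Measurable (fun p : ℝ × ℝ => (p.1, me ^ 2 + ve, p.2)) := by fun_prop
  have hme3 : |me| ≤ 2 * c ^ 3 := by
    refine hme.trans ?_
    have : c ^ 2 ≤ c ^ 3 := pow_le_pow_right₀ hc.le (by norm_num)
    have : 0 ≤ c ^ 3 := by positivity
    linarith
  obtain ⟨ie, be⟩ := integral_pow_six_gaussianReal_le hc hve hve' hme3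
  obtain ⟨ir, br⟩ := integral_pow_six_gaussianReal_le hc hvr hvr' hmr
  have hsq := sq_abs me
  have hw : |me ^ 2 + ve| ^ 3 ≤ 8 * c ^ 12 := by
    have h1 : me ^ 2 ≤ c ^ 4 := by
      calc me ^ 2 = |me| ^ 2 := hsq.symm
        _ ≤ (c ^ 2) ^ 2 := by gcongr
        _ = _ := by ring
    have h2 : c ≤ c ^ 4 := le_self_pow₀ hc.le (by norm_num)
    rw [abs_of_nonneg (by positivity)]
    calc _ ≤ (2 * c ^ 4) ^ 3 := by gcongr; linarith
      _ = _ := by ring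
  have eI : ∀ F : ℝ × ℝ × ℝ → ℝ, Measurable F → ∫ y, F y ∂gaussTriple me ve mr vr
      = ∫ p : ℝ × ℝ, F (p.1, me ^ 2 + ve, p.2)
        ∂((gaussianReal me ve.toNNReal).prod (gaussianReal mr vr.toNNReal)) := fun F hF => by
    rw [gaussTriple, integral_map hm.aemeasurable hF.aestronglyMeasurable]
  have iI : ∀ F : ℝ × ℝ × ℝ → ℝ, Measurable F → Integrable (fun p : ℝ × ℝ =>
        F (p.1, me ^ 2 + ve, p.2))
        ((gaussianReal me ve.toNNReal).prod (gaussianReal mr vr.toNNReal)) →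
      Integrable F (gaussTriple me ve mr vr) := fun F hF h => by
    rw [gaussTriple, integrable_map_measure hF.aestronglyMeasurable hm.aemeasurable]; exact h
  refine ⟨iI _ (by fun_prop) (ie.comp_fst _),
    iI _ (by fun_prop) (integrable_const (|me ^ 2 + ve| ^ 3)),
    iI _ (by fun_prop) (ir.comp_snd _), ?_, ?_, ?_, ?_, ?_, ?_, ?_, ?_, ?_⟩
  · rw [eI _ (by fun_prop), integral_fun_fst (fun x : ℝ => x ^ 6)]; simpa using be
  · rw [eI _ (by fun_prop)]; simpa using le_momentBound_self hc hw
  · rw [eI _ (by fun_prop), integral_fun_snd (fun x : ℝ => x ^ 6)]; simpa using br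
  · rw [eI _ (by fun_prop), integral_fun_fst (fun x : ℝ => x)]; simp
  · rw [eI _ (by fun_prop)]; simp
  · rw [eI _ (by fun_prop), integral_fun_snd (fun x : ℝ => x)]; simp
  · rw [eI _ (by fun_prop), integral_fun_fst (fun x : ℝ => x ^ 2), integral_sq_gaussianReal]
    simp [hve]
  · rw [eI _ (by fun_prop), integral_fun_snd (fun x : ℝ => x ^ 2), integral_sq_gaussianReal]
    simp [hvr]
  · rw [eI _ (by fun_prop), integral_prod_mul (fun x : ℝ => x) (fun x : ℝ => x)]; simp

end JackknifeK

/-! ### Translation of the statistics and assumptions, and the conclusion -/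

namespace JackknifeK

section RatioEvents

variable {n : ℕ} {H : Matrix (Fin n) (Fin n) ℝ} {s : ℝ}

/-- The statistic `N ^ 2 / D`, read as `0` when `D = 0`, has `{N ^ 2 ≤ a D}` as a sublevel set. -/
theorem sq_div_le_iff {N D a : ℝ} (hD : 0 ≤ D) (h0 : D = 0 → N = 0) (ha : 0 ≤ a) :
    N ^ 2 / D ≤ a ↔ N ^ 2 ≤ a * D := by
  rcases hD.eq_or_lt with h | h
  · simp [← h, h0 h.symm, ha]
  · rw [div_le_iff₀ h]

theorem numer_sq_le_iff (hs : 0 < s) (hn : 0 < n) (x : Fin n → ℝ × ℝ × ℝ) (a : ℝ) :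
    numer H s x ^ 2 ≤ a * denom H s x ↔
      (∑ i, (x i).1 * fit H x i) ^ 2 ≤ a * ∑ i, (x i).2.1 * fit H x i ^ 2 := by
  have hn' : (0 : ℝ) < n := by exact_mod_cast hn
  have hk : 0 < s ^ 2 / n := by positivity
  rw [numer, denom, mul_pow, div_pow, Real.sq_sqrt hn'.le, mul_left_comm,
    mul_le_mul_iff_right₀ hk]

theorem ratioCdf_map {Ω : Type*} [MeasurableSpace Ω] {μ : Measure Ω} [IsProbabilityMeasure μ]
    {T : Fin n → Ω → ℝ × ℝ × ℝ} (hT : ∀ i, Measurable (T i)) (hi : iIndepFun T μ) (a : ℝ) :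
    ratioCdf H s (fun i => μ.map (T i)) a
      = μ.real {ω | numer H s (fun i => T i ω) ^ 2 ≤ a * denom H s (fun i => T i ω)} := by
  have hm : MeasurableSet {x | numer H s x ^ 2 ≤ a * denom H s x} :=
    measurableSet_le (measurable_numer.pow_const 2) (measurable_denom.const_mul a)
  rw [ratioCdf, ← (iIndepFun_iff_map_fun_eq_pi_map fun i => (hT i).aemeasurable).1 hi,
    map_measureReal_apply (measurable_pi_lambda _ hT) hm]
  rfl

end RatioEvents

namespace IVSample

variable {Ω : Type*} [MeasurableSpace Ω] {μ : Measure Ω} {n : ℕ}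
  {S : IVSample μ n} {β₀ c : ℝ}

theorem JKI_eq (ω : Ω) : S.JKI β₀ ω = (∑ i, S.nullErr β₀ i ω * S.fitI β₀ i ω) ^ 2
    / ∑ i, S.nullErr β₀ i ω ^ 2 * S.fitI β₀ i ω ^ 2 := by
  have hD : 0 ≤ ∑ i, S.nullErr β₀ i ω ^ 2 * S.fitI β₀ i ω ^ 2 :=
    Finset.sum_nonneg fun i _ => by positivity
  rw [JKI]
  split_ifs with h
  · rw [mul_one]
  · rw [le_antisymm (not_lt.1 h) hD]; simp

theorem JKI_nonneg (ω : Ω) : 0 ≤ S.JKI β₀ ω := by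
  rw [JKI_eq]
  exact div_nonneg (sq_nonneg _) (Finset.sum_nonneg fun i _ => by positivity)

/-- A vanishing denominator forces every product ε_i Π̂_i to vanish, hence the numerator too. The
default value 0 of the statistic is then consistent with the inequality, since a ≥ 0. -/
theorem JKI_le_iff (hs : 0 < S.scale β₀) (hn : 0 < n) {a : ℝ} (ha : 0 ≤ a) (ω : Ω) :
    S.JKI β₀ ω ≤ a ↔ numer S.H (S.scale β₀) (fun i => S.triple β₀ i ω) ^ 2
      ≤ a * denom S.H (S.scale β₀) (fun i => S.triple β₀ i ω) := by
  rw [numer_sq_le_iff hs hn, JKI_eq, sq_div_le_iff _ _ ha]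
  · simp only [fitI_eq, triple, fit]
  · exact Finset.sum_nonneg fun i _ => by positivity
  · intro h
    rw [Finset.sum_eq_zero_iff_of_nonneg fun i _ => by positivity] at h
    refine Finset.sum_eq_zero fun i hi => ?_
    have := h i hi
    rwa [← mul_pow, sq_eq_zero_iff] at this

theorem measureReal_JKI_le [IsProbabilityMeasure μ] (hs : 0 < S.scale β₀) (hn : 0 < n) {a : ℝ} (ha : 0 ≤ a) :
    μ.real {ω | S.JKI β₀ ω ≤ a}
      = ratioCdf S.H (S.scale β₀) (fun i => μ.map (S.triple β₀ i)) a := by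
  rw [ratioCdf_map (S.measurable_triple β₀) (S.iIndepFun_triple β₀)]
  simp only [JKI_le_iff hs hn ha]

variable {Ω' : Type*} {εt rt : Fin n → Ω' → ℝ}

theorem fitG_eq (i : Fin n) (ω : Ω') : S.fitG rt i ω = ∑ j, S.H i j * rt j ω :=
  sum_ne_eq (fun i j => S.H i j * rt j ω) (fun i => by rw [S.H_diag, zero_mul]) i

theorem JKG_nonneg (ω : Ω') : 0 ≤ S.JKG β₀ εt rt ω :=
  div_nonneg (sq_nonneg _) (Finset.sum_nonneg fun _ _ =>
    mul_nonneg (integral_nonneg fun _ => sq_nonneg _) (sq_nonneg _))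

/-- The triples `(εt i, E[ε i (β₀)²], rt i)` of the Gaussian analogue. -/
noncomputable def tripleG (S : IVSample μ n) (β₀ : ℝ) (εt rt : Fin n → Ω' → ℝ) (i : Fin n)
    (ω : Ω') : ℝ × ℝ × ℝ :=
  (εt i ω, S.meanErr β₀ i ^ 2 + Var[S.nullErr β₀ i; μ], rt i ω)

/-- Here the weights are positive, so a vanishing denominator forces every Gaussian fit, and with it
the numerator, to be 0. -/
theorem JKG_le_iff [IsProbabilityMeasure μ] (hs : 0 < S.scale β₀) (hn : 0 < n)
    (hV : ∀ i, 0 < Var[S.nullErr β₀ i; μ]) {a : ℝ} (ha : 0 ≤ a) (ω : Ω') :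
    S.JKG β₀ εt rt ω ≤ a ↔ numer S.H (S.scale β₀) (fun i => S.tripleG β₀ εt rt i ω) ^ 2
      ≤ a * denom S.H (S.scale β₀) (fun i => S.tripleG β₀ εt rt i ω) := by
  have hw : ∀ i, 0 < S.meanErr β₀ i ^ 2 + Var[S.nullErr β₀ i; μ] := fun i => by
    have := hV i; positivity
  rw [numer_sq_le_iff hs hn, JKG]
  simp only [integral_nullErr_sq]
  have hD : ∀ i ∈ Finset.univ, 0 ≤ (S.meanErr β₀ i ^ 2 + Var[S.nullErr β₀ i; μ])
      * S.fitG rt i ω ^ 2 := fun i _ => mul_nonneg (hw i).le (sq_nonneg _)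
  rw [sq_div_le_iff (Finset.sum_nonneg hD) _ ha]
  · simp only [fitG_eq, tripleG, fit]
  · intro h
    rw [Finset.sum_eq_zero_iff_of_nonneg hD] at h
    refine Finset.sum_eq_zero fun i hi => ?_
    rcases mul_eq_zero.1 (h i hi) with h' | h'
    · exact absurd h' (hw i).ne'
    · rw [sq_eq_zero_iff.1 h', mul_zero]

variable [MeasurableSpace Ω'] {ν : Measure Ω'} [IsProbabilityMeasure ν] [IsProbabilityMeasure μ]

/-- Uncorrelated jointly Gaussian variables are independent; this is where partialling out the true
ρ_i gives the product law. -/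
theorem IsGaussianAnalogue.map_tripleG (h : S.IsGaussianAnalogue β₀ ν εt rt) {i : Fin n}
    (hV : 0 < Var[S.nullErr β₀ i; μ]) :
    ν.map (S.tripleG β₀ εt rt i) = gaussTriple (S.meanErr β₀ i) Var[S.nullErr β₀ i; μ]
      (S.meanR β₀ i) Var[S.r β₀ i; μ] := by
  have hg := h.gaussian i
  have hi : IndepFun (εt i) (rt i) ν := hg.indepFun_of_covariance_eq_zero (by
    rw [h.cov_εr, S.covariance_nullErr_r β₀ i hV.ne'])
  have hp := (indepFun_iff_map_prod_eq_prod_map_map (h.measurable_ε i).aemeasurable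
    (h.measurable_r i).aemeasurable).1 hi
  rw [hg.fst.map_eq_gaussianReal, hg.snd.map_eq_gaussianReal, h.mean_ε, h.mean_r, h.var_ε,
    h.var_r, integral_nullErr, integral_r] at hp
  rw [gaussTriple, ← hp, Measure.map_map (by fun_prop)
    ((h.measurable_ε i).prodMk (h.measurable_r i))]
  rfl

theorem IsGaussianAnalogue.measureReal_JKG_le (h : S.IsGaussianAnalogue β₀ ν εt rt)
    (hs : 0 < S.scale β₀) (hn : 0 < n) (hV : ∀ i, 0 < Var[S.nullErr β₀ i; μ])
    {a : ℝ} (ha : 0 ≤ a) :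
    ν.real {ω | S.JKG β₀ εt rt ω ≤ a} = ratioCdf S.H (S.scale β₀)
      (fun i => gaussTriple (S.meanErr β₀ i) Var[S.nullErr β₀ i; μ]
        (S.meanR β₀ i) Var[S.r β₀ i; μ]) a := by
  have hm : ∀ i, Measurable (S.tripleG β₀ εt rt i) := fun i =>
    (h.measurable_ε i).prodMk (measurable_const.prodMk (h.measurable_r i))
  have hi : iIndepFun (S.tripleG β₀ εt rt) ν := h.indep.comp (fun i (p : ℝ × ℝ) =>
    ((p.1, S.meanErr β₀ i ^ 2 + Var[S.nullErr β₀ i; μ], p.2) : ℝ × ℝ × ℝ))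
    (fun i => by fun_prop)
  simp only [← h.map_tripleG (hV _)]
  rw [ratioCdf_map hm hi]
  simp only [JKG_le_iff hs hn hV ha]

theorem MomentCond.tripleMoments (hc : 1 < c) (h : S.MomentCond β₀ c) (i : Fin n) :
    TripleMoments (μ.map (S.triple β₀ i)) (momentBound c) (S.meanErr β₀ i)
      Var[S.nullErr β₀ i; μ] (S.meanR β₀ i) Var[S.r β₀ i; μ] := by
  have hm := S.measurable_triple β₀ i
  obtain ⟨⟨i1, b1⟩, i2, b2⟩ := h.pow_six i
  have hme : |S.meanErr β₀ i| ≤ 2 * c ^ 3 := by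
    have h1 : c ^ 2 ≤ c ^ 3 := pow_le_pow_right₀ hc.le (by norm_num)
    have h2 : 0 ≤ c ^ 3 := by positivity
    linarith [h.abs_meanErr_le i]
  have he := pow_six_const_add (m := S.meanErr β₀ i) (S.measurable_eta β₀ i) i1
    (b1.trans (le_cube_mul hc))
  have hr := pow_six_const_add (m := S.meanR β₀ i) (S.measurable_zeta β₀ i) i2
    (b2.trans (le_cube_mul hc))
  simp only [← nullErr_eq, ← r_eq] at he hr
  have be := he.2.trans (le_momentBound hme le_rfl)
  have br := hr.2.trans (le_momentBound (h.abs_meanR_le hc i) le_rfl)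
  have e3 : ∀ x : ℝ, |x ^ 2| ^ 3 = x ^ 6 := fun x => by
    rw [abs_of_nonneg (sq_nonneg x), ← pow_mul]
  have hV : Var[S.nullErr β₀ i; μ] ≠ 0 :=
    ((inv_pos.2 (by linarith)).trans_le (h.variance_bounds i).1).ne'
  have eI : ∀ F : ℝ × ℝ × ℝ → ℝ, Measurable F → ∫ y, F y ∂(μ.map (S.triple β₀ i))
      = ∫ ω, F (S.triple β₀ i ω) ∂μ := fun F hF =>
    integral_map hm.aemeasurable hF.aestronglyMeasurable
  have iI : ∀ F : ℝ × ℝ × ℝ → ℝ, Measurable F → Integrable (fun ω => F (S.triple β₀ i ω)) μ →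
      Integrable F (μ.map (S.triple β₀ i)) := fun F hF h =>
    (integrable_map_measure hF.aestronglyMeasurable hm.aemeasurable).2 h
  refine ⟨iI _ (by fun_prop) he.1, iI _ (by fun_prop) (by simpa only [triple, e3] using he.1),
    iI _ (by fun_prop) hr.1, ?_, ?_, ?_, ?_, ?_, ?_, ?_, ?_, ?_⟩
  · rw [eI _ (by fun_prop)]; exact be
  · rw [eI _ (by fun_prop)]; simpa only [triple, e3] using be
  · rw [eI _ (by fun_prop)]; exact br
  · rw [eI _ (by fun_prop)]; exact S.integral_nullErr β₀ i
  · rw [eI _ (by fun_prop)]; exact S.integral_nullErr_sq β₀ i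
  · rw [eI _ (by fun_prop)]; exact S.integral_r β₀ i
  · rw [eI _ (by fun_prop)]; exact S.integral_nullErr_sq β₀ i
  · rw [eI _ (by fun_prop)]; exact S.integral_r_sq β₀ i
  · rw [eI _ (by fun_prop)]; exact S.integral_nullErr_mul_r β₀ i hV

/-- Absorbing β - β₀ into Π_i gives the mean of the null error, and the index becomes the second
moment of a linear form in the independent r_j. -/
theorem powerIndex_eq : S.powerIndex β₀ = S.scale β₀ ^ 2 / n *
    ((∑ i, S.meanErr β₀ i * ∑ j, S.H i j * S.meanR β₀ j) ^ 2
      + ∑ j, (∑ i, S.meanErr β₀ i * S.H i j) ^ 2 * Var[S.r β₀ j; μ]) := by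
  have swap : ∀ f : Fin n → ℝ, ∑ i, S.firstStage i * ∑ j, S.H i j * f j
      = ∑ j, (∑ i, S.firstStage i * S.H i j) * f j := fun f => by
    simp only [Finset.mul_sum, Finset.sum_mul]
    rw [Finset.sum_comm]
    exact Finset.sum_congr rfl fun j _ => Finset.sum_congr rfl fun i _ => by ring
  have h := (integral_sq_sum_of_iIndepFun (S.memLp_r β₀) (S.iIndepFun_r β₀)
    (fun j => ∑ i, S.firstStage i * S.H i j)).2
  have e1 : ∑ i, S.meanErr β₀ i * ∑ j, S.H i j * S.meanR β₀ j
      = (S.β - β₀) * ∑ j, (∑ i, S.firstStage i * S.H i j) * S.meanR β₀ j := by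
    rw [← swap, Finset.mul_sum]
    exact Finset.sum_congr rfl fun i _ => by rw [meanErr]; ring
  have e2 : ∀ j, ∑ i, S.meanErr β₀ i * S.H i j
      = (S.β - β₀) * ∑ i, S.firstStage i * S.H i j := fun j => by
    rw [Finset.mul_sum]
    exact Finset.sum_congr rfl fun i _ => by rw [meanErr]; ring
  simp only [integral_r] at h
  simp only [powerIndex, fitI_eq, swap, mul_pow, div_pow, Real.sq_sqrt (Nat.cast_nonneg n)]
  rw [integral_const_mul, h, e1]
  simp only [e2, mul_pow, mul_assoc]
  rw [← Finset.mul_sum]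
  ring

theorem regularDesign (hc : 1 < c) (hm : S.MomentCond β₀ c) (hb : S.BalancedDesign β₀ c)
    (hl : S.LocalIdentification β₀ c) :
    RegularDesign S.H (S.scale β₀) (momentBound c) (S.meanErr β₀)
      (fun i => Var[S.nullErr β₀ i; μ]) (S.meanR β₀) (fun i => Var[S.r β₀ i; μ]) := by
  have hc0 : 0 < c := by linarith
  obtain ⟨hn, hs⟩ := hb.scale_pos hc0
  have hcK : c ≤ momentBound c := le_momentBound_self hc (by
    have := le_self_pow₀ hc.le (n := 12) (by norm_num); linarith)
  have hinv : (momentBound c)⁻¹ ≤ c⁻¹ := inv_anti₀ hc0 hcK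
  have hfit := S.integral_fitI_sq β₀
  refine ⟨hc.le.trans hcK, hn, hs, S.H_diag, fun i => ?_, fun i => ?_, fun i => ?_, fun i => ?_,
    fun j => ?_, fun j => ?_, ?_, ?_⟩
  · refine le_momentBound_self hc ?_
    have h1 : S.meanErr β₀ i ^ 2 ≤ c ^ 4 := by
      calc _ = |S.meanErr β₀ i| ^ 2 := (sq_abs _).symm
        _ ≤ (c ^ 2) ^ 2 := by gcongr; exact hm.abs_meanErr_le i
        _ = _ := by ring
    have h2 : c ^ 4 ≤ c ^ 12 := pow_le_pow_right₀ hc.le (by norm_num)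
    have h3 : c ≤ c ^ 12 := le_self_pow₀ hc.le (by norm_num)
    linarith [(hm.variance_bounds i).2.1]
  · exact hinv.trans (hm.variance_bounds i).1
  · exact hinv.trans (hm.variance_bounds i).2.2.1
  · rw [← (hfit i).2]; exact S.scale_sq_mul_le β₀ hs i
  · have := hb.leverage j
    rw [sum_ne_eq (fun j i => S.H i j ^ 2) (fun i => by rw [S.H_diag]; ring)] at this
    exact this.trans hcK
  · have h1 := hl.means j
    have e := integral_sq_sum_of_iIndepFun (S.memLp_nullErr β₀) (S.iIndepFun_nullErr β₀)
      (fun i => S.scale β₀ * S.H i j)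
    simp only [integral_nullErr] at e
    have e' : ∀ ω, S.scale β₀ * ∑ i with i ≠ j, S.H i j * S.nullErr β₀ i ω
        = ∑ i, S.scale β₀ * S.H i j * S.nullErr β₀ i ω := fun ω => by
      rw [sum_ne_eq (fun j i => S.H i j * S.nullErr β₀ i ω)
        (fun i => by rw [S.H_diag, zero_mul]), Finset.mul_sum]
      simp only [mul_assoc]
    simp only [e', e.2] at h1
    -- The assumed second moment is squared mean plus variance; only the mean is needed here, so the
    -- variance is dropped.
    have h2 : 0 ≤ ∑ i, (S.scale β₀ * S.H i j) ^ 2 * Var[S.nullErr β₀ i; μ] :=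
      Finset.sum_nonneg fun i _ => mul_nonneg (sq_nonneg _) (variance_nonneg _ _)
    simp only [mul_assoc] at h1 h2
    rw [← Finset.mul_sum] at h1
    linarith
  · have h1 := hb.average
    rw [integral_const_mul, integral_finsetSum _ fun i _ => (hfit i).1] at h1
    simp only [(hfit _).2] at h1
    exact hinv.trans h1
  · rw [← powerIndex_eq]; exact hl.power.trans hcK

/-- The threshold depends only on c and η, before the model and a are chosen, so it passes to the
supremum over a and to a sequence of models. -/
theorem exists_jackknife_comparison (hc : 1 < c) {η : ℝ} (hη : 0 < η) : ∃ n₀ : ℕ, ∀ n ≥ n₀,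
    ∀ {Ω : Type*} [MeasurableSpace Ω] {μ : Measure Ω} [IsProbabilityMeasure μ]
      {Ω' : Type*} [MeasurableSpace Ω'] {ν : Measure Ω'} [IsProbabilityMeasure ν]
      (S : IVSample μ n) {εt rt : Fin n → Ω' → ℝ}, S.IsGaussianAnalogue β₀ ν εt rt →
      S.MomentCond β₀ c → S.BalancedDesign β₀ c → S.LocalIdentification β₀ c → ∀ a,
      |μ.real {ω | S.JKI β₀ ω ≤ a} - ν.real {ω | S.JKG β₀ εt rt ω ≤ a}| ≤ η := by
  have hc0 : 0 < c := by linarith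
  have hK : 1 ≤ momentBound c := hc.le.trans (le_momentBound_self hc (by
    have := le_self_pow₀ hc.le (n := 12) (by norm_num); linarith))
  obtain ⟨n₀, h₀⟩ := exists_uniform_comparison hK hη
  refine ⟨n₀, fun n hn Ω _ μ _ Ω' _ ν _ S εt rt hG hm hb hl a => ?_⟩
  obtain ⟨hn0, hs⟩ := hb.scale_pos hc0
  have hV := fun i => (inv_pos.2 hc0).trans_le (hm.variance_bounds i).1
  have hI := fun {a : ℝ} (ha : 0 ≤ a) => measureReal_JKI_le (S := S) hs hn0 ha
  have hJ := fun {a : ℝ} (ha : 0 ≤ a) => hG.measureReal_JKG_le hs hn0 hV ha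
  rcases lt_or_ge a 0 with ha | ha
  -- Both statistics are nonnegative, so for negative a both events are empty.
  · have e1 : {ω | S.JKI β₀ ω ≤ a} = ∅ :=
      Set.eq_empty_of_forall_notMem fun ω hω => absurd (ha.trans_le (JKI_nonneg ω)) (not_lt.2 hω)
    have e2 : {ω | S.JKG β₀ εt rt ω ≤ a} = ∅ :=
      Set.eq_empty_of_forall_notMem fun ω hω => absurd (ha.trans_le (JKG_nonneg ω)) (not_lt.2 hω)
    rw [e1, e2]
    simpa using hη.le
  · rw [hI ha, hJ ha]
    refine h₀ n hn _ _ _ _ _ _ _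
      (fun i => Measure.isProbabilityMeasure_map (S.measurable_triple β₀ i).aemeasurable)
      (regularDesign hc hm hb hl) (hm.tripleMoments hc) (fun i => ?_) ?_ ?_ a ha
    · obtain ⟨-, v2, v3, v4⟩ := hm.variance_bounds i
      exact tripleMoments_gaussTriple hc (hV i).le v2 ((inv_pos.2 hc0).le.trans v3) v4
        (hm.abs_meanErr_le i) (hm.abs_meanR_le hc i)
    -- For general triples the denominator may be negative, and monotonicity in a is not automatic.
    -- Here it is inherited from the distribution function of the actual statistic.
    · intro a b ha hab
      rw [← hI ha, ← hI (ha.trans hab)]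
      exact measureReal_mono fun ω hω => le_trans hω hab
    · intro a b ha hab
      rw [← hJ ha, ← hJ (ha.trans hab)]
      exact measureReal_mono fun ω hω => le_trans hω hab

end IVSample

end JackknifeK

theorem mainTheorem3
    {Ω : ℕ → Type*} [∀ n, MeasurableSpace (Ω n)]
    (μ : ∀ n, Measure (Ω n)) [∀ n, IsProbabilityMeasure (μ n)]
    {Ω' : ℕ → Type*} [∀ n, MeasurableSpace (Ω' n)]
    (ν : ∀ n, Measure (Ω' n)) [∀ n, IsProbabilityMeasure (ν n)]
    (S : ∀ n, JackknifeK.IVSample (μ n) n)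
    (εt rt : ∀ n, Fin n → Ω' n → ℝ)
    (β₀ c : ℝ) (hc : 1 < c)
    (hG : ∀ᶠ n in atTop, (S n).IsGaussianAnalogue β₀ (ν n) (εt n) (rt n))
    (hmoment : ∀ᶠ n in atTop, (S n).MomentCond β₀ c)
    (hbalanced : ∀ᶠ n in atTop, (S n).BalancedDesign β₀ c)
    (hlocal : ∀ᶠ n in atTop, (S n).LocalIdentification β₀ c) :
    Tendsto (fun n : ℕ => ⨆ a : ℝ,
        |(μ n).real {ω | (S n).JKI β₀ ω ≤ a}
          - (ν n).real {ω | (S n).JKG β₀ (εt n) (rt n) ω ≤ a}|)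
      atTop (𝓝 0) := by
  rw [tendsto_order]
  constructor
  · exact fun b hb => .of_forall fun n => hb.trans_le (Real.iSup_nonneg fun a => abs_nonneg _)
  · intro b hb
    obtain ⟨n₀, h₀⟩ := JackknifeK.IVSample.exists_jackknife_comparison (β₀ := β₀) hc (half_pos hb)
    filter_upwards [eventually_ge_atTop n₀, hG, hmoment, hbalanced, hlocal] with n hn h1 h2 h3 h4
    exact (Real.iSup_le (h₀ n hn (S n) h1 h2 h3 h4) (half_pos hb).le).trans_lt (half_lt_self hb)
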